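/- Let $E\subset\mathbb R^2$ be a closed (not necessarily convex) polygon with $n\ge 3$ distinct, cyclically ordered vertices $\mathbf q_1,\dots,\mathbf q_n$; that is, $E$ is compact, it is the closure of its connected interior, and $\partial E$ is the simple closed polygonal curve with edges $[\mathbf q_i,\mathbf q_{i+1}]$, $\mathbf q_{n+1}=\mathbf q_1$ (flat angles are allowed). Let $\mathcal P(E)$ be the space of affine functions $m(\mathbf x)=a+\langle \mathbf b,\mathbf x\rangle$. For $\zeta\in H^1(E)\cap C(E)$, define the affine function $$\pi_{\mathcal P}\zeta(\mathbf x)=\frac1n\sum_{j=1}^n\zeta(\mathbf q_j)+\Big\langle\frac1{|E|}\int_E\nabla\zeta\,d\mathbf y,\ \mathbf x-\frac1n\sum_{j=1}^n\mathbf q_j\Big\rangle .$$ Let $\mathcal W(E)$ be the space of all $\zeta\in H^1(E)\cap C(E)$ which are affine on each edge of $E$ and satisfy $\Delta\zeta=0$ weakly in the interior of $E$. Let $\mathcal Z(E)$ be the space of all $\zeta\in H^1(E)\cap C(E)$ which are affine on each edge of $E$, whose weak Laplacian $\Delta\zeta$ in the interior of $E$ is an affine function, and which satisfy $$\forall m\in\mathcal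 P(E),\qquad \int_E\zeta\,m\,d\mathbf x=\int_E(\pi_{\mathcal P}\zeta)\,m\,d\mathbf x .$$ Then for every $i=1,\dots,n$ there exists a unique function $\zeta_i\in\mathcal Z(E)$ such that $\zeta_i(\mathbf q_j)=1$ if $j=i$ and $\zeta_i(\mathbf q_j)=0$ if $j\neq i$. Moreover, $\mathcal Z(E)$ has the same degrees of freedom as $\mathcal W(E)$: for every $(v_1,\dots,v_n)\in\mathbb R^n$ there exist a unique $z\in\mathcal Z(E)$ and a unique $w\in\mathcal W(E)$ such that $z(\mathbf q_j)=w(\mathbf q_j)=v_j$ for all $j=1,\dots,n$. -/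

import Mathlib

/-- The Euclidean plane. -/
abbrev Plane : Type := EuclideanSpace ℝ (Fin 2)

/-- A (closed, possibly non-convex) polygon with `n` vertices, cyclically ordered: a compact set which
is the closure of its connected interior, and whose boundary is the simple closed polygonal curve
with these vertices.  Flat angles are allowed at the vertices, and the numbering may run in either
direction. -/
structure PolygonalElement (n : ℕ) where
  /-- The polygon, as a subset of the plane. -/
  carrier : Set Plane
  /-- The closed polygonal curve bounding it, that is, the list of the vertices. -/
  curve : Polygon Plane n
  three_le : 3 ≤ n
  vertices_injective : Function.Injective curve.vertices
  /-- Two different edges meet at most in a common endpoint. -/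
  edge_inter : ∀ i j, i ≠ j → curve.edgeSet ℝ i ∩ curve.edgeSet ℝ j ⊆
    {curve i, curve (finRotate n i)} ∩ {curve j, curve (finRotate n j)}
  isCompact : IsCompact carrier
  isConnected_interior : IsConnected (interior carrier)
  closure_interior : closure (interior carrier) = carrier
  frontier_eq : frontier carrier = curve.boundary ℝ

namespace PolygonalElement

open MeasureTheory

noncomputable section

variable {n : ℕ} (E : PolygonalElement n)

theorem vertex_mem (i : Fin n) : E.curve i ∈ E.carrier := by
  have h : E.curve i ∈ frontier E.carrier := by
    rw [E.frontier_eq]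
    exact Set.mem_iUnion.2 ⟨i, left_mem_affineSegment ℝ _ _⟩
  exact E.isCompact.isClosed.frontier_subset h

/-- The `i`-th vertex, as a point of `E`. -/
def q (i : Fin n) : E.carrier := ⟨E.curve i, E.vertex_mem i⟩

/-- The Lebesgue measure on `E`. -/
def area : Measure E.carrier := Measure.comap (fun x : E.carrier => (x : Plane)) volume

/-- Test functions: smooth, with compact support contained in the interior of `E`. -/
structure IsTest (φ : Plane → ℝ) : Prop where
  contDiff : ContDiff ℝ (⊤ : ℕ∞) φ
  hasCompactSupport : HasCompactSupport φ
  tsupport_subset : tsupport φ ⊆ interior E.carrier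

/-- `G` is a square integrable weak gradient of `ζ` in (the interior of) `E`; only the values of `G`
on `E` matter. -/
structure HasWeakGradient (ζ : C(E.carrier, ℝ)) (G : Plane → Plane) : Prop where
  memLp : MemLp G 2 (volume.restrict E.carrier)
  integral_eq : ∀ φ, E.IsTest φ → ∀ v : Plane,
    ∫ x, ζ x * fderiv ℝ φ x v ∂E.area = -∫ x in E.carrier, inner ℝ (G x) v * φ x

/-- `ζ` belongs to the Sobolev space `H¹(E)`. (A continuous function on the compact set `E` is
square integrable.) -/
def MemH1 (ζ : C(E.carrier, ℝ)) : Prop := ∃ G, E.HasWeakGradient ζ G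

open Classical in
/-- The weak gradient `∇ζ` of `ζ ∈ H¹(E)`, which is unique up to a null set. -/
def weakGradient (ζ : C(E.carrier, ℝ)) : Plane → Plane :=
  if h : E.MemH1 ζ then h.choose else 0

/-- `Δζ = f` in the weak sense, in the interior of `E`. -/
def HasWeakLaplacian (ζ : C(E.carrier, ℝ)) (f : Plane → ℝ) : Prop :=
  ∀ φ, E.IsTest φ →
    ∫ x in E.carrier, inner ℝ (E.weakGradient ζ x) (gradient φ x) = -∫ x in E.carrier, f x * φ x

/-- The restriction of `ζ` to each edge of `E` is affine. -/
def IsAffineOnEdges (ζ : C(E.carrier, ℝ)) : Prop :=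
  ∀ i, ∃ a : Plane →ᵃ[ℝ] ℝ, ∀ x : E.carrier, (x : Plane) ∈ E.curve.edgeSet ℝ i → ζ x = a x

/-- The average of `ζ` over the vertices of `E`. -/
def vertexAverage (ζ : C(E.carrier, ℝ)) : ℝ := (1 / (n : ℝ)) * ∑ j, ζ (E.q j)

/-- The average position of the vertices of `E`. -/
def vertexCenter : Plane := (1 / (n : ℝ)) • ∑ j, E.curve j

/-- The average `⟨∇ζ⟩` of the gradient of `ζ` over `E`. -/
def averageGradient (ζ : C(E.carrier, ℝ)) : Plane := ⨍ x in E.carrier, E.weakGradient ζ x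

/-- The projection of `ζ` onto affine functions: the vertex average of `ζ`, plus the inner product
of `⟨∇ζ⟩` with the position relative to the average of the vertices. -/
def piP (ζ : C(E.carrier, ℝ)) : Plane →ᵃ[ℝ] ℝ where
  toFun x := E.vertexAverage ζ + inner ℝ (E.averageGradient ζ) (x - E.vertexCenter)
  linear := (innerSL ℝ (E.averageGradient ζ)).toLinearMap
  map_vadd' x v := by
    simp [add_sub_assoc, inner_add_right]
    ring

/-- The moments of `ζ` and of its projection against affine functions coincide. -/
def MomentsMatch (ζ : C(E.carrier, ℝ)) : Prop :=
  ∀ m : Plane →ᵃ[ℝ] ℝ, ∫ x, ζ x * m x ∂E.area = ∫ x in E.carrier, E.piP ζ x * m x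

/-! ### The conditions above are linear -/

theorem measurableSet_carrier : MeasurableSet E.carrier := E.isCompact.measurableSet

instance : IsFiniteMeasure (volume.restrict E.carrier) :=
  ⟨by simpa using E.isCompact.measure_lt_top⟩

instance : CompactSpace E.carrier := isCompact_iff_compactSpace.1 E.isCompact

instance : IsFiniteMeasure E.area :=
  ⟨by
    rw [area, comap_subtype_coe_apply E.measurableSet_carrier]
    simpa using E.isCompact.measure_lt_top⟩

theorem volume_edgeSet (i : Fin n) : volume (E.curve.edgeSet ℝ i) = 0 := by
  have hs : E.curve.edgeSet ℝ i ⊆ affineSpan ℝ {E.curve i, E.curve (finRotate n i)} := by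
    rw [Polygon.edgeSet, affineSegment_eq_segment, ← convexHull_pair]
    exact convexHull_subset_affineSpan _
  refine measure_mono_null hs (Measure.addHaar_affineSubspace _ _ ?_)
  intro h
  have h1 := finrank_vectorSpan_insert_le_set ℝ {E.curve (finRotate n i)} (E.curve i)
  rw [← direction_affineSpan, h, AffineSubspace.direction_top, vectorSpan_singleton] at h1
  simp at h1

theorem volume_frontier : volume (frontier E.carrier) = 0 := by
  rw [E.frontier_eq]
  exact measure_iUnion_null E.volume_edgeSet

variable {E}

theorem IsTest.integrable_inner {φ : Plane → ℝ} (hφ : E.IsTest φ) {G : Plane → Plane}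
    (hG : MemLp G 2 (volume.restrict E.carrier)) (v : Plane) :
    Integrable (fun x => inner ℝ (G x) v * φ x) (volume.restrict E.carrier) := by
  obtain ⟨C, hC⟩ := hφ.hasCompactSupport.exists_bound_of_continuous hφ.contDiff.continuous
  exact ((hG.integrable (by norm_num)).inner_const v).mul_bdd (c := C)
    hφ.contDiff.continuous.aestronglyMeasurable (Filter.Eventually.of_forall hC)

theorem IsTest.continuous_gradient {φ : Plane → ℝ} (hφ : E.IsTest φ) :
    Continuous (gradient φ) :=
  (InnerProductSpace.toDual ℝ Plane).symm.continuous.comp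
    (hφ.contDiff.continuous_fderiv (by simp))

theorem IsTest.integrable_inner_gradient {φ : Plane → ℝ} (hφ : E.IsTest φ) {G : Plane → Plane}
    (hG : MemLp G 2 (volume.restrict E.carrier)) :
    Integrable (fun x => inner ℝ (G x) (gradient φ x)) (volume.restrict E.carrier) := by
  have h2 : HasCompactSupport (gradient φ) :=
    (hφ.hasCompactSupport.fderiv (𝕜 := ℝ)).comp_left (map_zero _)
  obtain ⟨C, hC⟩ := h2.exists_bound_of_continuous hφ.continuous_gradient
  refine ((hG.integrable (by norm_num)).norm.mul_const C).mono'
    (hG.aestronglyMeasurable.inner hφ.continuous_gradient.aestronglyMeasurable) ?_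
  exact Filter.Eventually.of_forall fun x => (norm_inner_le_norm _ _).trans
    (mul_le_mul_of_nonneg_left (hC x) (norm_nonneg _))

theorem IsTest.integrable_mul {φ : Plane → ℝ} (hφ : E.IsTest φ) (m : Plane →ᵃ[ℝ] ℝ) :
    Integrable (fun x => m x * φ x) (volume.restrict E.carrier) :=
  ((m.continuous_of_finiteDimensional.mul hφ.contDiff.continuous).integrable_of_hasCompactSupport
    hφ.hasCompactSupport.mul_left).restrict

theorem integrable_mul_continuous (ζ : C(E.carrier, ℝ)) {f : Plane → ℝ} (hf : Continuous f) :
    Integrable (fun x : E.carrier => ζ x * f x) E.area :=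
  have hc : Continuous fun x : E.carrier => ζ x * f x :=
    ζ.continuous.mul (hf.comp continuous_subtype_val)
  BoundedContinuousFunction.integrable E.area (BoundedContinuousFunction.mkOfCompact ⟨_, hc⟩)

theorem HasWeakGradient.ae_eq {ζ : C(E.carrier, ℝ)} {G H : Plane → Plane}
    (hG : E.HasWeakGradient ζ G) (hH : E.HasWeakGradient ζ H) :
    G =ᵐ[volume.restrict E.carrier] H := by
  have hint : IntegrableOn (fun x => G x - H x) E.carrier :=
    (hG.memLp.integrable (by norm_num)).sub (hH.memLp.integrable (by norm_num))
  have hloc : LocallyIntegrableOn (fun x => G x - H x) (interior E.carrier) :=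
    (hint.mono_set interior_subset).locallyIntegrableOn
  have key := isOpen_interior.ae_eq_zero_of_integral_contDiff_smul_eq_zero hloc (by
    intro φ h1 h2 h3
    have hφ : E.IsTest φ := ⟨h1, h2, h3⟩
    obtain ⟨C, hC⟩ := h2.exists_bound_of_continuous h1.continuous
    have hI : IntegrableOn (fun x => φ x • (G x - H x)) E.carrier :=
      hint.bdd_smul C h1.continuous.aestronglyMeasurable (Filter.Eventually.of_forall hC)
    rw [← setIntegral_eq_integral_of_forall_compl_eq_zero (s := E.carrier)]
    · refine ext_inner_left ℝ fun v => ?_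
      rw [← integral_inner hI, inner_zero_right]
      have e := (hG.integral_eq φ hφ v).symm.trans (hH.integral_eq φ hφ v)
      rw [neg_inj, ← sub_eq_zero, ← integral_sub (hφ.integrable_inner hG.memLp v)
        (hφ.integrable_inner hH.memLp v)] at e
      rw [← e]
      congr 1
      ext x
      rw [inner_smul_right, real_inner_comm, inner_sub_left]
      ring
    · intro x hx
      rw [image_eq_zero_of_notMem_tsupport fun h => hx (interior_subset (h3 h)), zero_smul])
  have hf : ∀ᵐ x, x ∉ frontier E.carrier := measure_eq_zero_iff_ae_notMem.1 E.volume_frontier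
  rw [Filter.EventuallyEq, ae_restrict_iff' E.measurableSet_carrier]
  filter_upwards [key, hf] with x h1 h2 h3
  refine sub_eq_zero.1 (h1 ?_)
  by_contra h
  exact h2 ⟨subset_closure h3, h⟩

theorem HasWeakGradient.add {ζ η : C(E.carrier, ℝ)} {G H : Plane → Plane}
    (hG : E.HasWeakGradient ζ G) (hH : E.HasWeakGradient η H) :
    E.HasWeakGradient (ζ + η) (G + H) where
  memLp := hG.memLp.add hH.memLp
  integral_eq φ hφ v := by
    have hc : Continuous fun x => fderiv ℝ φ x v :=
      (hφ.contDiff.continuous_fderiv (by simp)).clm_apply continuous_const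
    simp only [ContinuousMap.add_apply, Pi.add_apply, inner_add_left, add_mul]
    rw [integral_add (integrable_mul_continuous ζ hc) (integrable_mul_continuous η hc),
      integral_add (hφ.integrable_inner hG.memLp v) (hφ.integrable_inner hH.memLp v),
      hG.integral_eq φ hφ v, hH.integral_eq φ hφ v, neg_add]

theorem HasWeakGradient.smul {ζ : C(E.carrier, ℝ)} {G : Plane → Plane} (c : ℝ)
    (hG : E.HasWeakGradient ζ G) : E.HasWeakGradient (c • ζ) (c • G) where
  memLp := hG.memLp.const_smul c
  integral_eq φ hφ v := by
    simp only [ContinuousMap.smul_apply, Pi.smul_apply, real_inner_smul_left, smul_eq_mul,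
      mul_assoc]
    rw [integral_const_mul, integral_const_mul, hG.integral_eq φ hφ v, mul_neg]

theorem hasWeakGradient_zero : E.HasWeakGradient 0 0 where
  memLp := MemLp.zero
  integral_eq φ hφ v := by simp

theorem MemH1.hasWeakGradient {ζ : C(E.carrier, ℝ)} (h : E.MemH1 ζ) :
    E.HasWeakGradient ζ (E.weakGradient ζ) := by
  rw [weakGradient, dif_pos h]
  exact h.choose_spec

theorem MemH1.weakGradient_add {ζ η : C(E.carrier, ℝ)} (h : E.MemH1 ζ) (h' : E.MemH1 η) :
    E.weakGradient (ζ + η) =ᵐ[volume.restrict E.carrier]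
      E.weakGradient ζ + E.weakGradient η :=
  have hs := h.hasWeakGradient.add h'.hasWeakGradient
  (MemH1.hasWeakGradient ⟨_, hs⟩).ae_eq hs

theorem MemH1.weakGradient_smul {ζ : C(E.carrier, ℝ)} (c : ℝ) (h : E.MemH1 ζ) :
    E.weakGradient (c • ζ) =ᵐ[volume.restrict E.carrier] c • E.weakGradient ζ :=
  have hs := h.hasWeakGradient.smul c
  (MemH1.hasWeakGradient ⟨_, hs⟩).ae_eq hs

theorem MemH1.averageGradient_add {ζ η : C(E.carrier, ℝ)} (h : E.MemH1 ζ) (h' : E.MemH1 η) :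
    E.averageGradient (ζ + η) = E.averageGradient ζ + E.averageGradient η := by
  simp only [averageGradient, setAverage_eq]
  rw [integral_congr_ae (h.weakGradient_add h'), ← smul_add]
  congr 1
  exact integral_add (h.hasWeakGradient.memLp.integrable (by norm_num))
    (h'.hasWeakGradient.memLp.integrable (by norm_num))

theorem MemH1.averageGradient_smul {ζ : C(E.carrier, ℝ)} (c : ℝ) (h : E.MemH1 ζ) :
    E.averageGradient (c • ζ) = c • E.averageGradient ζ := by
  simp only [averageGradient, setAverage_eq]
  rw [integral_congr_ae (h.weakGradient_smul c), smul_comm]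
  congr 1
  exact integral_smul c _

theorem MemH1.piP_add {ζ η : C(E.carrier, ℝ)} (h : E.MemH1 ζ) (h' : E.MemH1 η) (x : Plane) :
    E.piP (ζ + η) x = E.piP ζ x + E.piP η x := by
  change E.vertexAverage _ + inner ℝ (E.averageGradient _) _ = (E.vertexAverage _ + inner ℝ _ _) +
    (E.vertexAverage _ + inner ℝ _ _)
  rw [h.averageGradient_add h', inner_add_left]
  simp only [vertexAverage, ContinuousMap.add_apply, Finset.sum_add_distrib]
  ring

theorem MemH1.piP_smul {ζ : C(E.carrier, ℝ)} (c : ℝ) (h : E.MemH1 ζ) (x : Plane) :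
    E.piP (c • ζ) x = c * E.piP ζ x := by
  change E.vertexAverage _ + inner ℝ (E.averageGradient _) _ = c * (E.vertexAverage _ + inner ℝ _ _)
  rw [h.averageGradient_smul c, real_inner_smul_left]
  simp only [vertexAverage, ContinuousMap.smul_apply, smul_eq_mul, ← Finset.mul_sum]
  ring

theorem HasWeakLaplacian.add {ζ η : C(E.carrier, ℝ)} {m k : Plane →ᵃ[ℝ] ℝ} (h : E.MemH1 ζ)
    (h' : E.MemH1 η) (hm : E.HasWeakLaplacian ζ m) (hk : E.HasWeakLaplacian η k) :
    E.HasWeakLaplacian (ζ + η) (m + k : Plane →ᵃ[ℝ] ℝ) := by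
  intro φ hφ
  have e : (fun x => inner ℝ (E.weakGradient (ζ + η) x) (gradient φ x))
      =ᵐ[volume.restrict E.carrier] fun x => inner ℝ (E.weakGradient ζ x) (gradient φ x) +
        inner ℝ (E.weakGradient η x) (gradient φ x) := by
    filter_upwards [h.weakGradient_add h'] with x hx
    rw [hx, Pi.add_apply, inner_add_left]
  rw [integral_congr_ae e, integral_add (hφ.integrable_inner_gradient h.hasWeakGradient.memLp)
    (hφ.integrable_inner_gradient h'.hasWeakGradient.memLp), hm φ hφ, hk φ hφ, ← neg_add,
    ← integral_add (hφ.integrable_mul m) (hφ.integrable_mul k)]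
  simp only [AffineMap.coe_add, Pi.add_apply, add_mul]

theorem HasWeakLaplacian.smul {ζ : C(E.carrier, ℝ)} {m : Plane →ᵃ[ℝ] ℝ} (c : ℝ) (h : E.MemH1 ζ)
    (hm : E.HasWeakLaplacian ζ m) :
    E.HasWeakLaplacian (c • ζ) (c • m : Plane →ᵃ[ℝ] ℝ) := by
  intro φ hφ
  have e : (fun x => inner ℝ (E.weakGradient (c • ζ) x) (gradient φ x))
      =ᵐ[volume.restrict E.carrier] fun x =>
        c * inner ℝ (E.weakGradient ζ x) (gradient φ x) := by
    filter_upwards [h.weakGradient_smul c] with x hx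
    rw [hx, Pi.smul_apply, real_inner_smul_left]
  rw [integral_congr_ae e, integral_const_mul, hm φ hφ, mul_neg, ← integral_const_mul]
  simp only [AffineMap.coe_smul, Pi.smul_apply, smul_eq_mul, mul_assoc]

theorem hasWeakLaplacian_zero : E.HasWeakLaplacian 0 (0 : Plane →ᵃ[ℝ] ℝ) := by
  intro φ hφ
  have e : (fun x => inner ℝ (E.weakGradient 0 x) (gradient φ x))
      =ᵐ[volume.restrict E.carrier] fun _ => (0 : ℝ) := by
    filter_upwards [(MemH1.hasWeakGradient ⟨_, hasWeakGradient_zero⟩).ae_eq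
      (hasWeakGradient_zero (E := E))] with x hx
    rw [hx, Pi.zero_apply, inner_zero_left]
  rw [integral_congr_ae e]
  simp

theorem IsAffineOnEdges.add {ζ η : C(E.carrier, ℝ)} (h : E.IsAffineOnEdges ζ)
    (h' : E.IsAffineOnEdges η) : E.IsAffineOnEdges (ζ + η) := by
  intro i
  obtain ⟨a, ha⟩ := h i
  obtain ⟨b, hb⟩ := h' i
  exact ⟨a + b, fun x hx => by simp [ha x hx, hb x hx]⟩

theorem IsAffineOnEdges.smul {ζ : C(E.carrier, ℝ)} (c : ℝ) (h : E.IsAffineOnEdges ζ) :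
    E.IsAffineOnEdges (c • ζ) := by
  intro i
  obtain ⟨a, ha⟩ := h i
  exact ⟨c • a, fun x hx => by simp [ha x hx]⟩

theorem isAffineOnEdges_zero : E.IsAffineOnEdges 0 := fun _ => ⟨0, fun _ _ => by simp⟩

theorem MomentsMatch.add {ζ η : C(E.carrier, ℝ)} (h : E.MemH1 ζ) (h' : E.MemH1 η)
    (hm : E.MomentsMatch ζ) (hm' : E.MomentsMatch η) : E.MomentsMatch (ζ + η) := by
  intro m
  have hi : ∀ a : Plane →ᵃ[ℝ] ℝ, IntegrableOn (fun x => a x * m x) E.carrier := fun a =>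
    (a.continuous_of_finiteDimensional.mul m.continuous_of_finiteDimensional).continuousOn
      |>.integrableOn_compact E.isCompact
  simp only [ContinuousMap.add_apply, h.piP_add h', add_mul]
  rw [integral_add (integrable_mul_continuous ζ m.continuous_of_finiteDimensional)
    (integrable_mul_continuous η m.continuous_of_finiteDimensional), integral_add (hi _) (hi _),
    hm m, hm' m]

theorem MomentsMatch.smul {ζ : C(E.carrier, ℝ)} (c : ℝ) (h : E.MemH1 ζ)
    (hm : E.MomentsMatch ζ) : E.MomentsMatch (c • ζ) := by
  intro m
  simp only [ContinuousMap.smul_apply, h.piP_smul c, smul_eq_mul, mul_assoc]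
  rw [integral_const_mul, integral_const_mul, hm m]

variable (E)

/-! ### The local spaces -/

/-- The enlarged space: functions of `H¹(E) ∩ C(E)` which are affine on each edge and whose
Laplacian is an affine function. -/
def Wtilde : Submodule ℝ C(E.carrier, ℝ) where
  carrier := {ζ | E.MemH1 ζ ∧ E.IsAffineOnEdges ζ ∧ ∃ m : Plane →ᵃ[ℝ] ℝ, E.HasWeakLaplacian ζ m}
  add_mem' := by
    rintro ζ η ⟨h, ha, m, hm⟩ ⟨h', ha', k, hk⟩
    exact ⟨⟨_, h.hasWeakGradient.add h'.hasWeakGradient⟩, ha.add ha', m + k, hm.add h h' hk⟩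
  zero_mem' := ⟨⟨_, hasWeakGradient_zero⟩, isAffineOnEdges_zero, 0, hasWeakLaplacian_zero⟩
  smul_mem' := by
    rintro c ζ ⟨h, ha, m, hm⟩
    exact ⟨⟨_, h.hasWeakGradient.smul c⟩, ha.smul c, c • m, hm.smul c h⟩

/-- The space `W(E)`: functions of `H¹(E) ∩ C(E)` which are affine on each edge and harmonic
inside `E`. -/
def W : Submodule ℝ C(E.carrier, ℝ) where
  carrier := {ζ | E.MemH1 ζ ∧ E.IsAffineOnEdges ζ ∧ E.HasWeakLaplacian ζ (0 : Plane →ᵃ[ℝ] ℝ)}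
  add_mem' := by
    rintro ζ η ⟨h, ha, hm⟩ ⟨h', ha', hk⟩
    refine ⟨⟨_, h.hasWeakGradient.add h'.hasWeakGradient⟩, ha.add ha', ?_⟩
    simpa only [add_zero] using hm.add h h' hk
  zero_mem' := ⟨⟨_, hasWeakGradient_zero⟩, isAffineOnEdges_zero, hasWeakLaplacian_zero⟩
  smul_mem' := by
    rintro c ζ ⟨h, ha, hm⟩
    refine ⟨⟨_, h.hasWeakGradient.smul c⟩, ha.smul c, ?_⟩
    simpa only [smul_zero] using hm.smul c h

/-- The enhanced space `Z(E)`: the functions of the enlarged space whose moments against affine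
functions are those of their projection `piP`. -/
def Z : Submodule ℝ C(E.carrier, ℝ) where
  carrier := {ζ | ζ ∈ E.Wtilde ∧ E.MomentsMatch ζ}
  add_mem' := fun {_ _} h h' => ⟨E.Wtilde.add_mem h.1 h'.1, h.2.add h.1.1 h'.1.1 h'.2⟩
  zero_mem' := ⟨E.Wtilde.zero_mem, by
    intro m
    have h : ∀ x, E.piP 0 x = 0 := fun x => by
      simpa only [zero_smul, zero_mul] using
        MemH1.piP_smul (E := E) 0 ⟨_, hasWeakGradient_zero⟩ x
    simp only [h, ContinuousMap.zero_apply, zero_mul, integral_zero]⟩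
  smul_mem' := fun c _ h => ⟨E.Wtilde.smul_mem c h.1, h.2.smul c h.1.1⟩

/-- The degrees of freedom: the linear map sending a function to its values at the vertices. -/
def dof : C(E.carrier, ℝ) →ₗ[ℝ] (Fin n → ℝ) where
  toFun ζ j := ζ (E.q j)
  map_add' _ _ := rfl
  map_smul' _ _ := rfl

end

end PolygonalElement

namespace PolygonalElement

open MeasureTheory Filter Topology

/-! For `W`: a function that is affine on edges is determined on `∂E` by its vertex values, so
injectivity of the degrees of freedom is the maximum principle and surjectivity is the Dirichlet
problem with continuous, edgewise affine data.

For `Z`: let `b_m` (`bubble`) solve `Δ b_m = m` with zero boundary values. Its vertex average and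
its mean gradient both vanish, so its projection onto affine functions is zero; moreover `∫ b_m m =
-∫ |∇ b_m|²`, which vanishes only for `m = 0`. If `z ∈ Z` has zero vertex values, then `z = b_m` for
some `m`, the moment condition gives `∫ b_m m = 0`, and `z = 0`. Conversely, `m ↦ (k ↦ ∫ b_m k)` is
an injective map from the affine functions to their dual, hence bijective by dimension
(`surjective_moment_bubble`). So the function `w ∈ W` with given vertex values can be corrected by
the bubble whose moments are those of `π w - w`; the correction changes neither the vertex values
nor the projection.

The analytic work is to solve the Dirichlet problem in `H¹(E) ∩ C(E)` on an arbitrary polygon. Zero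
trace is understood as membership in the closure of the test functions (`HasTrace`). For smooth
data, orthogonal projection in `L²` gives a weak solution (`exists_hasTrace`), and Weyl's lemma
makes it continuous inside (`exists_continuousOn_of_lap_eq_zero`). Continuity at the boundary comes
from barriers: every boundary point `p` is an endpoint of a segment `[p, q] ⊆ ∂E`, and with `s = ((z
- p) / (z - q)) ^ (1/4)` the function `Re (s / (1 + s))` is harmonic off that segment, has a square
integrable gradient, tends to `0` at `p` and is bounded below by a positive constant away from `p`
(`exists_barrier`). No information on the angles of `E` is needed. A weak comparison principle
(`HasTrace.ae_le`) traps the solution below a multiple of the barrier.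

The edgewise affine data are only Lipschitz. They are approximated uniformly by smooth functions
with the same Lipschitz constant: the solutions converge uniformly by the maximum principle, and
their gradients are bounded in `L²` by the Dirichlet principle, so a weak limit of the gradients is
the gradient of the limit (`exists_dirichlet_of_lipschitz`).

Uniqueness never uses that an `H¹` function with zero boundary values is a limit of test functions:
the maximum principle is proved for continuous distributional solutions. -/

theorem toReal_eLpNorm_add_le {α F : Type*} [MeasurableSpace α] {μ : Measure α}
    [NormedAddCommGroup F] {A B : α → F} (hA : MemLp A 2 μ) (hB : MemLp B 2 μ) :
    (eLpNorm (A + B) 2 μ).toReal ≤ (eLpNorm A 2 μ).toReal + (eLpNorm B 2 μ).toReal := by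
  rw [← ENNReal.toReal_add hA.2.ne hB.2.ne]
  exact ENNReal.toReal_mono (by simp [hA.2.ne, hB.2.ne])
    (eLpNorm_add_le hA.1 hB.1 (by norm_num))

/-! ### Inner products and the Cauchy–Schwarz inequality in `L²`. -/

section L2

variable {α F : Type*} [MeasurableSpace α] {μ : Measure α} [NormedAddCommGroup F]
  [InnerProductSpace ℝ F] {A B : α → F}

theorem integrable_inner_of_memLp (hA : MemLp A 2 μ) (hB : MemLp B 2 μ) :
    Integrable (fun x => inner ℝ (A x) (B x)) μ := by
  refine (L2.integrable_inner (𝕜 := ℝ) (hA.toLp A) (hB.toLp B)).congr ?_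
  filter_upwards [hA.coeFn_toLp, hB.coeFn_toLp] with x h1 h2
  rw [h1, h2]

theorem inner_toLp (hA : MemLp A 2 μ) (hB : MemLp B 2 μ) :
    inner ℝ (hA.toLp A) (hB.toLp B) = ∫ x, inner ℝ (A x) (B x) ∂μ := by
  rw [L2.inner_def]
  refine integral_congr_ae ?_
  filter_upwards [hA.coeFn_toLp, hB.coeFn_toLp] with x h1 h2
  rw [h1, h2]

theorem abs_integral_inner_le (hA : MemLp A 2 μ) (hB : MemLp B 2 μ) :
    |∫ x, inner ℝ (A x) (B x) ∂μ| ≤ (eLpNorm A 2 μ).toReal * (eLpNorm B 2 μ).toReal := by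
  rw [← inner_toLp hA hB, ← Lp.norm_toLp A hA, ← Lp.norm_toLp B hB]
  exact abs_real_inner_le_norm _ _

theorem integral_inner_self (hA : MemLp A 2 μ) :
    ∫ x, inner ℝ (A x) (A x) ∂μ = (eLpNorm A 2 μ).toReal ^ 2 := by
  rw [← inner_toLp hA hA, ← Lp.norm_toLp A hA, real_inner_self_eq_norm_sq]

theorem abs_integral_mul_le {f g : α → ℝ} (hf : MemLp f 2 μ) (hg : MemLp g 2 μ) :
    |∫ x, f x * g x ∂μ| ≤ (eLpNorm f 2 μ).toReal * (eLpNorm g 2 μ).toReal := by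
  simpa [mul_comm] using abs_integral_inner_le hg hf

end L2

/-! ### Calculus of test functions and the Poincaré inequality. -/

section TestFunctions

variable {n : ℕ} {E : PolygonalElement n} {φ ψ : Plane → ℝ}

theorem memLp_of_continuousOn {F : Type*} [NormedAddCommGroup F] {f : Plane → F}
    (hf : ContinuousOn f E.carrier) (p : ENNReal) : MemLp f p (volume.restrict E.carrier) := by
  obtain ⟨C, hC⟩ := E.isCompact.exists_bound_of_continuousOn hf
  refine MemLp.of_bound (hf.aestronglyMeasurable_of_isCompact E.isCompact E.measurableSet_carrier) C ?_
  filter_upwards [ae_restrict_mem E.measurableSet_carrier] with x hx using hC x hx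

theorem ae_mem_interior (E : PolygonalElement n) :
    ∀ᵐ x ∂volume.restrict E.carrier, x ∈ interior E.carrier := by
  have hf : ∀ᵐ x, x ∉ frontier E.carrier := measure_eq_zero_iff_ae_notMem.1 E.volume_frontier
  rw [ae_restrict_iff' E.measurableSet_carrier]
  filter_upwards [hf] with x h1 h2
  by_contra h
  exact h1 ⟨subset_closure h2, h⟩

namespace IsTest

theorem setIntegral_eq {f : Plane → ℝ} (hφ : E.IsTest φ) (hf : Function.support f ⊆ tsupport φ) :
    ∫ x in E.carrier, f x = ∫ x, f x := by
  refine setIntegral_eq_integral_of_forall_compl_eq_zero fun x hx => ?_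
  by_contra h
  exact hx (interior_subset (hφ.tsupport_subset (hf h)))

theorem zero : E.IsTest 0 := ⟨contDiff_const, .zero, by simp⟩

theorem add (hφ : E.IsTest φ) (hψ : E.IsTest ψ) : E.IsTest (φ + ψ) :=
  ⟨hφ.1.add hψ.1, hφ.2.add hψ.2, (tsupport_add φ ψ).trans
    (Set.union_subset hφ.3 hψ.3)⟩

theorem smul (c : ℝ) (hφ : E.IsTest φ) : E.IsTest (c • φ) :=
  ⟨contDiff_const.smul hφ.1, hφ.2.smul_left (f := fun _ => c),
    (tsupport_smul_subset_right (fun _ => c) φ).trans hφ.3⟩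

theorem neg (hφ : E.IsTest φ) : E.IsTest (-φ) := by simpa using hφ.smul (-1)

theorem sub (hφ : E.IsTest φ) (hψ : E.IsTest ψ) : E.IsTest (φ - ψ) := by
  simpa [sub_eq_add_neg] using hφ.add hψ.neg

theorem fderiv_apply (hφ : E.IsTest φ) (v : Plane) : E.IsTest fun x => fderiv ℝ φ x v :=
  have h : tsupport (fun x => fderiv ℝ φ x v) ⊆ tsupport φ := tsupport_fderiv_apply_subset ℝ v
  ⟨(hφ.1.fderiv_right (m := (⊤ : ℕ∞)) (by simp)).clm_apply contDiff_const,
    hφ.2.mono' (subset_closure.trans h), h.trans hφ.3⟩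

theorem mul_continuousOn (hφ : E.IsTest φ) {f : Plane → ℝ} (hf : ContinuousOn f (interior E.carrier)) :
    Integrable fun x => f x * φ x := by
  have h : tsupport (fun x => f x * φ x) ⊆ tsupport φ := tsupport_mul_subset_right
  refine Continuous.integrable_of_hasCompactSupport (continuous_of_tsupport fun x hx => ?_)
    (hφ.2.mono' (subset_closure.trans h))
  exact (hf.continuousAt (isOpen_interior.mem_nhds (hφ.3 (h hx)))).mul hφ.1.continuous.continuousAt

/-- Only the interior matters, because the support of `φ` is a compact subset of it. Hence `f` may
be singular at the boundary, as the barriers below are, and no regularity of `∂E` enters. -/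
theorem integral_mul_fderiv (hφ : E.IsTest φ) {f : Plane → ℝ}
    (hf : ContDiffOn ℝ 1 f (interior E.carrier)) (v : Plane) :
    ∫ x in E.carrier, f x * fderiv ℝ φ x v = -∫ x in E.carrier, fderiv ℝ f x v * φ x := by
  rw [hφ.setIntegral_eq, hφ.setIntegral_eq]
  · refine integral_mul_fderiv_eq_neg_fderiv_mul_of_integrable ?_ ?_ ?_ ?_ ?_
    · exact hφ.mul_continuousOn
        ((hf.continuousOn_fderiv_of_isOpen isOpen_interior le_rfl).clm_apply continuousOn_const)
    · exact (hφ.fderiv_apply v).mul_continuousOn hf.continuousOn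
    · exact hφ.mul_continuousOn hf.continuousOn
    · exact fun x hx => (hf.contDiffAt (isOpen_interior.mem_nhds (hφ.3 hx))).differentiableAt (by simp)
    · exact fun x _ => hφ.1.differentiable (by simp) x
  · exact fun x hx => subset_closure fun h => hx (by simp [h])
  · exact fun x hx => tsupport_fderiv_apply_subset ℝ v (subset_closure fun h => hx (by simp [h]))

theorem integral_fderiv (hφ : E.IsTest φ) (v : Plane) :
    ∫ x in E.carrier, fderiv ℝ φ x v = 0 := by
  simpa using hφ.integral_mul_fderiv (f := fun _ => 1) contDiffOn_const v

theorem memLp (hφ : E.IsTest φ) (p : ENNReal) : MemLp φ p (volume.restrict E.carrier) :=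
  memLp_of_continuousOn hφ.1.continuous.continuousOn p

theorem memLp_gradient (hφ : E.IsTest φ) (p : ENNReal) :
    MemLp (gradient φ) p (volume.restrict E.carrier) :=
  memLp_of_continuousOn hφ.continuous_gradient.continuousOn p

theorem gradient_add (hφ : E.IsTest φ) (hψ : E.IsTest ψ) :
    gradient (φ + ψ) = gradient φ + gradient ψ := by
  ext1 x
  simp [gradient, fderiv_add (hφ.1.differentiable (by simp) x) (hψ.1.differentiable (by simp) x)]

theorem gradient_smul (c : ℝ) (hφ : E.IsTest φ) : gradient (c • φ) = c • gradient φ := by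
  ext1 x
  simp [gradient, fderiv_const_smul (hφ.1.differentiable (by simp) x)]

theorem gradient_sub (hφ : E.IsTest φ) (hψ : E.IsTest ψ) :
    gradient (φ - ψ) = gradient φ - gradient ψ := by
  ext1 x
  simp [gradient, fderiv_sub (hφ.1.differentiable (by simp) x) (hψ.1.differentiable (by simp) x)]

end IsTest

/-- The Poincaré inequality. -/
theorem exists_eLpNorm_le_eLpNorm_gradient (E : PolygonalElement n) :
    ∃ C : NNReal, ∀ φ, E.IsTest φ → eLpNorm φ 2 (volume.restrict E.carrier) ≤
      C * eLpNorm (gradient φ) 2 (volume.restrict E.carrier) := by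
  -- Gagliardo–Nirenberg–Sobolev: in dimension two, the Sobolev exponent conjugate to `1` is `2`.
  obtain ⟨D, hD⟩ : ∃ D : NNReal, ∀ φ : Plane → ℝ, E.IsTest φ →
      eLpNorm φ 2 volume ≤ D * eLpNorm (gradient φ) 1 volume := by
    refine ⟨eLpNormLESNormFDerivOfLeConst ℝ volume E.carrier 1 2, fun φ hφ => ?_⟩
    have hs : Function.support φ ⊆ E.carrier := fun x hx =>
      interior_subset (hφ.3 (subset_closure hx))
    have hn : eLpNorm (gradient φ) 1 volume = eLpNorm (fderiv ℝ φ) 1 volume :=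
      eLpNorm_congr_norm_ae (Eventually.of_forall fun x => by simp [gradient])
    rw [hn]
    exact eLpNorm_le_eLpNorm_fderiv_of_le (volume : Measure Plane) (u := φ) (s := E.carrier)
      (hφ.1.of_le (by simp)) hs (p := 1) (q := 2) le_rfl (by simp) (by simp; norm_num)
      E.isCompact.isBounded
  refine ⟨D * (volume E.carrier ^ (1 / 2 : ℝ)).toNNReal, fun φ hφ => ?_⟩
  have hs : Function.support φ ⊆ E.carrier := fun x hx =>
    interior_subset (hφ.3 (subset_closure hx))
  have hs' : Function.support (gradient φ) ⊆ E.carrier := fun x hx =>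
    interior_subset (hφ.3 (support_fderiv_subset ℝ (f := φ) fun h => hx (by simp [gradient, h])))
  -- Hölder's inequality on `E`, of finite area, turns the `L¹` norm of the gradient into its `L²`
  -- norm, at the price of the factor `|E| ^ (1/2)`.
  have h2 := eLpNorm_le_eLpNorm_mul_rpow_measure_univ (μ := volume.restrict E.carrier)
    (p := 1) (q := 2) (by norm_num) hφ.continuous_gradient.aestronglyMeasurable
  have he : (1 : ENNReal).toReal⁻¹ - (2 : ENNReal).toReal⁻¹ = 1 / 2 := by norm_num
  rw [eLpNorm_restrict_eq_of_support_subset (p := 1) hs', Measure.restrict_apply_univ, one_div,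
    one_div, he] at h2
  rw [eLpNorm_restrict_eq_of_support_subset hs, ENNReal.coe_mul, mul_assoc,
    ENNReal.coe_toNNReal (ENNReal.rpow_ne_top_of_nonneg (by norm_num) E.isCompact.measure_lt_top.ne)]
  exact (hD φ hφ).trans (by gcongr; rwa [mul_comm])

end TestFunctions

/-! ### Radial averages and Weyl's lemma. -/

noncomputable section

/-- A smooth nondecreasing function, equal to `-1` on `(-∞, 0]` and to `0` on `[1, ∞)`. -/
def profile (t : ℝ) : ℝ := -Real.smoothTransition (1 - t)

theorem contDiff_profile {m : ℕ∞} : ContDiff ℝ m profile :=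
  (Real.smoothTransition.contDiff.comp (contDiff_const.sub contDiff_id)).neg

theorem profile_eq_zero {t : ℝ} (ht : 1 ≤ t) : profile t = 0 := by
  simp [profile, Real.smoothTransition.zero_of_nonpos (sub_nonpos.2 ht)]

theorem profile_eq_neg_one {t : ℝ} (ht : t ≤ 0) : profile t = -1 := by
  simp [profile, Real.smoothTransition.one_of_one_le (by linarith : 1 ≤ 1 - t)]

theorem monotone_profile : Monotone profile := fun s t h =>
  neg_le_neg (Real.smoothTransition.monotone (by linarith))

theorem deriv_profile_nonneg (t : ℝ) : 0 ≤ deriv profile t := monotone_profile.deriv_nonneg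

theorem contDiff_deriv_profile : ContDiff ℝ (⊤ : ℕ∞) (deriv profile) :=
  (contDiff_infty_iff_deriv.1 contDiff_profile).2

theorem support_deriv_profile_subset : Function.support (deriv profile) ⊆ Set.Icc 0 1 := by
  intro t ht
  by_contra h
  rw [Set.mem_Icc, not_and_or, not_le, not_le] at h
  apply ht
  obtain h | h := h
  · have : profile =ᶠ[𝓝 t] fun _ => -1 := by
      filter_upwards [Iio_mem_nhds h] with s hs using profile_eq_neg_one (Set.mem_Iio.1 hs).le
    rw [this.deriv_eq, deriv_const]
  · have : profile =ᶠ[𝓝 t] fun _ => 0 := by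
      filter_upwards [Ioi_mem_nhds h] with s hs using profile_eq_zero (Set.mem_Ioi.1 hs).le
    rw [this.deriv_eq, deriv_const]

theorem hasCompactSupport_deriv_profile : HasCompactSupport (deriv profile) :=
  .of_support_subset_isCompact isCompact_Icc support_deriv_profile_subset

theorem exists_deriv_profile_pos : ∃ t, 0 < t ∧ t < 1 ∧ 0 < deriv profile t := by
  obtain ⟨t, ht, h⟩ := exists_deriv_eq_slope profile zero_lt_one
    (contDiff_profile (m := 1)).continuous.continuousOn
    ((contDiff_profile (m := 1)).differentiable (by simp)).differentiableOn
  refine ⟨t, ht.1, ht.2, ?_⟩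
  rw [h, profile_eq_zero le_rfl, profile_eq_neg_one le_rfl]
  norm_num

/-- Radial averaging kernels, up to normalization. -/
def kernel (a : ℝ) (z : Plane) : ℝ := a * deriv profile (a * ‖z‖ ^ 2)

/-- The integral of the radial averaging kernels. -/
def kernelMass : ℝ := ∫ z : Plane, deriv profile (‖z‖ ^ 2)

theorem continuous_kernel (a : ℝ) : Continuous (kernel a) :=
  continuous_const.mul (contDiff_deriv_profile.continuous.comp (by fun_prop))

theorem kernel_nonneg {a : ℝ} (ha : 0 ≤ a) (z : Plane) : 0 ≤ kernel a z :=
  mul_nonneg ha (deriv_profile_nonneg _)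

theorem mul_norm_sq_le_of_kernel_ne_zero {a : ℝ} {z : Plane} (h : kernel a z ≠ 0) :
    a * ‖z‖ ^ 2 ≤ 1 :=
  (support_deriv_profile_subset (right_ne_zero_of_mul h)).2

theorem hasCompactSupport_kernel {a : ℝ} (ha : 0 < a) : HasCompactSupport (kernel a) := by
  refine .of_support_subset_isCompact (isCompact_closedBall 0 (√(a⁻¹))) fun z hz => ?_
  have h := mul_norm_sq_le_of_kernel_ne_zero hz
  rw [mem_closedBall_zero_iff]
  refine Real.le_sqrt_of_sq_le ?_
  rwa [← one_div, le_div_iff₀' ha]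

theorem exists_kernel_le : ∃ C, ∀ a, 0 ≤ a → ∀ z, ‖kernel a z‖ ≤ a * C := by
  obtain ⟨C, hC⟩ := hasCompactSupport_deriv_profile.exists_bound_of_continuous
    contDiff_deriv_profile.continuous
  refine ⟨C, fun a ha z => ?_⟩
  rw [kernel, norm_mul, Real.norm_of_nonneg ha]
  exact mul_le_mul_of_nonneg_left (hC _) ha

theorem kernelMass_pos : 0 < kernelMass := by
  obtain ⟨t, h0, h1, ht⟩ := exists_deriv_profile_pos
  have hk : kernel 1 = fun z => deriv profile (‖z‖ ^ 2) := by ext z; simp [kernel]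
  rw [kernelMass, ← hk]
  refine (continuous_kernel 1).integral_pos_of_hasCompactSupport_nonneg_nonzero
    (hasCompactSupport_kernel one_pos) (kernel_nonneg zero_le_one)
    (x := EuclideanSpace.single 0 (√t)) ?_
  simp [kernel, Real.sq_sqrt h0.le, ht.ne']

/-- The factor `a` in `kernel` is the Jacobian of the dilation by `√a` in the plane. -/
theorem integral_kernel {a : ℝ} (ha : 0 < a) : ∫ z, kernel a z = kernelMass := by
  have h := Measure.integral_comp_smul (volume : Measure Plane)
    (fun z => deriv profile (‖z‖ ^ 2)) (√a)
  have h2 : ∀ z : Plane, ‖√a • z‖ ^ 2 = a * ‖z‖ ^ 2 := fun z => by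
    rw [norm_smul, mul_pow, Real.norm_eq_abs, sq_abs, Real.sq_sqrt ha.le]
  simp only [h2, finrank_euclideanSpace, Fintype.card_fin, Real.sq_sqrt ha.le] at h
  simp only [kernel, integral_const_mul, h, kernelMass, smul_eq_mul, abs_inv, abs_of_pos ha]
  field_simp

/-- The Laplacian of a function on the plane. -/
def lap (ψ : Plane → ℝ) (y : Plane) : ℝ :=
  ∑ i, fderiv ℝ (fun z => fderiv ℝ ψ z (EuclideanSpace.single i 1)) y (EuclideanSpace.single i 1)

/-- A radial function whose Laplacian is the derivative of the averaging kernel. -/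
def kernelPrimitive (a : ℝ) (x y : Plane) : ℝ := (4 * a)⁻¹ * profile (a * ‖y - x‖ ^ 2)

/-- In the plane, the Laplacian of `F (‖y‖ ^ 2)` is `4 F' + 4 ‖y‖ ^ 2 F''`. The right-hand side is
also the derivative of `kernel a (y - x)` with respect to `a`, which is the point of the factor `(4
* a)⁻¹`. -/
theorem lap_kernelPrimitive {a : ℝ} (ha : 0 < a) (x y : Plane) :
    lap (kernelPrimitive a x) y = deriv profile (a * ‖y - x‖ ^ 2) +
      a * ‖y - x‖ ^ 2 * deriv (deriv profile) (a * ‖y - x‖ ^ 2) := by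
  have h0 : ∀ y, HasFDerivAt (fun y => a * ‖y - x‖ ^ 2) (a • (2 • innerSL ℝ (y - x))) y :=
    fun y => (((hasFDerivAt_id y).sub_const x).norm_sq.const_mul a)
  have h1 : ∀ y v, fderiv ℝ (kernelPrimitive a x) y v =
      2⁻¹ * (deriv profile (a * ‖y - x‖ ^ 2) * inner ℝ v (y - x)) := fun y v => by
    have hd : HasDerivAt profile (deriv profile (a * ‖y - x‖ ^ 2)) (a * ‖y - x‖ ^ 2) :=
      ((contDiff_profile (m := 1)).differentiable (by simp) _).hasDerivAt
    have := (hd.comp_hasFDerivAt y (h0 y)).const_mul (4 * a)⁻¹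
    have e : fderiv ℝ (kernelPrimitive a x) y = _ := this.fderiv
    rw [e]
    simp only [_root_.smul_apply, innerSL_apply_apply, smul_eq_mul, nsmul_eq_mul, real_inner_comm v]
    field_simp
    push_cast
    ring
  have h2 : ∀ v, fderiv ℝ (fun z => fderiv ℝ (kernelPrimitive a x) z v) y v =
      2⁻¹ * (deriv profile (a * ‖y - x‖ ^ 2) * inner ℝ v v + 
        2 * a * deriv (deriv profile) (a * ‖y - x‖ ^ 2) * inner ℝ v (y - x) ^ 2) := fun v => by
    simp only [h1]
    have hd : HasDerivAt (deriv profile) (deriv (deriv profile) (a * ‖y - x‖ ^ 2))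
      (a * ‖y - x‖ ^ 2) := (contDiff_deriv_profile.differentiable (by simp) _).hasDerivAt
    have hi : HasFDerivAt (fun y => inner ℝ v (y - x)) (innerSL ℝ v) y :=
      (innerSL ℝ v).hasFDerivAt.comp y ((hasFDerivAt_id y).sub_const x)
    have := ((hd.comp_hasFDerivAt y (h0 y)).mul hi).const_mul 2⁻¹
    have e : fderiv ℝ (fun z => 2⁻¹ * (deriv profile (a * ‖z - x‖ ^ 2) * inner ℝ v (z - x))) y =
      _ := this.fderiv
    rw [e]
    simp only [_root_.smul_apply, _root_.add_apply, innerSL_apply_apply,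
      smul_eq_mul, nsmul_eq_mul, real_inner_comm v, Function.comp_apply]
    push_cast
    ring
  simp only [lap, h2, Fin.sum_univ_two]
  have hn : ‖y - x‖ ^ 2 = (y - x) 0 ^ 2 + (y - x) 1 ^ 2 := by
    rw [EuclideanSpace.norm_sq_eq, Fin.sum_univ_two]; simp
  simp only [hn, EuclideanSpace.inner_single_left]
  simp
  ring

variable {n : ℕ} {E : PolygonalElement n}

theorem isTest_kernelPrimitive {a : ℝ} {x : Plane}
    (hx : ∀ z, a * ‖z - x‖ ^ 2 ≤ 1 → z ∈ interior E.carrier) : E.IsTest (kernelPrimitive a x) := by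
  have hc : IsClosed {z : Plane | a * ‖z - x‖ ^ 2 ≤ 1} := isClosed_le (by fun_prop) continuous_const
  have hs : Function.support (kernelPrimitive a x) ⊆ {z : Plane | a * ‖z - x‖ ^ 2 ≤ 1} := fun z hz => by
    by_contra h
    exact hz (by simp [kernelPrimitive, profile_eq_zero (not_le.1 h).le])
  have ht : tsupport (kernelPrimitive a x) ⊆ {z : Plane | a * ‖z - x‖ ^ 2 ≤ 1} :=
    closure_minimal hs hc
  refine ⟨contDiff_const.mul (contDiff_profile.comp (contDiff_const.mul
    ((contDiff_id.sub contDiff_const).norm_sq ℝ))), ?_, fun z hz => hx z (ht hz)⟩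
  exact E.isCompact.of_isClosed_subset (isClosed_tsupport _) fun z hz => interior_subset (hx z (ht hz))

/-- The (unnormalized) radial average of `u` around `x`. -/
def radialAverage (E : PolygonalElement n) (u : Plane → ℝ) (a : ℝ) (x : Plane) : ℝ :=
  ∫ y in E.carrier, u y * kernel a (y - x)

theorem hasDerivAt_radialAverage {u : Plane → ℝ} (hu : IntegrableOn u E.carrier) {a : ℝ}
    (ha : 0 < a) (x : Plane) :
    HasDerivAt (fun a => E.radialAverage u a x)
      (∫ y in E.carrier, u y * lap (kernelPrimitive a x) y) a := by
  set k : ℝ → ℝ := fun t => deriv profile t + t * deriv (deriv profile) t with hk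
  have hkc : Continuous k := contDiff_deriv_profile.continuous.add (continuous_id.mul
    (contDiff_deriv_profile.continuous_deriv (by simp)))
  obtain ⟨C, hC⟩ := (hasCompactSupport_deriv_profile.add
    (hasCompactSupport_deriv_profile.deriv.mul_left (f := fun t => t))).exists_bound_of_continuous hkc
  obtain ⟨K, hK⟩ := exists_kernel_le
  have key := hasDerivAt_integral_of_dominated_loc_of_deriv_le (μ := volume.restrict E.carrier)
    (F := fun a y => u y * kernel a (y - x)) (F' := fun a y => u y * k (a * ‖y - x‖ ^ 2))
    (x₀ := a) (s := Set.univ) (bound := fun y => ‖u y‖ * C) univ_mem ?_ ?_ ?_ ?_ ?_ ?_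
  · refine key.2.congr_deriv ?_
    simp only [lap_kernelPrimitive ha, hk]
  · exact Eventually.of_forall fun b => hu.aestronglyMeasurable.mul
      ((continuous_kernel b).comp (by fun_prop)).aestronglyMeasurable
  · exact hu.mul_bdd (c := a * K) ((continuous_kernel a).comp (by fun_prop)).aestronglyMeasurable
      (Eventually.of_forall fun y => hK a ha.le _)
  · exact hu.aestronglyMeasurable.mul (hkc.comp (by fun_prop)).aestronglyMeasurable
  · refine Eventually.of_forall fun y b _ => ?_
    rw [norm_mul]
    exact mul_le_mul_of_nonneg_left (hC _) (norm_nonneg _)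
  · exact hu.norm.mul_const C
  · refine Eventually.of_forall fun y b _ => ?_
    have hd : HasDerivAt (deriv profile) (deriv (deriv profile) (b * ‖y - x‖ ^ 2))
      (b * ‖y - x‖ ^ 2) := (contDiff_deriv_profile.differentiable (by simp) _).hasDerivAt
    have hl : HasDerivAt (fun b => b * ‖y - x‖ ^ 2) (‖y - x‖ ^ 2) b := by
      simpa using (hasDerivAt_id b).mul_const (‖y - x‖ ^ 2)
    have := ((hasDerivAt_id b).mul (hd.comp b hl)).const_mul (u y)
    refine this.congr_deriv ?_
    simp only [hk, Function.comp_apply, id]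
    ring

/-- The derivative of the average in `a` is the integral of `u` against the Laplacian of a test
function, hence zero. A larger parameter means a smaller disc, so being inside `E` at the parameter
`a` suffices for all later ones. -/
theorem radialAverage_eq {u : Plane → ℝ} (hu : IntegrableOn u E.carrier)
    (hΔ : ∀ ψ, E.IsTest ψ → ∫ y in E.carrier, u y * lap ψ y = 0) {a b : ℝ} (ha : 0 < a) 
    (hab : a ≤ b) {x : Plane} (hx : ∀ z, a * ‖z - x‖ ^ 2 ≤ 1 → z ∈ interior E.carrier) :
    E.radialAverage u b x = E.radialAverage u a x := by
  have hd : ∀ c ∈ Set.Icc a b, HasDerivAt (fun a => E.radialAverage u a x) 0 c := fun c hc => by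
    have h0 : 0 < c := ha.trans_le hc.1
    have := hasDerivAt_radialAverage hu h0 x
    rwa [hΔ _ (isTest_kernelPrimitive fun z hz => hx z (le_trans ?_ hz))] at this
    exact mul_le_mul_of_nonneg_right hc.1 (sq_nonneg _)
  exact constant_of_has_deriv_right_zero (fun c hc => (hd c hc).continuousAt.continuousWithinAt)
    (fun c hc => (hd c (Set.Ico_subset_Icc_self hc)).hasDerivWithinAt) b ⟨hab, le_rfl⟩

theorem continuous_radialAverage {u : Plane → ℝ} (hu : IntegrableOn u E.carrier) {a : ℝ}
    (ha : 0 < a) : Continuous (E.radialAverage u a) := by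
  obtain ⟨K, hK⟩ := exists_kernel_le
  refine continuous_of_dominated (bound := fun y => ‖u y‖ * (a * K)) ?_ ?_ ?_ ?_
  · exact fun x => hu.aestronglyMeasurable.mul
      ((continuous_kernel a).comp (by fun_prop)).aestronglyMeasurable
  · refine fun x => Eventually.of_forall fun y => ?_
    rw [norm_mul]
    exact mul_le_mul_of_nonneg_left (hK a ha.le _) (norm_nonneg _)
  · exact hu.norm.mul_const _
  · exact Eventually.of_forall fun y => continuous_const.mul
      ((continuous_kernel a).comp (by fun_prop))

/-- For `a = (ε ^ 2)⁻¹` the kernel is supported in the disc of radius `ε` and is bounded by a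
multiple of the inverse of its area. The normalized kernels are thus an approximate identity, and
convergence holds at the Lebesgue points of `u`. -/
theorem ae_tendsto_radialAverage {u : Plane → ℝ} (hu : IntegrableOn u E.carrier) :
    ∀ᵐ x ∂volume.restrict E.carrier,
      Tendsto (fun ε : ℝ => E.radialAverage u (ε ^ 2)⁻¹ x) (𝓝[>] 0) (𝓝 (kernelMass * u x)) := by
  have hi : Integrable (E.carrier.indicator u) := hu.integrable_indicator E.measurableSet_carrier
  obtain ⟨K, hK⟩ := exists_kernel_le
  rw [ae_restrict_iff' E.measurableSet_carrier]
  filter_upwards [(Besicovitch.vitaliFamily volume).ae_tendsto_average_norm_sub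
    hi.locallyIntegrable] with x h₀ hx
  have h1 := h₀.comp (Besicovitch.tendsto_filterAt volume x)
  have h2 := tendsto_integral_smul_of_tendsto_average_norm_sub
    (g := fun ε y => kernelMass⁻¹ * kernel (ε ^ 2)⁻¹ (y - x))
    (kernelMass⁻¹ * K * volume.real (Metric.closedBall (0 : Plane) 1)) h1 ?_ ?_ ?_ ?_
  · have h3 := h2.const_mul kernelMass
    rw [Set.indicator_of_mem hx] at h3
    refine h3.congr fun ε => ?_
    rw [radialAverage, ← integral_indicator E.measurableSet_carrier, ← integral_const_mul]
    congr 1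
    ext y
    have := kernelMass_pos.ne'
    by_cases hy : y ∈ E.carrier <;> simp [hy]
    field_simp
  · exact Eventually.of_forall fun ε => hi.integrableOn
  · refine tendsto_const_nhds.congr' ?_
    filter_upwards [self_mem_nhdsWithin] with ε hε
    rw [integral_const_mul, integral_sub_right_eq_self (kernel _), integral_kernel, 
      inv_mul_cancel₀ kernelMass_pos.ne']
    have : 0 < ε := hε
    positivity
  · filter_upwards [self_mem_nhdsWithin] with ε hε y hy
    have hε : 0 < ε := hε
    have := mul_norm_sq_le_of_kernel_ne_zero (right_ne_zero_of_mul hy)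
    rw [mem_closedBall_iff_norm]
    rw [inv_mul_le_iff₀ (by positivity), mul_one] at this
    exact le_of_sq_le_sq this hε.le
  · filter_upwards [self_mem_nhdsWithin] with ε hε y
    have hε : 0 < ε := hε
    rw [Measure.addHaar_real_closedBall' _ _ hε.le]
    have h4 := hK (ε ^ 2)⁻¹ (by positivity) (y - x)
    have h5 : 0 < volume.real (Metric.closedBall (0 : Plane) 1) :=
      ENNReal.toReal_pos (Metric.measure_closedBall_pos _ _ one_pos).ne' measure_closedBall_lt_top.ne
    rw [abs_mul, abs_of_pos (inv_pos.2 kernelMass_pos)]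
    simp only [finrank_euclideanSpace, Fintype.card_fin]
    rw [mul_div_mul_right _ _ h5.ne', mul_div_assoc]
    refine mul_le_mul_of_nonneg_left ?_ (inv_pos.2 kernelMass_pos).le
    rwa [div_eq_inv_mul]

/-- **Weyl's lemma**: a distributionally harmonic function coincides with a continuous one, which
has the mean value property. -/
theorem exists_continuousOn_of_lap_eq_zero {u : Plane → ℝ} (hu : IntegrableOn u E.carrier)
    (hΔ : ∀ ψ, E.IsTest ψ → ∫ y in E.carrier, u y * lap ψ y = 0) :
    ∃ w : Plane → ℝ, ContinuousOn w (interior E.carrier) ∧ u =ᵐ[volume.restrict E.carrier] w ∧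
      ∀ x a, 0 < a → (∀ z, a * ‖z - x‖ ^ 2 ≤ 1 → z ∈ interior E.carrier) →
        E.radialAverage u a x = kernelMass * w x := by
  have hex : ∀ x ∈ interior E.carrier, ∃ a, 0 < a ∧ ∀ y, a * ‖y - x‖ ^ 2 ≤ 1 →
      ∀ z, a * ‖z - y‖ ^ 2 ≤ 1 → z ∈ interior E.carrier := fun x hx => by
    obtain ⟨r, hr, h⟩ := Metric.isOpen_iff.1 isOpen_interior x hx
    -- The parameter belongs to discs of radius `r / 3`. A disc of this size centred at any `y`
    -- within `r / 3` of `x` stays in the ball of radius `r`, so one parameter serves a whole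
    -- neighbourhood of `x`. This gives continuity of the averages.
    refine ⟨(r / 3)⁻¹ ^ 2, by positivity, fun y hy z hz => h ?_⟩
    have aux : ∀ v : Plane, (r / 3)⁻¹ ^ 2 * ‖v‖ ^ 2 ≤ 1 → ‖v‖ ≤ r / 3 := fun v hv => by
      rw [← mul_pow, sq_le_one_iff₀ (by positivity), inv_mul_le_iff₀ (by positivity)] at hv
      linarith
    rw [mem_ball_iff_norm]
    have := norm_add_le (z - y) (y - x)
    rw [sub_add_sub_cancel] at this
    linarith [aux _ hy, aux _ hz]
  have hex' : ∀ x ∈ interior E.carrier, ∃ a, 0 < a ∧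
      ∀ z, a * ‖z - x‖ ^ 2 ≤ 1 → z ∈ interior E.carrier := fun x hx => by
    obtain ⟨a, ha, h⟩ := hex x hx
    exact ⟨a, ha, h x (by simp)⟩
  choose! α hα hαx using hex'
  have hmv : ∀ x a, 0 < a → (∀ z, a * ‖z - x‖ ^ 2 ≤ 1 → z ∈ interior E.carrier) →
      E.radialAverage u a x = kernelMass * (kernelMass⁻¹ * E.radialAverage u (α x) x) := by
    intro x a ha h
    rw [mul_inv_cancel_left₀ kernelMass_pos.ne']
    have hx : x ∈ interior E.carrier := h x (by simp)
    obtain h' | h' := le_total a (α x)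
    · exact (radialAverage_eq hu hΔ ha h' h).symm
    · exact radialAverage_eq hu hΔ (hα x hx) h' (hαx x hx)
  refine ⟨fun x => kernelMass⁻¹ * E.radialAverage u (α x) x, ?_, ?_, hmv⟩
  · intro x hx
    obtain ⟨a, ha, h⟩ := hex x hx
    have hc : ContinuousAt (fun y => kernelMass⁻¹ * E.radialAverage u a y) x :=
      (continuous_const.mul (continuous_radialAverage hu ha)).continuousAt
    refine (hc.congr ?_).continuousWithinAt
    have : {y : Plane | a * ‖y - x‖ ^ 2 < 1} ∈ 𝓝 x :=
      (isOpen_lt (by fun_prop) continuous_const).mem_nhds (by simp)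
    filter_upwards [this] with y hy
    rw [hmv y a ha (h y (le_of_lt hy)), inv_mul_cancel_left₀ kernelMass_pos.ne']
  · filter_upwards [ae_mem_interior E, ae_tendsto_radialAverage hu] with x hx h
    -- As `ε → 0` the average is eventually constant, while at almost every point it tends to
    -- `kernelMass * u x`.
    have h2 : Tendsto (fun ε : ℝ => E.radialAverage u (ε ^ 2)⁻¹ x) (𝓝[>] 0)
        (𝓝 (E.radialAverage u (α x) x)) := by
      refine tendsto_const_nhds.congr' ?_
      have ht : Tendsto (fun ε : ℝ => (ε ^ 2)⁻¹) (𝓝[>] 0) atTop := by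
        refine tendsto_inv_nhdsGT_zero.comp (tendsto_nhdsWithin_iff.2 ⟨?_, ?_⟩)
        · exact (continuous_pow 2).tendsto' 0 0 (by simp) |>.mono_left nhdsWithin_le_nhds
        · filter_upwards [self_mem_nhdsWithin] with ε hε
          exact pow_pos (Set.mem_Ioi.1 hε) 2
      filter_upwards [ht.eventually_ge_atTop (α x)] with ε hε
      exact (radialAverage_eq hu hΔ (hα x hx) hε (hαx x hx)).symm
    rw [← tendsto_nhds_unique h h2, inv_mul_cancel_left₀ kernelMass_pos.ne']

end

/-! ### Distributional gradients and the maximum principle. -/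

noncomputable section

variable {n : ℕ} {E : PolygonalElement n}

open Classical in
/-- The extension by zero of a continuous function on `E`. -/
def extend (ζ : C(E.carrier, ℝ)) (x : Plane) : ℝ := if h : x ∈ E.carrier then ζ ⟨x, h⟩ else 0

@[simp]
theorem extend_coe (ζ : C(E.carrier, ℝ)) (x : E.carrier) : extend ζ x = ζ x := by
  simp [extend]

theorem continuousOn_extend (ζ : C(E.carrier, ℝ)) : ContinuousOn (extend ζ) E.carrier := by
  rw [continuousOn_iff_continuous_domRestrict]
  have : E.carrier.domRestrict (extend ζ) = ζ := funext fun x => extend_coe ζ x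
  rw [this]
  exact ζ.continuous

theorem integral_area (f : Plane → ℝ) : ∫ x : E.carrier, f x ∂E.area = ∫ x in E.carrier, f x :=
  integral_subtype_comap E.measurableSet_carrier f

theorem integral_area_mul (ζ : C(E.carrier, ℝ)) (f : Plane → ℝ) :
    ∫ x : E.carrier, ζ x * f x ∂E.area = ∫ x in E.carrier, extend ζ x * f x := by
  rw [← integral_area]
  simp

theorem memLp_extend (ζ : C(E.carrier, ℝ)) : MemLp (extend ζ) 2 (volume.restrict E.carrier) :=
  memLp_of_continuousOn (continuousOn_extend ζ) 2

/-- `G` is a distributional gradient of `u` in the interior of `E`. -/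
def IsDistribGradient (E : PolygonalElement n) (u : Plane → ℝ) (G : Plane → Plane) : Prop :=
  ∀ φ, E.IsTest φ → ∀ v : Plane,
    ∫ x in E.carrier, u x * fderiv ℝ φ x v = -∫ x in E.carrier, inner ℝ (G x) v * φ x

theorem hasWeakGradient_iff {ζ : C(E.carrier, ℝ)} {G : Plane → Plane} :
    E.HasWeakGradient ζ G ↔
      MemLp G 2 (volume.restrict E.carrier) ∧ E.IsDistribGradient (extend ζ) G := by
  constructor
  · exact fun h => ⟨h.memLp, fun φ hφ v => by rw [← integral_area_mul, h.integral_eq φ hφ v]⟩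
  · exact fun h => ⟨h.1, fun φ hφ v => by
      rw [integral_area_mul _ fun x => fderiv ℝ φ x v, h.2 φ hφ v]⟩

theorem inner_eq_sum (a b : Plane) : inner ℝ a b =
    ∑ i, inner ℝ a (EuclideanSpace.single i 1) * inner ℝ b (EuclideanSpace.single i 1) := by
  simp [PiLp.inner_apply, mul_comm]

theorem IsTest.continuous_lap {ψ : Plane → ℝ} (hψ : E.IsTest ψ) : Continuous (lap ψ) :=
  continuous_finsetSum _ fun _ _ => ((hψ.fderiv_apply _).fderiv_apply _).1.continuous

/-- The definition is applied to the partial derivatives of `ψ`, which are test functions again.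
This converts weak harmonicity into the distributional form required by Weyl's lemma. -/
theorem IsDistribGradient.integral_mul_lap {u : Plane → ℝ} {G : Plane → Plane}
    (h : E.IsDistribGradient u G) (hu : IntegrableOn u E.carrier)
    (hG : MemLp G 2 (volume.restrict E.carrier)) {ψ : Plane → ℝ} (hψ : E.IsTest ψ) :
    ∫ x in E.carrier, u x * lap ψ x = -∫ x in E.carrier, inner ℝ (G x) (gradient ψ x) := by
  simp only [inner_eq_sum _ (gradient ψ _), inner_gradient_left, lap, Finset.mul_sum]
  rw [integral_finsetSum, integral_finsetSum, ← Finset.sum_neg_distrib]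
  · exact Finset.sum_congr rfl fun i _ => h _ (hψ.fderiv_apply _) _
  · exact fun i _ => (hψ.fderiv_apply _).integrable_inner hG _
  · intro i _
    have ht := (hψ.fderiv_apply (EuclideanSpace.single i 1)).fderiv_apply (EuclideanSpace.single i 1)
    obtain ⟨C, hC⟩ := ht.hasCompactSupport.exists_bound_of_continuous ht.1.continuous
    exact hu.mul_bdd (c := C) ht.1.continuous.aestronglyMeasurable (Eventually.of_forall hC)

theorem eqOn_interior {u w : Plane → ℝ} (h : u =ᵐ[volume.restrict E.carrier] w)
    (hu : ContinuousOn u (interior E.carrier)) (hw : ContinuousOn w (interior E.carrier)) :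
    Set.EqOn u w (interior E.carrier) :=
  Measure.eqOn_open_of_ae_eq (ae_restrict_of_ae_restrict_of_subset interior_subset h)
    isOpen_interior hu hw

theorem mem_interior_or_frontier {x : Plane} (hx : x ∈ E.carrier) :
    x ∈ interior E.carrier ∨ x ∈ frontier E.carrier := by
  by_cases h : x ∈ interior E.carrier
  · exact .inl h
  · exact .inr ⟨subset_closure hx, h⟩

theorem setIntegral_kernel {a : ℝ} (ha : 0 < a) {x : Plane}
    (hx : ∀ z, a * ‖z - x‖ ^ 2 ≤ 1 → z ∈ interior E.carrier) :
    ∫ y in E.carrier, kernel a (y - x) = kernelMass := by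
  rw [setIntegral_eq_integral_of_forall_compl_eq_zero, integral_sub_right_eq_self (kernel a),
    integral_kernel ha]
  intro y hy
  by_contra h
  exact hy (interior_subset (hx y (mul_norm_sq_le_of_kernel_ne_zero h)))

/-- The maximum principle. -/
theorem le_of_lap_eq_zero {u : Plane → ℝ} (hu : ContinuousOn u E.carrier)
    (hΔ : ∀ ψ, E.IsTest ψ → ∫ y in E.carrier, u y * lap ψ y = 0) {M : ℝ}
    (hM : ∀ x ∈ frontier E.carrier, u x ≤ M) : ∀ x ∈ E.carrier, u x ≤ M := by
  intro x hx
  have hui : IntegrableOn u E.carrier := hu.integrableOn_compact E.isCompact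
  obtain ⟨x₀, hx₀, hmax⟩ := E.isCompact.exists_isMaxOn ⟨x, hx⟩ hu
  refine (hmax hx).trans ?_
  by_contra! hlt
  obtain ⟨w, hw, huw, hmv⟩ := exists_continuousOn_of_lap_eq_zero hui hΔ
  have huw' := eqOn_interior huw (hu.mono interior_subset) hw
  have hK : IsCompact (E.carrier ∩ u ⁻¹' {u x₀}) :=
    E.isCompact.of_isClosed_subset (hu.preimage_isClosed_of_isClosed E.isCompact.isClosed
      isClosed_singleton) Set.inter_subset_left
  -- Among the maximum points of `u`, take one that is furthest to the right. The mean value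
  -- property will produce another one strictly to its right, so no connectedness argument is
  -- needed.
  obtain ⟨x₁, ⟨hx₁, hux₁⟩, hmax₁⟩ := hK.exists_isMaxOn (f := fun x : Plane => x 0) ⟨x₀, hx₀, rfl⟩
    (by fun_prop)
  have hux₁ : u x₁ = u x₀ := hux₁
  have hx₁i : x₁ ∈ interior E.carrier := by
    refine (mem_interior_or_frontier hx₁).resolve_right fun h => ?_
    linarith [hM x₁ h]
  obtain ⟨r, hr, hball⟩ := Metric.isOpen_iff.1 isOpen_interior x₁ hx₁i
  set a := (r / 2)⁻¹ ^ 2 with ha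
  have ha0 : 0 < a := by positivity
  have hx₁a : ∀ z, a * ‖z - x₁‖ ^ 2 ≤ 1 → z ∈ interior E.carrier := fun z hz => hball (by
    rw [ha, ← mul_pow, sq_le_one_iff₀ (by positivity), inv_mul_le_iff₀ (by positivity)] at hz
    rw [mem_ball_iff_norm]
    linarith)
  have hkc : Continuous fun y => kernel a (y - x₁) := (continuous_kernel a).comp (by fun_prop)
  have hk : IntegrableOn (fun y => kernel a (y - x₁)) E.carrier :=
    hkc.continuousOn.integrableOn_compact E.isCompact
  -- The mean value property at `x₁`: the nonnegative function `u x₀ - u` has weighted average zero,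
  -- so it vanishes wherever the kernel is positive.
  have hint : ∫ y in E.carrier, (u x₀ - u y) * kernel a (y - x₁) = 0 := by
    have h1 := hmv x₁ a ha0 hx₁a
    rw [← huw' hx₁i, hux₁, radialAverage] at h1
    simp only [sub_mul]
    rw [integral_sub (hk.const_mul _), integral_const_mul, setIntegral_kernel ha0 hx₁a, h1]
    · ring
    · exact (hu.mul hkc.continuousOn).integrableOn_compact E.isCompact
  have hfc : ContinuousOn (fun y => (u x₀ - u y) * kernel a (y - x₁)) E.carrier :=
    (continuousOn_const.sub hu).mul hkc.continuousOn
  rw [setIntegral_eq_zero_iff_of_nonneg_ae] at hint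
  · have h0 := eqOn_interior hint (hfc.mono interior_subset) continuousOn_const
    obtain ⟨t, ht0, ht1, ht⟩ := exists_deriv_profile_pos
    -- The kernel vanishes at its centre's far surroundings and need not be positive everywhere
    -- inside; the distance `√(t / a)` is chosen so that its argument is exactly `t`, where the
    -- profile has positive slope.
    set y₁ : Plane := x₁ + EuclideanSpace.single 0 (√(t / a)) with hy₁
    have hn : a * ‖y₁ - x₁‖ ^ 2 = t := by
      simp [hy₁, Real.sq_sqrt (div_pos ht0 ha0).le]
      field_simp
    have hyi : y₁ ∈ interior E.carrier := hx₁a y₁ (by rw [hn]; exact ht1.le)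
    have h1 : (u x₀ - u y₁) * kernel a (y₁ - x₁) = 0 := h0 hyi
    have h2 : kernel a (y₁ - x₁) ≠ 0 := by
      rw [kernel, hn]
      positivity
    have h3 : u y₁ = u x₀ := by
      have := (mul_eq_zero.1 h1).resolve_right h2
      linarith
    have h4 : y₁ 0 ≤ x₁ 0 := hmax₁ ⟨interior_subset hyi, h3⟩
    have h5 : 0 < √(t / a) := Real.sqrt_pos.2 (div_pos ht0 ha0)
    simp [hy₁] at h4
    linarith
  · filter_upwards [ae_restrict_mem E.measurableSet_carrier] with y hy
    exact mul_nonneg (sub_nonneg.2 (hmax hy)) (kernel_nonneg ha0.le _)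
  · exact hfc.integrableOn_compact E.isCompact

theorem eqOn_zero_of_lap_eq_zero {u : Plane → ℝ} (hu : ContinuousOn u E.carrier)
    (hΔ : ∀ ψ, E.IsTest ψ → ∫ y in E.carrier, u y * lap ψ y = 0)
    (h0 : ∀ x ∈ frontier E.carrier, u x = 0) : ∀ x ∈ E.carrier, u x = 0 := by
  intro x hx
  refine le_antisymm (le_of_lap_eq_zero hu hΔ (fun y hy => (h0 y hy).le) x hx) ?_
  have := le_of_lap_eq_zero (u := fun x => -u x) (M := 0) hu.neg
    (fun ψ hψ => by simp [integral_neg, hΔ ψ hψ]) (fun y hy => by simp [h0 y hy]) x hx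
  linarith

end

/-! ### Boundary values in the Sobolev sense and the Dirichlet principle. -/

noncomputable section

variable {n : ℕ} {E : PolygonalElement n}

/-- The function `u`, with gradient `G`, has the same trace on the boundary as `g`: the difference
`u - g` belongs to the closure of the test functions in the Sobolev space. -/
structure HasTrace (E : PolygonalElement n) (u : Plane → ℝ) (G : Plane → Plane)
    (g : Plane → ℝ) : Prop where
  memLp : MemLp u 2 (volume.restrict E.carrier)
  memLp_gradient : MemLp G 2 (volume.restrict E.carrier)
  approx : ∀ δ > 0, ∃ φ, E.IsTest φ ∧
    (eLpNorm (G - gradient g - gradient φ) 2 (volume.restrict E.carrier)).toReal ≤ δ ∧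
    (eLpNorm (u - g - φ) 2 (volume.restrict E.carrier)).toReal ≤ δ

theorem continuous_gradient {g : Plane → ℝ} (hg : ContDiff ℝ (⊤ : ℕ∞) g) :
    Continuous (gradient g) :=
  (InnerProductSpace.toDual ℝ Plane).symm.continuous.comp (hg.continuous_fderiv (by simp))

theorem memLp_gradient_of_contDiff {g : Plane → ℝ} (hg : ContDiff ℝ (⊤ : ℕ∞) g) :
    MemLp (gradient g) 2 (volume.restrict E.carrier) :=
  memLp_of_continuousOn (continuous_gradient hg).continuousOn 2

theorem memLp_contDiff {g : Plane → ℝ} (hg : ContDiff ℝ (⊤ : ℕ∞) g) :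
    MemLp g 2 (volume.restrict E.carrier) :=
  memLp_of_continuousOn hg.continuous.continuousOn 2

/-- The gradients of the test functions, as elements of `L²`. -/
def testGradients (E : PolygonalElement n) :
    Submodule ℝ (Lp Plane 2 (volume.restrict E.carrier)) where
  carrier := {x | ∃ φ, ∃ h : E.IsTest φ, x = (h.memLp_gradient 2).toLp (gradient φ)}
  add_mem' := by
    rintro _ _ ⟨φ, hφ, rfl⟩ ⟨ψ, hψ, rfl⟩
    refine ⟨φ + ψ, hφ.add hψ, ?_⟩
    rw [← MemLp.toLp_add]
    congr 1
    exact (hφ.gradient_add hψ).symm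
  zero_mem' := by
    refine ⟨0, .zero, ?_⟩
    have : gradient (0 : Plane → ℝ) = 0 := by ext1 x; simp [gradient]
    simp only [this]
    rfl
  smul_mem' := by
    rintro c _ ⟨φ, hφ, rfl⟩
    refine ⟨c • φ, hφ.smul c, ?_⟩
    rw [← MemLp.toLp_const_smul]
    congr 1
    exact (hφ.gradient_smul c).symm

/-- The Dirichlet principle. -/
theorem exists_hasTrace {g : Plane → ℝ} (hg : ContDiff ℝ (⊤ : ℕ∞) g) :
    ∃ u G, E.HasTrace u G g ∧
      (∀ ψ, E.IsTest ψ → ∫ x in E.carrier, inner ℝ (G x) (gradient ψ x) = 0) ∧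
      (eLpNorm G 2 (volume.restrict E.carrier)).toReal ≤
        (eLpNorm (gradient g) 2 (volume.restrict E.carrier)).toReal := by
  obtain ⟨C, hC⟩ := E.exists_eLpNorm_le_eLpNorm_gradient
  set V := E.testGradients.topologicalClosure with hV
  set d : Lp Plane 2 (volume.restrict E.carrier) := (memLp_gradient_of_contDiff hg).toLp (gradient g) with hd
  have : CompleteSpace V := E.testGradients.isClosed_topologicalClosure.completeSpace_coe
  -- The gradient of the solution is the component `d - P` of `∇g` orthogonal to all gradients of
  -- test functions. It remains to recognize `-P` as the gradient of a function with zero trace.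
  set P := V.starProjection d with hP
  have hPV : -P ∈ closure (E.testGradients : Set (Lp Plane 2 (volume.restrict E.carrier))) :=
    V.neg_mem (Submodule.starProjection_apply_mem V d)
  obtain ⟨s, hs, hlim⟩ := mem_closure_iff_seq_limit.1 hPV
  choose φ hφ hsφ using hs
  -- By Poincaré, the test functions converge in `L²` as soon as their gradients do; `C + 1`
  -- replaces `C`, which may be zero.
  have hcauchy : CauchySeq fun k => ((hφ k).memLp 2).toLp (φ k) := by
    have h1 := hlim.cauchySeq
    rw [Metric.cauchySeq_iff] at h1 ⊢
    intro ε hε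
    obtain ⟨N, hN⟩ := h1 (ε / (C + 1)) (by positivity)
    refine ⟨N, fun k hk l hl => ?_⟩
    have h2 := hN k hk l hl
    rw [hsφ k, hsφ l, dist_eq_norm, ← MemLp.toLp_sub, Lp.norm_toLp,
      ← (hφ k).gradient_sub (hφ l), lt_div_iff₀ (by positivity)] at h2
    rw [dist_eq_norm, ← MemLp.toLp_sub, Lp.norm_toLp]
    refine lt_of_le_of_lt ?_ h2
    have h3 := ENNReal.toReal_mono
      (ENNReal.mul_ne_top ENNReal.coe_ne_top (((hφ k).sub (hφ l)).memLp_gradient 2).2.ne)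
      (hC _ ((hφ k).sub (hφ l)))
    rw [ENNReal.toReal_mul, ENNReal.coe_toReal] at h3
    refine h3.trans ?_
    rw [mul_comm]
    gcongr
    linarith
  obtain ⟨w, hw⟩ := cauchySeq_tendsto_of_complete hcauchy
  refine ⟨g + w, d - P, ⟨?_, ?_, ?_⟩, ?_, ?_⟩
  · exact (memLp_contDiff hg).add (Lp.memLp w)
  · exact (Lp.memLp d).sub (Lp.memLp P)
  · intro δ hδ
    obtain ⟨k, h1, h2⟩ := ((Metric.tendsto_nhds.1 hlim δ hδ).and
      (Metric.tendsto_nhds.1 hw δ hδ)).exists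
    refine ⟨φ k, hφ k, ?_, ?_⟩
    · rw [dist_comm, dist_eq_norm, Lp.norm_def] at h1
      refine le_trans (le_of_eq ?_) h1.le
      congr 1
      refine eLpNorm_congr_ae ?_
      filter_upwards [Lp.coeFn_sub (-P) (s k), Lp.coeFn_neg P, (memLp_gradient_of_contDiff hg).coeFn_toLp,
        ((hφ k).memLp_gradient 2).coeFn_toLp] with x e1 e2 e3 e4
      rw [e1]
      simp only [Pi.sub_apply, hsφ k, e4, e2, Pi.neg_apply, hd, e3]
      abel
    · rw [dist_comm, dist_eq_norm, Lp.norm_def] at h2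
      refine le_trans (le_of_eq ?_) h2.le
      congr 1
      refine eLpNorm_congr_ae ?_
      filter_upwards [Lp.coeFn_sub w (((hφ k).memLp 2).toLp (φ k)),
        ((hφ k).memLp 2).coeFn_toLp] with x e1 e2
      rw [e1]
      simp only [Pi.sub_apply, Pi.add_apply, e2]
      ring
  · intro ψ hψ
    have h1 : inner ℝ (d - P) ((hψ.memLp_gradient 2).toLp (gradient ψ)) = 0 :=
      Submodule.starProjection_inner_eq_zero d _
        (E.testGradients.le_topologicalClosure ⟨ψ, hψ, rfl⟩)
    rw [L2.inner_def] at h1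
    rw [← h1]
    refine integral_congr_ae ?_
    filter_upwards [Lp.coeFn_sub d P, (hψ.memLp_gradient 2).coeFn_toLp] with x e1 e2
    rw [e1, e2, Pi.sub_apply]
  · rw [← Lp.norm_toLp (gradient g) (memLp_gradient_of_contDiff hg), ← hd]
    have h1 : (eLpNorm (⇑d - ⇑P) 2 (volume.restrict E.carrier)).toReal = ‖d - P‖ := by
      rw [Lp.norm_def, eLpNorm_congr_ae (Lp.coeFn_sub d P)]
    rw [h1]
    have h2 := V.norm_sq_eq_add_norm_sq_starProjection d
    rw [Submodule.starProjection_orthogonal'] at h2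
    simp at h2
    refine le_of_sq_le_sq ?_ (norm_nonneg _)
    nlinarith [sq_nonneg ‖P‖]

theorem eq_zero_of_forall_abs_le {a C : ℝ} (h : ∀ δ > 0, |a| ≤ C * δ) : a = 0 := by
  by_contra ha
  have h0 : 0 < |a| := abs_pos.2 ha
  have h1 := h (|a| / (2 * (|C| + 1))) (by positivity)
  have h2 : C * (|a| / (2 * (|C| + 1))) ≤ (|C| + 1) * (|a| / (2 * (|C| + 1))) := by
    gcongr
    linarith [le_abs_self C]
  have h3 : (|C| + 1) * (|a| / (2 * (|C| + 1))) = |a| / 2 := by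
    field_simp
  linarith

/-- Integration by parts is exact for the smooth function `g + χ`, with `χ` an approximating test
function. The two error terms are at most a constant times `δ` by Cauchy–Schwarz. -/
theorem HasTrace.isDistribGradient {u g : Plane → ℝ} {G : Plane → Plane} (h : E.HasTrace u G g)
    (hg : ContDiff ℝ (⊤ : ℕ∞) g) : E.IsDistribGradient u G := by
  intro φ hφ v
  rw [← sub_eq_zero, sub_neg_eq_add]
  have hv : MemLp (fun x => φ x • v) 2 (volume.restrict E.carrier) :=
    memLp_of_continuousOn (hφ.1.continuous.smul continuous_const).continuousOn 2
  refine eq_zero_of_forall_abs_le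
    (C := (eLpNorm (fun x => fderiv ℝ φ x v) 2 (volume.restrict E.carrier)).toReal +
      (eLpNorm (fun x => φ x • v) 2 (volume.restrict E.carrier)).toReal) fun δ hδ => ?_
  obtain ⟨χ, hχ, h1, h2⟩ := h.approx δ hδ
  have hgχ : ContDiff ℝ (⊤ : ℕ∞) (g + χ) := hg.add hχ.1
  have m1 : MemLp (u - g - χ) 2 (volume.restrict E.carrier) :=
    (h.memLp.sub (memLp_contDiff hg)).sub (hχ.memLp 2)
  have m2 : MemLp (G - gradient g - gradient χ) 2 (volume.restrict E.carrier) :=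
    (h.memLp_gradient.sub (memLp_gradient_of_contDiff hg)).sub (hχ.memLp_gradient 2)
  have m3 := (hφ.fderiv_apply v).memLp 2
  have e1 := hφ.integral_mul_fderiv (f := g + χ) (hgχ.of_le (by simp)).contDiffOn v
  have i1 := abs_integral_mul_le m1 m3
  have i2 := abs_integral_inner_le m2 hv
  have e2 : ∫ x in E.carrier, (u - g - χ) x * fderiv ℝ φ x v =
      (∫ x in E.carrier, u x * fderiv ℝ φ x v) - ∫ x in E.carrier, (g + χ) x * fderiv ℝ φ x v := by
    have j1 : IntegrableOn (fun x => u x * fderiv ℝ φ x v) E.carrier := h.memLp.integrable_mul m3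
    have j2 : IntegrableOn (fun x => (g + χ) x * fderiv ℝ φ x v) E.carrier :=
      (memLp_contDiff hgχ).integrable_mul m3
    rw [← integral_sub j1 j2]
    congr 1
    ext x
    simp only [Pi.sub_apply, Pi.add_apply]
    ring
  have e3 : ∫ x in E.carrier, inner ℝ ((G - gradient g - gradient χ) x) (φ x • v) =
      (∫ x in E.carrier, inner ℝ (G x) v * φ x) -
        ∫ x in E.carrier, fderiv ℝ (g + χ) x v * φ x := by
    rw [← integral_sub (hφ.integrable_inner h.memLp_gradient v)]
    · congr 1
      ext x
      have e4 : fderiv ℝ (g + χ) x v = fderiv ℝ g x v + fderiv ℝ χ x v := by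
        rw [fderiv_add (hg.differentiable (by simp) x) (hχ.1.differentiable (by simp) x)]
        rfl
      simp only [Pi.sub_apply, inner_smul_right, inner_sub_left, inner_gradient_left, e4]
      ring
    · simpa only [← inner_gradient_left] using
        hφ.integrable_inner (memLp_gradient_of_contDiff hgχ) v
  have e5 : (∫ x in E.carrier, u x * fderiv ℝ φ x v) + ∫ x in E.carrier, inner ℝ (G x) v * φ x =
      (∫ x in E.carrier, (u - g - χ) x * fderiv ℝ φ x v) +
        ∫ x in E.carrier, inner ℝ ((G - gradient g - gradient χ) x) (φ x • v) := by
    rw [e2, e3, e1]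
    ring
  rw [e5]
  refine (abs_add_le _ _).trans ?_
  rw [add_mul]
  refine add_le_add (i1.trans ?_) (i2.trans ?_)
  · rw [mul_comm]
    gcongr
  · rw [mul_comm]
    gcongr

theorem HasTrace.neg {u g : Plane → ℝ} {G : Plane → Plane} (h : E.HasTrace u G g) :
    E.HasTrace (-u) (-G) (-g) where
  memLp := h.memLp.neg
  memLp_gradient := h.memLp_gradient.neg
  approx δ hδ := by
    obtain ⟨φ, hφ, h1, h2⟩ := h.approx δ hδ
    have e : ∀ f : Plane → ℝ, gradient (-f) = -gradient f := fun f => by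
      ext1 x
      simp [gradient, fderiv_neg]
    refine ⟨-φ, hφ.neg, ?_, ?_⟩
    · rw [e g, e φ, ← eLpNorm_neg]
      convert h1 using 3
      abel
    · rw [← eLpNorm_neg]
      convert h2 using 3
      abel

end

/-! ### Weak comparison with harmonic majorants. -/

noncomputable section

variable {n : ℕ} {E : PolygonalElement n}

theorem restrict_carrier_eq (E : PolygonalElement n) :
    (volume : Measure Plane).restrict E.carrier = volume.restrict (interior E.carrier) := by
  refine Measure.restrict_congr_set ?_
  have hf : ∀ᵐ x, x ∉ frontier E.carrier := measure_eq_zero_iff_ae_notMem.1 E.volume_frontier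
  filter_upwards [hf] with x hx
  refine propext ⟨fun h => ?_, fun h => interior_subset h⟩
  exact (mem_interior_or_frontier h).resolve_right hx

theorem exists_deriv_smoothTransition_le : ∃ C : NNReal, ∀ t,
    0 ≤ deriv Real.smoothTransition t ∧ deriv Real.smoothTransition t ≤ C := by
  have hd : ContDiff ℝ 1 Real.smoothTransition := Real.smoothTransition.contDiff (n := 1)
  obtain ⟨C, hC⟩ := isCompact_Icc.exists_bound_of_continuousOn (s := Set.Icc (0 : ℝ) 1)
    (hd.continuous_deriv le_rfl).continuousOn
  refine ⟨C.toNNReal, fun t => ⟨Real.smoothTransition.monotone.deriv_nonneg, ?_⟩⟩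
  by_cases ht : t ∈ Set.Icc (0 : ℝ) 1
  · exact (le_abs_self _).trans ((hC t ht).trans (Real.le_coe_toNNReal C))
  · rw [Set.mem_Icc, not_and_or, not_le, not_le] at ht
    have : deriv Real.smoothTransition t = 0 := by
      obtain h | h := ht
      · have : Real.smoothTransition =ᶠ[𝓝 t] fun _ => 0 := by
          filter_upwards [Iio_mem_nhds h] with s hs using
            Real.smoothTransition.zero_of_nonpos (Set.mem_Iio.1 hs).le
        rw [this.deriv_eq, deriv_const]
      · have : Real.smoothTransition =ᶠ[𝓝 t] fun _ => 1 := by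
          filter_upwards [Ioi_mem_nhds h] with s hs using
            Real.smoothTransition.one_of_one_le (Set.mem_Ioi.1 hs).le
        rw [this.deriv_eq, deriv_const]
    rw [this]
    exact C.toNNReal.2

/-- A smooth cutoff of the positive part of `f` in the interior of `E`. -/
def positivePart (E : PolygonalElement n) (f : Plane → ℝ) : Plane → ℝ :=
  (interior E.carrier).indicator fun x => Real.smoothTransition (f x)

theorem positivePart_apply {f : Plane → ℝ} {x : Plane} (hx : x ∈ interior E.carrier) :
    E.positivePart f x = Real.smoothTransition (f x) := Set.indicator_of_mem hx _

/-- Since `f ≤ 0` wherever `φ` vanishes, the cutoff is supported inside the support of `φ`. The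
behaviour of `f` near the boundary of `E` is therefore irrelevant. -/
theorem isTest_positivePart {f φ : Plane → ℝ} (hφ : E.IsTest φ)
    (hf : ContDiffOn ℝ (⊤ : ℕ∞) f (interior E.carrier))
    (h0 : ∀ x ∈ interior E.carrier, φ x = 0 → f x ≤ 0) : E.IsTest (E.positivePart f) := by
  have hs : Function.support (E.positivePart f) ⊆ tsupport φ := fun x hx => by
    by_contra h
    refine hx ?_
    by_cases hxi : x ∈ interior E.carrier
    · rw [positivePart_apply hxi]
      exact Real.smoothTransition.zero_of_nonpos (h0 x hxi (image_eq_zero_of_notMem_tsupport h))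
    · exact Set.indicator_of_notMem hxi _
  have ht : tsupport (E.positivePart f) ⊆ tsupport φ := closure_minimal hs (isClosed_tsupport φ)
  refine ⟨contDiff_iff_contDiffAt.2 fun x => ?_, hφ.2.mono' hs, ht.trans hφ.3⟩
  by_cases hx : x ∈ interior E.carrier
  · have h1 : ContDiffAt ℝ (⊤ : ℕ∞) (fun x => Real.smoothTransition (f x)) x :=
      Real.smoothTransition.contDiffAt.comp x (hf.contDiffAt (isOpen_interior.mem_nhds hx))
    refine h1.congr_of_eventuallyEq ?_
    filter_upwards [isOpen_interior.mem_nhds hx] with y hy using positivePart_apply hy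
  · have h1 : E.positivePart f =ᶠ[𝓝 x] fun _ => 0 := by
      filter_upwards [(isClosed_tsupport φ).isOpen_compl.mem_nhds fun h => hx (hφ.3 h)] with y hy
      by_contra h
      exact hy (hs h)
    exact contDiffAt_const.congr_of_eventuallyEq h1

theorem gradient_positivePart {f : Plane → ℝ}
    (hf : ContDiffOn ℝ (⊤ : ℕ∞) f (interior E.carrier)) {x : Plane}
    (hx : x ∈ interior E.carrier) :
    gradient (E.positivePart f) x = deriv Real.smoothTransition (f x) • gradient f x := by
  have h1 : E.positivePart f =ᶠ[𝓝 x] fun y => Real.smoothTransition (f y) := by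
    filter_upwards [isOpen_interior.mem_nhds hx] with y hy using positivePart_apply hy
  have h2 : DifferentiableAt ℝ f x :=
    (hf.contDiffAt (isOpen_interior.mem_nhds hx)).differentiableAt (by simp)
  have h3 : DifferentiableAt ℝ Real.smoothTransition (f x) :=
    (Real.smoothTransition.contDiff (n := 1)).differentiable (by simp) _
  have h4 : fderiv ℝ (fun y => Real.smoothTransition (f y)) x = _ :=
    (h3.hasDerivAt.comp_hasFDerivAt x h2.hasFDerivAt).fderiv
  rw [h1.gradient_eq, gradient, h4, map_smul, gradient]

/-- Comparison of a solution with a harmonic function which is larger than the boundary data. -/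
theorem HasTrace.ae_le {u g S : Plane → ℝ} {G : Plane → Plane} (h : E.HasTrace u G g)
    (hG : ∀ ψ, E.IsTest ψ → ∫ x in E.carrier, inner ℝ (G x) (gradient ψ x) = 0)
    (hg : ContDiff ℝ (⊤ : ℕ∞) g) (hS : ContDiffOn ℝ (⊤ : ℕ∞) S (interior E.carrier))
    (hS2 : MemLp (gradient S) 2 (volume.restrict E.carrier))
    (hS0 : ∀ ψ, E.IsTest ψ → ∫ x in E.carrier, inner ℝ (gradient S x) (gradient ψ x) = 0)
    (hgS : ∀ x ∈ interior E.carrier, g x ≤ S x) :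
    ∀ᵐ x ∂volume.restrict E.carrier, u x ≤ S x := by
  obtain ⟨C, hC⟩ := exists_deriv_smoothTransition_le
  obtain ⟨P, hP⟩ := E.exists_eLpNorm_le_eLpNorm_gradient
  have hlip : ∀ s t, |Real.smoothTransition s - Real.smoothTransition t| ≤ C * |s - t| := by
    have : LipschitzWith C Real.smoothTransition := lipschitzWith_of_nnnorm_deriv_le
      ((Real.smoothTransition.contDiff (n := 1)).differentiable (by simp)) fun t => by
        rw [← NNReal.coe_le_coe, coe_nnnorm, Real.norm_of_nonneg (hC t).1]
        exact (hC t).2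
    exact fun s t => by simpa [Real.dist_eq] using this.dist_le_mul s t
  have hSm : AEStronglyMeasurable S (volume.restrict E.carrier) := by
    rw [restrict_carrier_eq]
    exact hS.continuousOn.aestronglyMeasurable isOpen_interior.measurableSet
  -- This function is bounded and vanishes exactly where `u ≤ S`, so it suffices that its `L²` norm
  -- is zero.
  set w : Plane → ℝ := fun x => Real.smoothTransition (u x - S x) with hw
  have hwm : MemLp w 2 (volume.restrict E.carrier) := by
    refine MemLp.of_bound (Real.smoothTransition.continuous.comp_aestronglyMeasurable
      (h.memLp.1.sub hSm)) 1 (Eventually.of_forall fun x => ?_)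
    rw [Real.norm_of_nonneg (Real.smoothTransition.nonneg _)]
    exact Real.smoothTransition.le_one _
  have key : (eLpNorm w 2 (volume.restrict E.carrier)).toReal = 0 := by
    refine eq_zero_of_forall_abs_le (C := P * C + C) fun δ hδ => ?_
    obtain ⟨φ, hφ, h1, h2⟩ := h.approx δ hδ
    -- A smooth substitute for `u - S`. Where `φ = 0` it equals `g - S ≤ 0`, which makes its cutoff
    -- an admissible test function.
    set f : Plane → ℝ := fun x => g x + φ x - S x with hf
    have hfc : ContDiffOn ℝ (⊤ : ℕ∞) f (interior E.carrier) :=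
      (hg.add hφ.1).contDiffOn.sub hS
    have hψ : E.IsTest (E.positivePart f) := isTest_positivePart hφ hfc fun x hx h0 => by
      simp only [hf, h0]
      linarith [hgS x hx]
    set d := gradient (E.positivePart f) with hd
    have md : MemLp d 2 (volume.restrict E.carrier) := hψ.memLp_gradient 2
    set e := G - gradient g - gradient φ with he
    have me : MemLp e 2 (volume.restrict E.carrier) :=
      (h.memLp_gradient.sub (memLp_gradient_of_contDiff hg)).sub (hφ.memLp_gradient 2)
    -- With `T` the smooth transition, `d = T'(f) ∇f` and `0 ≤ T' ≤ C` give `|d|² ≤ C ⟨∇f, d⟩`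
    -- pointwise. Here `∇f = -e + G - ∇S`, and both `G` and `∇S` are orthogonal to `d`, so only the
    -- small error `e` contributes.
    have hdd : (eLpNorm d 2 (volume.restrict E.carrier)).toReal ^ 2 ≤
        C * ∫ x in E.carrier, inner ℝ (-e x) (d x) := by
      have j1 : IntegrableOn (fun x => inner ℝ (-e x) (d x)) E.carrier :=
        integrable_inner_of_memLp me.neg md
      have j2 : IntegrableOn (fun x => inner ℝ (G x) (d x)) E.carrier :=
        integrable_inner_of_memLp h.memLp_gradient md
      have j3 : IntegrableOn (fun x => inner ℝ (gradient S x) (d x)) E.carrier :=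
        integrable_inner_of_memLp hS2 md
      have i1 : ∫ x in E.carrier, inner ℝ (-e x) (d x) = 
          ∫ x in E.carrier, (inner ℝ (-e x) (d x) + (inner ℝ (G x) (d x) 
            - inner ℝ (gradient S x) (d x))) := by
        have j4 : IntegrableOn (fun x => inner ℝ (G x) (d x) - inner ℝ (gradient S x) (d x))
          E.carrier := j2.sub j3
        rw [integral_add j1 j4, integral_sub j2 j3, hG _ hψ, hS0 _ hψ]
        simp
      rw [← integral_inner_self md, i1, ← integral_const_mul]
      refine integral_mono_ae (integrable_inner_of_memLp md md) ?_ ?_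
      · exact (j1.add (j2.sub j3)).const_mul _
      · filter_upwards [ae_mem_interior E] with x hx
        have hfx : gradient f x = gradient g x + gradient φ x - gradient S x := by
          have h3 : DifferentiableAt ℝ S x :=
            (hS.contDiffAt (isOpen_interior.mem_nhds hx)).differentiableAt (by simp)
          have h4 : fderiv ℝ f x = _ := (((hg.differentiable (by simp) x).hasFDerivAt.add
            (hφ.1.differentiable (by simp) x).hasFDerivAt).sub h3.hasFDerivAt).fderiv
          rw [gradient, h4, map_sub, map_add]
          rfl
        have hdx : d x = deriv Real.smoothTransition (f x) • gradient f x :=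
          gradient_positivePart hfc hx
        have hin : inner ℝ (-e x) (d x) + (inner ℝ (G x) (d x) - inner ℝ (gradient S x) (d x)) =
            inner ℝ (gradient f x) (d x) := by
          rw [← inner_sub_left, ← inner_add_left, hfx]
          congr 1
          simp only [he, Pi.sub_apply]
          abel
        simp only [hin]
        rw [hdx, inner_smul_left, inner_smul_right]
        simp only [conj_trivial]
        refine mul_le_mul_of_nonneg_right (hC _).2 (mul_nonneg (hC _).1 real_inner_self_nonneg)
    have hde : (eLpNorm d 2 (volume.restrict E.carrier)).toReal ≤ C * δ := by
      have i2 := (le_abs_self _).trans (abs_integral_inner_le me.neg md)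
      have i3 : (eLpNorm (-e) 2 (volume.restrict E.carrier)).toReal ≤ δ := by
        rwa [eLpNorm_neg]
      set D := (eLpNorm d 2 (volume.restrict E.carrier)).toReal with hD
      have hD0 : 0 ≤ D := ENNReal.toReal_nonneg
      have i4 : D ^ 2 ≤ C * (δ * D) := hdd.trans (mul_le_mul_of_nonneg_left (i2.trans (by gcongr))
        C.2)
      by_contra! hlt
      have : 0 < D := lt_of_le_of_lt (by positivity) hlt
      nlinarith
    have hψn : (eLpNorm (E.positivePart f) 2 (volume.restrict E.carrier)).toReal ≤ P * (C * δ) := by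
      have := ENNReal.toReal_mono (ENNReal.mul_ne_top ENNReal.coe_ne_top md.2.ne) (hP _ hψ)
      rw [ENNReal.toReal_mul, ENNReal.coe_toReal] at this
      exact this.trans (mul_le_mul_of_nonneg_left hde P.2)
    -- The transition is Lipschitz, and `(u - S) - f = u - g - φ` is small in `L²`.
    have hwψ : (eLpNorm (w - E.positivePart f) 2 (volume.restrict E.carrier)).toReal ≤ C * δ := by
      have m1 : MemLp (u - g - φ) 2 (volume.restrict E.carrier) :=
        (h.memLp.sub (memLp_contDiff hg)).sub (hφ.memLp 2)
      have i5 : eLpNorm (w - E.positivePart f) 2 (volume.restrict E.carrier) ≤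
          ENNReal.ofReal C * eLpNorm (u - g - φ) 2 (volume.restrict E.carrier) := by
        refine eLpNorm_le_mul_eLpNorm_of_ae_le_mul ?_ 2
        filter_upwards [ae_mem_interior E] with x hx
        rw [Pi.sub_apply, positivePart_apply hx, Real.norm_eq_abs, Real.norm_eq_abs]
        refine (hlip _ _).trans (le_of_eq ?_)
        congr 2
        simp only [hf, Pi.sub_apply]
        ring
      have := ENNReal.toReal_mono (ENNReal.mul_ne_top ENNReal.ofReal_ne_top m1.2.ne) i5
      rw [ENNReal.toReal_mul, ENNReal.ofReal_coe_nnreal, ENNReal.coe_toReal] at this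
      exact this.trans (mul_le_mul_of_nonneg_left h2 C.2)
    rw [abs_of_nonneg ENNReal.toReal_nonneg]
    have := toReal_eLpNorm_add_le (hwm.sub (hψ.memLp 2)) (hψ.memLp 2)
    rw [sub_add_cancel] at this
    linarith
  rw [ENNReal.toReal_eq_zero_iff, or_iff_left hwm.2.ne, eLpNorm_eq_zero_iff hwm.1 (by simp)] at key
  filter_upwards [key] with x hx
  simpa [hw] using hx

end

/-! ### A holomorphic barrier off a slit. -/

noncomputable section

/-- The branch of the fourth root of `(z - P) / (z - Q)` which is holomorphic off the segment from
`P` to `Q`. -/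
def slitRoot (P Q z : ℂ) : ℂ := Complex.exp (Complex.log ((z - P) / (z - Q)) / 4)

/-- If `(z - P) / (z - Q) = -t` with `t ≥ 0`, then `z = (P + t Q) / (1 + t)` lies on the segment. -/
theorem div_mem_slitPlane {P Q z : ℂ} (hz : z ∉ segment ℝ P Q) :
    (z - P) / (z - Q) ∈ Complex.slitPlane := by
  have hQ : z - Q ≠ 0 := fun h => hz (by rw [sub_eq_zero.1 h]; exact right_mem_segment ℝ P Q)
  by_contra h
  rw [Complex.mem_slitPlane_iff_not_le_zero, not_not, Complex.le_def] at h
  obtain ⟨h1, h2⟩ := h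
  set t : ℝ := -((z - P) / (z - Q)).re with ht
  have ht0 : 0 ≤ t := by simpa [ht] using h1
  have hw : (z - P) / (z - Q) = -(t : ℂ) := by
    apply Complex.ext <;> simp [ht]
    simpa using h2
  rw [div_eq_iff hQ] at hw
  have h1t : (1 : ℂ) + t ≠ 0 := by exact_mod_cast (by positivity : (1 + t) ≠ 0)
  refine hz ⟨1 / (1 + t), t / (1 + t), by positivity, by positivity, by field_simp, ?_⟩
  simp only [Complex.real_smul]
  push_cast
  field_simp
  linear_combination -hw

theorem sub_ne_zero_of_notMem_segment {P Q z : ℂ} (hz : z ∉ segment ℝ P Q) :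
    z - P ≠ 0 ∧ z - Q ≠ 0 :=
  ⟨fun h => hz (by rw [sub_eq_zero.1 h]; exact left_mem_segment ℝ P Q),
    fun h => hz (by rw [sub_eq_zero.1 h]; exact right_mem_segment ℝ P Q)⟩

theorem norm_slitRoot {P Q z : ℂ} (hz : z ∉ segment ℝ P Q) :
    ‖slitRoot P Q z‖ = ‖z - P‖ ^ (1 / 4 : ℝ) / ‖z - Q‖ ^ (1 / 4 : ℝ) := by
  obtain ⟨h1, h2⟩ := sub_ne_zero_of_notMem_segment hz
  have h3 : 0 < ‖z - P‖ / ‖z - Q‖ := div_pos (norm_pos_iff.2 h1) (norm_pos_iff.2 h2)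
  rw [slitRoot, Complex.norm_exp, ← Real.div_rpow (norm_nonneg _) (norm_nonneg _),
    Real.rpow_def_of_pos h3]
  have : (Complex.log ((z - P) / (z - Q)) / 4).re = (Complex.log ((z - P) / (z - Q))).re / 4 := by
    simp
  rw [this, Complex.log_re, norm_div]
  ring_nf

/-- The argument of the root is at most `π / 4 ≤ π / 3` in absolute value, and `cos (π / 3) = 1 /
2`. A square root would give no such lower bound on the real part. -/
theorem norm_slitRoot_le (P Q z : ℂ) :
    ‖slitRoot P Q z‖ / 2 ≤ (slitRoot P Q z).re := by
  rw [slitRoot, Complex.norm_exp, Complex.exp_re, div_eq_mul_inv]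
  refine mul_le_mul_of_nonneg_left ?_ (Real.exp_pos _).le
  have h1 : (Complex.log ((z - P) / (z - Q)) / 4).im = Complex.arg ((z - P) / (z - Q)) / 4 := by
    simp [Complex.log_im]
  rw [h1, ← one_div, ← Real.cos_pi_div_three, ← Real.cos_abs (Complex.arg _ / 4)]
  have h2 := Complex.abs_arg_le_pi ((z - P) / (z - Q))
  have h3 := Real.pi_pos
  refine Real.cos_le_cos_of_nonneg_of_le_pi (abs_nonneg _) (by linarith) ?_
  rw [abs_div, abs_of_pos (by norm_num : (0 : ℝ) < 4)]
  linarith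

theorem hasDerivAt_slitRoot {P Q z : ℂ} (hz : z ∉ segment ℝ P Q) :
    HasDerivAt (slitRoot P Q) (slitRoot P Q z * ((P - Q) / (4 * ((z - P) * (z - Q))))) z := by
  obtain ⟨h1, h2⟩ := sub_ne_zero_of_notMem_segment hz
  have h3 : HasDerivAt (fun z => (z - P) / (z - Q)) ((1 * (z - Q) - (z - P) * 1) / (z - Q) ^ 2) z :=
    ((hasDerivAt_id z).sub_const P).div ((hasDerivAt_id z).sub_const Q) h2
  refine ((h3.clog (div_mem_slitPlane hz)).div_const 4).cexp.congr_deriv ?_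
  rw [slitRoot]
  congr 1
  field_simp
  ring

/-- A bounded holomorphic function off the segment from `P` to `Q`, with positive real part, which
vanishes at `P` only. -/
def slitBarrier (P Q z : ℂ) : ℂ := slitRoot P Q z / (1 + slitRoot P Q z)

theorem slitRoot_ne_zero (P Q z : ℂ) : slitRoot P Q z ≠ 0 := Complex.exp_ne_zero _

theorem slitRoot_re_pos (P Q z : ℂ) : 0 < (slitRoot P Q z).re :=
  lt_of_lt_of_le (by simpa using slitRoot_ne_zero P Q z) (norm_slitRoot_le P Q z)

theorem one_le_norm_one_add (P Q z : ℂ) : 1 ≤ ‖1 + slitRoot P Q z‖ := by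
  refine le_trans ?_ (Complex.re_le_norm _)
  have := slitRoot_re_pos P Q z
  simp [this.le]

theorem norm_le_norm_one_add (P Q z : ℂ) : ‖slitRoot P Q z‖ ≤ ‖1 + slitRoot P Q z‖ := by
  have := slitRoot_re_pos P Q z
  rw [Complex.norm_def, Complex.norm_def]
  refine Real.sqrt_le_sqrt ?_
  simp only [Complex.normSq_apply, Complex.add_re, Complex.add_im, Complex.one_re, Complex.one_im]
  nlinarith

theorem hasDerivAt_slitBarrier {P Q z : ℂ} (hz : z ∉ segment ℝ P Q) :
    HasDerivAt (slitBarrier P Q) (slitRoot P Q z / (1 + slitRoot P Q z) ^ 2 *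
      ((P - Q) / (4 * ((z - P) * (z - Q))))) z := by
  have h0 : 1 + slitRoot P Q z ≠ 0 := norm_pos_iff.1 (zero_lt_one.trans_le (one_le_norm_one_add P Q z))
  have h1 := hasDerivAt_slitRoot hz
  refine (h1.div (h1.const_add 1) h0).congr_deriv ?_
  field_simp
  ring

theorem norm_slitBarrier_le {P Q z : ℂ} (hz : z ∉ segment ℝ P Q) :
    ‖slitBarrier P Q z‖ ≤ ‖z - P‖ ^ (1 / 4 : ℝ) / ‖z - Q‖ ^ (1 / 4 : ℝ) := by
  rw [slitBarrier, norm_div, norm_slitRoot hz]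
  exact div_le_self (by positivity) (one_le_norm_one_add P Q z)

/-- With `s` the root, `Re (s / (1 + s)) = (Re s + |s|²) / |1 + s|²`, where `Re s ≥ |s| / 2` and `|1
+ s| ≤ 1 + |s|`. The bound increases with `|s|`, hence is uniformly positive away from `P` on
bounded sets. -/
theorem le_slitBarrier_re (P Q z : ℂ) :
    ‖slitRoot P Q z‖ / (2 * (1 + ‖slitRoot P Q z‖)) ≤ (slitBarrier P Q z).re := by
  set s := slitRoot P Q z with hs
  have h0 : 0 < ‖s‖ := norm_pos_iff.2 (slitRoot_ne_zero P Q z)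
  have h1 : 0 < Complex.normSq (1 + s) := Complex.normSq_pos.2
    (norm_pos_iff.1 (zero_lt_one.trans_le (one_le_norm_one_add P Q z)))
  have h2 : Complex.normSq (1 + s) ≤ (1 + ‖s‖) ^ 2 := by
    rw [Complex.normSq_eq_norm_sq]
    gcongr
    simpa using norm_add_le 1 s
  have h3 : (slitBarrier P Q z).re = (s.re + ‖s‖ ^ 2) / Complex.normSq (1 + s) := by
    rw [slitBarrier, ← hs, Complex.div_re, ← Complex.normSq_eq_norm_sq, Complex.normSq_apply s]
    simp
    ring
  have h4 : ‖s‖ / 2 ≤ s.re := norm_slitRoot_le P Q z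
  rw [h3, div_le_div_iff₀ (by positivity) h1]
  calc ‖s‖ * Complex.normSq (1 + s) ≤ ‖s‖ * (1 + ‖s‖) ^ 2 := by gcongr
    _ = (‖s‖ / 2 + ‖s‖ * ‖s‖ / 2) * (2 * (1 + ‖s‖)) := by ring
    _ ≤ _ := by
      gcongr
      nlinarith

/-- One of `z - P` and `z - Q` has norm at least `‖P - Q‖ / 2`. Far from `Q`, the factor `|s| / |1 +
s|²` is bounded by `|s|`, and far from `P` by `1 / |s|`. Either way the singularity `1 / (|z - P| |z
- Q|)` is reduced to the power `-3/4` of the distance to the nearer end, which is square integrable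
in the plane. -/
theorem exists_norm_deriv_slitBarrier_le {P Q : ℂ} (hPQ : P ≠ Q) :
    ∃ C : ℝ, ∀ z ∉ segment ℝ P Q, ‖deriv (slitBarrier P Q) z‖ ≤
      C * ((‖z - P‖ ^ (1 / 4 : ℝ))⁻¹ ^ 3 + (‖z - Q‖ ^ (1 / 4 : ℝ))⁻¹ ^ 3) := by
  set l := ‖P - Q‖ with hl
  have hl0 : 0 < l := norm_pos_iff.2 (sub_ne_zero.2 hPQ)
  set m := (l / 2) ^ (1 / 4 : ℝ) with hm
  have hm0 : 0 < m := by positivity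
  refine ⟨l / 4 * m⁻¹ ^ 5, fun z hz => ?_⟩
  obtain ⟨h1, h2⟩ := sub_ne_zero_of_notMem_segment hz
  have hA : 0 < ‖z - P‖ := norm_pos_iff.2 h1
  have hB : 0 < ‖z - Q‖ := norm_pos_iff.2 h2
  have ha : 0 < ‖z - P‖ ^ (1 / 4 : ℝ) := by positivity
  have hb : 0 < ‖z - Q‖ ^ (1 / 4 : ℝ) := by positivity
  have pow4 : ∀ t : ℝ, 0 ≤ t → (t ^ (1 / 4 : ℝ)) ^ 4 = t := fun t ht => by
    rw [← Real.rpow_natCast, ← Real.rpow_mul ht]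
    norm_num
  have hs := norm_slitRoot hz
  have h1s := one_le_norm_one_add P Q z
  have h2s := norm_le_norm_one_add P Q z
  have hs0 : 0 < ‖slitRoot P Q z‖ := norm_pos_iff.2 (slitRoot_ne_zero P Q z)
  have hA4 := pow4 _ hA.le
  have hB4 := pow4 _ hB.le
  have hd : ‖deriv (slitBarrier P Q) z‖ = ‖slitRoot P Q z‖ / ‖1 + slitRoot P Q z‖ ^ 2 *
      (l / (4 * (‖z - P‖ * ‖z - Q‖))) := by
    rw [(hasDerivAt_slitBarrier hz).deriv]
    simp [hl]
  set a := ‖z - P‖ ^ (1 / 4 : ℝ) with ha'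
  set b := ‖z - Q‖ ^ (1 / 4 : ℝ) with hb'
  have tri : l ≤ ‖z - P‖ + ‖z - Q‖ := by
    have := norm_sub_le (z - Q) (z - P)
    rw [sub_sub_sub_cancel_left] at this
    linarith
  rw [hd]
  obtain h | h : l / 2 ≤ ‖z - Q‖ ∨ l / 2 ≤ ‖z - P‖ := by
    by_contra! h
    linarith
  · have hmb : m ≤ b := Real.rpow_le_rpow (by positivity) h (by norm_num)
    have hle : ‖slitRoot P Q z‖ / ‖1 + slitRoot P Q z‖ ^ 2 ≤ a / b := by
      rw [← hs]
      exact div_le_self hs0.le (one_le_pow₀ h1s)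
    calc _ ≤ a / b * (l / (4 * (‖z - P‖ * ‖z - Q‖))) := by gcongr
      _ = l / 4 * b⁻¹ ^ 5 * a⁻¹ ^ 3 := by
        rw [← hA4, ← hB4]
        field_simp
      _ ≤ l / 4 * m⁻¹ ^ 5 * (a⁻¹ ^ 3 + b⁻¹ ^ 3) := by
        gcongr
        exact le_add_of_nonneg_right (by positivity)
  · have hma : m ≤ a := Real.rpow_le_rpow (by positivity) h (by norm_num)
    have hle : ‖slitRoot P Q z‖ / ‖1 + slitRoot P Q z‖ ^ 2 ≤ b / a := by
      calc _ ≤ ‖slitRoot P Q z‖ / ‖slitRoot P Q z‖ ^ 2 := by gcongr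
        _ = _ := by
          rw [hs]
          field_simp
    calc _ ≤ b / a * (l / (4 * (‖z - P‖ * ‖z - Q‖))) := by gcongr
      _ = l / 4 * a⁻¹ ^ 5 * b⁻¹ ^ 3 := by
        rw [← hA4, ← hB4]
        field_simp
      _ ≤ l / 4 * m⁻¹ ^ 5 * (a⁻¹ ^ 3 + b⁻¹ ^ 3) := by
        gcongr
        exact le_add_of_nonneg_left (by positivity)

/-- The identification of the Euclidean plane with the complex numbers. -/
def toComplex : Plane ≃ₗᵢ[ℝ] ℂ := Complex.orthonormalBasisOneI.repr.symm

theorem toComplex_single_zero : toComplex (EuclideanSpace.single 0 1) = 1 := by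
  simp [toComplex]

theorem toComplex_single_one : toComplex (EuclideanSpace.single 1 1) = Complex.I := by
  simp [toComplex]

theorem hasFDerivAt_re_comp_toComplex {f : ℂ → ℂ} {x : Plane} {f' : ℂ}
    (hf : HasDerivAt f f' (toComplex x)) :
    ∃ L : Plane →L[ℝ] ℝ, HasFDerivAt (fun x => (f (toComplex x)).re) L x ∧
      ∀ v, L v = (f' * toComplex v).re := by
  have h1 := (hf.hasFDerivAt.restrictScalars ℝ).comp x
    toComplex.toContinuousLinearEquiv.toContinuousLinearMap.hasFDerivAt
  have h2 := Complex.reCLM.hasFDerivAt.comp x h1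
  exact ⟨_, h2, fun v => by simp [mul_comm]⟩

variable {n : ℕ} {E : PolygonalElement n}

/-- The partial derivatives of `Re f` are `Re f'` and `Re (i f')`. After one integration by parts in
each variable, the integrand contains `Re f'' + Re (i² f'') = 0`. -/
theorem isHarmonic_re_comp_toComplex {U : Set ℂ} (hU : IsOpen U) {f : ℂ → ℂ}
    (hf : DifferentiableOn ℂ f U) (hEU : ∀ x ∈ interior E.carrier, toComplex x ∈ U) :
    ContDiffOn ℝ (⊤ : ℕ∞) (fun x => (f (toComplex x)).re) (interior E.carrier) ∧
      (∀ x ∈ interior E.carrier,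
        ‖gradient (fun x => (f (toComplex x)).re) x‖ ≤ ‖deriv f (toComplex x)‖) ∧
      ∀ ψ, E.IsTest ψ →
        ∫ x in E.carrier, inner ℝ (gradient (fun x => (f (toComplex x)).re) x) (gradient ψ x) = 0 := by
  have hsm : ∀ {h : ℂ → ℂ}, DifferentiableOn ℂ h U →
      ContDiffOn ℝ (⊤ : ℕ∞) (fun x => (h (toComplex x)).re) (interior E.carrier) := fun hh =>
    Complex.reCLM.contDiff.comp_contDiffOn
      (((hh.contDiffOn hU).restrict_scalars ℝ).comp toComplex.contDiff.contDiffOn hEU)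
  have hder : ∀ {h : ℂ → ℂ}, DifferentiableOn ℂ h U → ∀ x ∈ interior E.carrier, ∀ v,
      fderiv ℝ (fun x => (h (toComplex x)).re) x v = (deriv h (toComplex x) * toComplex v).re := by
    intro h hh x hx v
    obtain ⟨L, hL, hLv⟩ := hasFDerivAt_re_comp_toComplex
      (hh.hasDerivAt (hU.mem_nhds (hEU x hx)))
    rw [hL.fderiv, hLv]
  have hf' : DifferentiableOn ℂ (deriv f) U := hf.deriv hU
  refine ⟨hsm hf, fun x hx => ?_, fun ψ hψ => ?_⟩
  · rw [gradient, LinearIsometryEquiv.norm_map]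
    refine ContinuousLinearMap.opNorm_le_bound _ (norm_nonneg _) fun v => ?_
    rw [hder hf x hx v]
    refine (Complex.abs_re_le_norm _).trans ?_
    rw [norm_mul, LinearIsometryEquiv.norm_map]
  · have hI : DifferentiableOn ℂ (fun z => deriv f z * Complex.I) U := hf'.mul_const _
    have e0 : ∀ᵐ x ∂volume.restrict E.carrier,
        inner ℝ (gradient (fun x => (f (toComplex x)).re) x) (gradient ψ x) =
        (deriv f (toComplex x)).re * fderiv ℝ ψ x (EuclideanSpace.single 0 1) +
          (deriv f (toComplex x) * Complex.I).re * fderiv ℝ ψ x (EuclideanSpace.single 1 1) := by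
      filter_upwards [ae_mem_interior E] with x hx
      rw [inner_eq_sum, Fin.sum_univ_two]
      simp only [inner_gradient_left, hder hf x hx, toComplex_single_zero, toComplex_single_one,
        mul_one]
    have hi : ∀ {h : ℂ → ℂ}, DifferentiableOn ℂ h U → ∀ v : Plane, IntegrableOn
        (fun x => (h (toComplex x)).re * fderiv ℝ ψ x v) E.carrier := fun hh v =>
      ((hψ.fderiv_apply v).mul_continuousOn (hsm hh).continuousOn).integrableOn
    rw [integral_congr_ae e0, integral_add (hi hf' _) (hi hI _),
      hψ.integral_mul_fderiv ((hsm hf').of_le (by simp)),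
      hψ.integral_mul_fderiv ((hsm hI).of_le (by simp)), ← neg_add, neg_eq_zero,
      ← integral_add]
    · refine integral_eq_zero_of_ae ?_
      filter_upwards [ae_mem_interior E] with x hx
      have h1 : deriv (fun z => deriv f z * Complex.I) (toComplex x) =
          deriv (deriv f) (toComplex x) * Complex.I :=
        deriv_mul_const (hf'.differentiableAt (hU.mem_nhds (hEU x hx))) _
      rw [hder hf' x hx, hder hI x hx, h1, toComplex_single_zero, toComplex_single_one, mul_assoc,
        Complex.I_mul_I]
      simp
    · exact (hψ.mul_continuousOn (((hsm hf').continuousOn_fderiv_of_isOpen isOpen_interior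
        (by simp)).clm_apply continuousOn_const)).integrableOn
    · exact (hψ.mul_continuousOn (((hsm hI).continuousOn_fderiv_of_isOpen isOpen_interior
        (by simp)).clm_apply continuousOn_const)).integrableOn

end

/-! ### Barriers on the polygon and continuity up to the boundary. -/

noncomputable section

variable {n : ℕ} {E : PolygonalElement n}

/-- The square is `‖x - p‖ ^ (-3/2)`, locally integrable in the plane because `3/2 < 2`. -/
theorem memLp_inv_norm_rpow (p : Plane) :
    MemLp (fun x => (‖x - p‖ ^ (1 / 4 : ℝ))⁻¹ ^ 3) 2 (volume.restrict E.carrier) := by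
  have hm : Measurable fun x : Plane => (‖x - p‖ ^ (1 / 4 : ℝ))⁻¹ ^ 3 := by fun_prop
  rw [memLp_two_iff_integrable_sq hm.aestronglyMeasurable]
  have hm' : Measurable fun x : Plane => ((‖x‖ ^ (1 / 4 : ℝ))⁻¹ ^ 3) ^ 2 := by fun_prop
  have h1 : LocallyIntegrable (fun x : Plane => ((‖x‖ ^ (1 / 4 : ℝ))⁻¹ ^ 3) ^ 2) := by
    refine locallyIntegrable_of_norm_le_rpow (C := 1) (α := 3 / 2) (by simp) (by simp; norm_num)
      (Eventually.of_forall fun x => ?_) hm'.aestronglyMeasurable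
    rw [Real.norm_of_nonneg (by positivity), one_mul, ← pow_mul, inv_pow, ← Real.rpow_natCast,
      ← Real.rpow_mul (norm_nonneg x), Real.rpow_neg (norm_nonneg x)]
    norm_num
  have hK : IsCompact ((fun x => x - p) '' E.carrier) := E.isCompact.image (by fun_prop)
  have h2 := (measurePreserving_sub_right volume p).integrableOn_comp_preimage
    (Homeomorph.subRight p).measurableEmbedding |>.2 (h1.integrableOn_isCompact hK)
  exact h2.mono_set (Set.subset_preimage_image _ _)

/-- Barriers at the endpoint of a segment contained in the boundary. -/
theorem exists_barrier {p q : Plane} (hpq : p ≠ q) (hseg : segment ℝ p q ⊆ frontier E.carrier) :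
    ∃ b : Plane → ℝ, ContDiffOn ℝ (⊤ : ℕ∞) b (interior E.carrier) ∧
      MemLp (gradient b) 2 (volume.restrict E.carrier) ∧
      (∀ ψ, E.IsTest ψ → ∫ x in E.carrier, inner ℝ (gradient b x) (gradient ψ x) = 0) ∧
      (∀ x ∈ interior E.carrier, 0 ≤ b x) ∧ Tendsto b (𝓝[interior E.carrier] p) (𝓝 0) ∧
      ∀ r > 0, ∃ c > 0, ∀ x ∈ interior E.carrier, r ≤ ‖x - p‖ → c ≤ b x := by
  set P := toComplex p with hP
  set Q := toComplex q with hQ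
  have hPQ : P ≠ Q := toComplex.injective.ne hpq
  set U := (segment ℝ P Q)ᶜ with hU
  have hUo : IsOpen U := by
    rw [hU, isOpen_compl_iff, segment_eq_image_lineMap]
    exact (isCompact_Icc.image (AffineMap.lineMap_continuous)).isClosed
  have hEU : ∀ x ∈ interior E.carrier, toComplex x ∈ U := by
    intro x hx h
    have h1 : segment ℝ P Q = toComplex '' segment ℝ p q :=
      (image_segment ℝ toComplex.toLinearEquiv.toLinearMap.toAffineMap p q).symm
    rw [h1] at h
    obtain ⟨y, hy, hyx⟩ := h
    rw [toComplex.injective hyx] at hy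
    exact (hseg hy).2 hx
  have hd : DifferentiableOn ℂ (slitBarrier P Q) U := fun z hz =>
    (hasDerivAt_slitBarrier hz).differentiableAt.differentiableWithinAt
  obtain ⟨h1, h2, h3⟩ := isHarmonic_re_comp_toComplex hUo hd hEU
  have hdist : ∀ x y, ‖toComplex x - toComplex y‖ = ‖x - y‖ := fun x y => by
    rw [← map_sub, LinearIsometryEquiv.norm_map]
  refine ⟨fun x => (slitBarrier P Q (toComplex x)).re, h1, ?_, h3, ?_, ?_, ?_⟩
  · obtain ⟨C, hC⟩ := exists_norm_deriv_slitBarrier_le hPQ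
    refine (((memLp_inv_norm_rpow p).add (memLp_inv_norm_rpow q)).const_mul C).mono ?_ ?_
    · rw [restrict_carrier_eq]
      refine ContinuousOn.aestronglyMeasurable ?_ isOpen_interior.measurableSet
      exact (InnerProductSpace.toDual ℝ Plane).symm.continuous.comp_continuousOn
        (h1.continuousOn_fderiv_of_isOpen isOpen_interior (by simp))
    · filter_upwards [ae_mem_interior E] with x hx
      refine ((h2 x hx).trans (hC _ (hEU x hx))).trans (le_trans (le_of_eq ?_) (le_abs_self _))
      rw [hP, hQ, hdist, hdist]
      rfl
  · intro x hx
    exact le_trans (by positivity) (le_slitBarrier_re P Q _)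
  · have ht : Tendsto (fun x : Plane => ‖x - p‖ ^ (1 / 4 : ℝ) / ‖x - q‖ ^ (1 / 4 : ℝ))
        (𝓝[interior E.carrier] p) (𝓝 0) := by
      have hc : ContinuousAt (fun x : Plane => ‖x - p‖ ^ (1 / 4 : ℝ) / ‖x - q‖ ^ (1 / 4 : ℝ)) p := by
        have h0 : ‖p - q‖ ^ (1 / 4 : ℝ) ≠ 0 :=
          (Real.rpow_pos_of_pos (norm_pos_iff.2 (sub_ne_zero.2 hpq)) _).ne'
        refine ContinuousAt.div ?_ ?_ h0
        · exact (continuous_id.sub continuous_const).norm.continuousAt.rpow_const (.inr (by norm_num))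
        · exact (continuous_id.sub continuous_const).norm.continuousAt.rpow_const (.inr (by norm_num))
      have := hc.tendsto
      simp only [sub_self, norm_zero] at this
      rw [Real.zero_rpow (by norm_num), zero_div] at this
      exact this.mono_left nhdsWithin_le_nhds
    refine squeeze_zero_norm' ?_ ht
    filter_upwards [self_mem_nhdsWithin] with x hx
    have := norm_slitBarrier_le (hEU x hx)
    rw [hP, hQ, hdist, hdist] at this
    exact (Complex.abs_re_le_norm _).trans this
  · intro r hr
    obtain ⟨R, hR⟩ := E.isCompact.isBounded.exists_norm_le
    set D := R + ‖q‖ + 1 with hD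
    have hDx : ∀ x ∈ interior E.carrier, ‖x - q‖ ≤ D ∧ 0 ≤ R := fun x hx => by
      have h4 := hR x (interior_subset hx)
      have h5 := norm_sub_le x q
      exact ⟨by linarith, (norm_nonneg x).trans h4⟩
    obtain hE | ⟨x₀, hx₀⟩ := (interior E.carrier).eq_empty_or_nonempty
    · exact ⟨1, one_pos, fun x hx => by simp [hE] at hx⟩
    have hD0 : 0 < D := by linarith [(hDx x₀ hx₀).2, norm_nonneg q]
    -- A lower bound for the modulus of the root when `x` is at distance at least `r` from `p` and,
    -- by boundedness of `E`, at most `D` from `q`.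
    set σ := r ^ (1 / 4 : ℝ) / D ^ (1 / 4 : ℝ) with hσ
    have hσ0 : 0 < σ := by positivity
    refine ⟨σ / (2 * (1 + σ)), by positivity, fun x hx hrx => ?_⟩
    refine le_trans ?_ (le_slitBarrier_re P Q _)
    have h6 := norm_slitRoot (hEU x hx)
    rw [hP, hQ, hdist, hdist, ← hP, ← hQ] at h6
    have hq : 0 < ‖x - q‖ := by
      have := (sub_ne_zero_of_notMem_segment (hEU x hx)).2
      rw [← hdist]
      exact norm_pos_iff.2 this
    have h7 : σ ≤ ‖slitRoot P Q (toComplex x)‖ := by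
      rw [h6, hσ]
      have := (hDx x hx).1
      gcongr
    rw [div_le_div_iff₀ (by positivity) (by positivity)]
    nlinarith

theorem vertex_ne (E : PolygonalElement n) (i : Fin n) : E.curve i ≠ E.curve (finRotate n i) := by
  intro h
  have h1 := E.vertices_injective h
  have h3 := E.three_le
  obtain ⟨m, rfl⟩ : ∃ m, n = m + 2 := ⟨n - 2, by omega⟩
  rw [finRotate_apply] at h1
  simp at h1

theorem edgeSet_subset_frontier (E : PolygonalElement n) (i : Fin n) :
    E.curve.edgeSet ℝ i ⊆ frontier E.carrier := by
  rw [E.frontier_eq]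
  exact Set.subset_iUnion (fun i => E.curve.edgeSet ℝ i) i

/-- The point lies on an edge, and at least one end of that edge differs from it. Thus every
boundary point, reentrant corners included, has a barrier. -/
theorem exists_segment_subset_frontier {p : Plane} (hp : p ∈ frontier E.carrier) :
    ∃ q, p ≠ q ∧ segment ℝ p q ⊆ frontier E.carrier := by
  rw [E.frontier_eq] at hp
  obtain ⟨i, hi⟩ := Set.mem_iUnion.1 hp
  have hsub := E.edgeSet_subset_frontier i
  rw [Polygon.edgeSet, affineSegment_eq_segment] at hi hsub
  by_cases h : p = E.curve (finRotate n i)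
  · refine ⟨E.curve i, fun h' => E.vertex_ne i (h'.symm.trans h), ?_⟩
    exact ((convex_segment _ _).segment_subset hi (left_mem_segment ℝ _ _)).trans hsub
  · exact ⟨_, h, ((convex_segment _ _).segment_subset hi (right_mem_segment ℝ _ _)).trans hsub⟩

/-- The harmonic function `S = g p + ε / 2 + M b`, with `b` the barrier at `p`, dominates `g`: near
`p` by continuity of `g`, elsewhere by the size of `M`. Comparison gives `w ≤ S`, and `S` tends to
`g p + ε / 2` at `p`. The lower bound follows by applying this to `-w`. -/
theorem HasTrace.eventually_le {w g : Plane → ℝ} {G : Plane → Plane} (h : E.HasTrace w G g)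
    (hG : ∀ ψ, E.IsTest ψ → ∫ x in E.carrier, inner ℝ (G x) (gradient ψ x) = 0)
    (hg : ContDiff ℝ (⊤ : ℕ∞) g) (hw : ContinuousOn w (interior E.carrier)) {p : Plane}
    (hp : p ∈ frontier E.carrier) {ε : ℝ} (hε : 0 < ε) :
    ∀ᶠ x in 𝓝[interior E.carrier] p, w x < g p + ε := by
  obtain ⟨q, hpq, hseg⟩ := exists_segment_subset_frontier hp
  obtain ⟨b, hb, hb2, hb0, hbnn, hblim, hbc⟩ := exists_barrier hpq hseg
  obtain ⟨r, hr, hgr⟩ := Metric.continuousAt_iff.1 hg.continuous.continuousAt (ε / 2) (half_pos hε)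
  obtain ⟨c, hc, hcb⟩ := hbc r hr
  obtain ⟨B, hB⟩ := E.isCompact.exists_bound_of_continuousOn hg.continuous.continuousOn
  have hpB := hB p (E.isCompact.isClosed.frontier_subset hp)
  have hB0 : 0 ≤ B := (norm_nonneg _).trans hpB
  -- At distance at least `r` from `p` this gives `M b ≥ 2 B ≥ g - g p`.
  set M := 2 * B / c with hM
  have hM0 : 0 ≤ M := by positivity
  set S : Plane → ℝ := fun x => g p + ε / 2 + M * b x with hS
  have hSc : ContDiffOn ℝ (⊤ : ℕ∞) S (interior E.carrier) :=
    contDiffOn_const.add (contDiffOn_const.mul hb)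
  have hSg : ∀ᵐ x ∂volume.restrict E.carrier, gradient S x = M • gradient b x := by
    filter_upwards [ae_mem_interior E] with x hx
    have h1 : DifferentiableAt ℝ b x :=
      (hb.contDiffAt (isOpen_interior.mem_nhds hx)).differentiableAt (by simp)
    have h2 : fderiv ℝ S x = _ := ((h1.hasFDerivAt.const_mul M).const_add (g p + ε / 2)).fderiv
    rw [gradient, h2, map_smul, gradient]
  have hgS : ∀ x ∈ interior E.carrier, g x ≤ S x := by
    intro x hx
    have hbx := hbnn x hx
    by_cases hxr : dist x p < r
    · have := (abs_lt.1 (hgr hxr)).2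
      have h3 : 0 ≤ M * b x := mul_nonneg hM0 hbx
      simp only [hS]
      linarith
    · rw [not_lt, dist_eq_norm] at hxr
      have h3 : M * c ≤ M * b x := mul_le_mul_of_nonneg_left (hcb x hx hxr) hM0
      have h4 : M * c = 2 * B := div_mul_cancel₀ _ hc.ne'
      have h5 := (abs_le.1 hpB).1
      have h6 := (abs_le.1 (hB x (interior_subset hx))).2
      simp only [hS]
      linarith
  have hle := h.ae_le hG hg hSc ((memLp_congr_ae hSg).2 (hb2.const_smul M)) (fun ψ hψ => by
    have : ∀ᵐ x ∂volume.restrict E.carrier, inner ℝ (gradient S x) (gradient ψ x) =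
        M * inner ℝ (gradient b x) (gradient ψ x) := by
      filter_upwards [hSg] with x hx
      rw [hx, real_inner_smul_left]
    rw [integral_congr_ae this, integral_const_mul, hb0 ψ hψ, mul_zero]) hgS
  -- The almost everywhere inequality is upgraded to all interior points: it says that two
  -- continuous functions, `max w S` and `S`, agree almost everywhere.
  have hmax : Set.EqOn (fun x => max (w x) (S x)) S (interior E.carrier) := by
    refine eqOn_interior ?_ (hw.sup hSc.continuousOn) hSc.continuousOn
    filter_upwards [hle] with x hx using max_eq_right hx
  have hSlim : Tendsto S (𝓝[interior E.carrier] p) (𝓝 (g p + ε / 2 + M * 0)) :=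
    (hblim.const_mul M).const_add _
  filter_upwards [hSlim.eventually_lt_const (by linarith : g p + ε / 2 + M * 0 < g p + ε),
    self_mem_nhdsWithin] with x hx hxi
  exact (max_eq_right_iff.1 (hmax hxi)).trans_lt hx

theorem HasTrace.congr {u w g : Plane → ℝ} {G : Plane → Plane} (h : E.HasTrace u G g)
    (huw : u =ᵐ[volume.restrict E.carrier] w) : E.HasTrace w G g where
  memLp := (memLp_congr_ae huw).1 h.memLp
  memLp_gradient := h.memLp_gradient
  approx δ hδ := by
    obtain ⟨φ, hφ, h1, h2⟩ := h.approx δ hδ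
    refine ⟨φ, hφ, h1, ?_⟩
    rwa [eLpNorm_congr_ae (((huw.symm.sub .rfl).sub .rfl))]

/-- The Dirichlet problem with smooth boundary data. -/
theorem exists_dirichlet {g : Plane → ℝ} (hg : ContDiff ℝ (⊤ : ℕ∞) g) :
    ∃ (ζ : C(E.carrier, ℝ)) (G : Plane → Plane), E.HasTrace (extend ζ) G g ∧
      (∀ ψ, E.IsTest ψ → ∫ x in E.carrier, inner ℝ (G x) (gradient ψ x) = 0) ∧
      (eLpNorm G 2 (volume.restrict E.carrier)).toReal ≤
        (eLpNorm (gradient g) 2 (volume.restrict E.carrier)).toReal ∧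
      ∀ x ∈ frontier E.carrier, extend ζ x = g x := by
  obtain ⟨u, G, htr, hG, hGn⟩ := exists_hasTrace (E := E) hg
  have hui : IntegrableOn u E.carrier := htr.memLp.integrable (by norm_num)
  obtain ⟨w, hw, huw, -⟩ := exists_continuousOn_of_lap_eq_zero hui fun ψ hψ => by
    rw [(htr.isDistribGradient hg).integral_mul_lap hui htr.memLp_gradient hψ, hG ψ hψ, neg_zero]
  have htw := htr.congr huw
  have hlim : ∀ p ∈ frontier E.carrier, Tendsto w (𝓝[interior E.carrier] p) (𝓝 (g p)) := by
    intro p hp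
    rw [Metric.tendsto_nhds]
    intro ε hε
    have h1 := htw.eventually_le hG hg hw hp hε
    have h2 := htw.neg.eventually_le (fun ψ hψ => by
      simp only [Pi.neg_apply, inner_neg_left, integral_neg, hG ψ hψ, neg_zero]) hg.neg hw.neg hp hε
    filter_upwards [h1, h2] with x hx1 hx2
    simp only [Pi.neg_apply] at hx2
    rw [Real.dist_eq, abs_lt]
    constructor <;> linarith
  classical
  -- The continuous representative inside and the data on the boundary are glued; `hlim` makes the
  -- result continuous on `E`.
  set f : Plane → ℝ := fun x => if x ∈ interior E.carrier then w x else g x with hf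
  have hfi : ∀ x ∈ interior E.carrier, f x = w x := fun x hx => if_pos hx
  have hfb : ∀ x ∈ frontier E.carrier, f x = g x := fun x hx => if_neg hx.2
  have hfc : ContinuousOn f E.carrier := by
    intro x hx
    obtain hxi | hxb := mem_interior_or_frontier hx
    · have h1 : ContinuousAt w x := hw.continuousAt (isOpen_interior.mem_nhds hxi)
      refine (h1.congr ?_).continuousWithinAt
      filter_upwards [isOpen_interior.mem_nhds hxi] with y hy using (hfi y hy).symm
    · have hsub : E.carrier ⊆ interior E.carrier ∪ frontier E.carrier := fun y hy =>
        mem_interior_or_frontier hy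
      refine ContinuousWithinAt.mono ?_ hsub
      rw [ContinuousWithinAt, hfb x hxb, nhdsWithin_union, tendsto_sup]
      constructor
      · refine (hlim x hxb).congr' ?_
        filter_upwards [self_mem_nhdsWithin] with y hy using (hfi y hy).symm
      · refine (hg.continuous.continuousAt.tendsto.mono_left nhdsWithin_le_nhds).congr' ?_
        filter_upwards [self_mem_nhdsWithin] with y hy using (hfb y hy).symm
  set ζ : C(E.carrier, ℝ) := ⟨E.carrier.domRestrict f, continuousOn_iff_continuous_domRestrict.1 hfc⟩
    with hζ
  have hext : ∀ x ∈ E.carrier, extend ζ x = f x := fun x hx => extend_coe ζ ⟨x, hx⟩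
  refine ⟨ζ, G, htw.congr ?_, hG, hGn, fun x hx => ?_⟩
  · filter_upwards [ae_mem_interior E] with x hx
    rw [hext x (interior_subset hx), hfi x hx]
  · rw [hext x (E.isCompact.isClosed.frontier_subset hx), hfb x hx]

end

/-! ### Edgewise affine boundary data: Lipschitz extension and smoothing. -/

noncomputable section

theorem exists_affineMap_eq {p q : Plane} (hpq : p ≠ q) (s t : ℝ) :
    ∃ a : Plane →ᵃ[ℝ] ℝ, a p = s ∧ a q = t := by
  have h0 : q - p ≠ 0 := sub_ne_zero.2 hpq.symm
  have h1 : inner ℝ (q - p) (q - p) ≠ 0 := inner_self_ne_zero.2 h0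
  refine ⟨((t - s) / inner ℝ (q - p) (q - p)) •
    ((innerSL ℝ (q - p)).toLinearMap.toAffineMap - AffineMap.const ℝ Plane (inner ℝ (q - p) p)) +
      AffineMap.const ℝ Plane s, ?_, ?_⟩
  · simp only [AffineMap.coe_add, AffineMap.coe_smul, AffineMap.coe_sub, Pi.add_apply,
      Pi.smul_apply, Pi.sub_apply, LinearMap.coe_toAffineMap, ContinuousLinearMap.coe_coe,
      innerSL_apply_apply, AffineMap.const_apply, sub_self, smul_zero, zero_add]
  · have h2 : inner ℝ (q - p) q - inner ℝ (q - p) p = inner ℝ (q - p) (q - p) := by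
      rw [← inner_sub_right]
    simp only [AffineMap.coe_add, AffineMap.coe_smul, AffineMap.coe_sub, Pi.add_apply,
      Pi.smul_apply, Pi.sub_apply, LinearMap.coe_toAffineMap, ContinuousLinearMap.coe_coe,
      innerSL_apply_apply, AffineMap.const_apply, smul_eq_mul, h2]
    field_simp
    ring

theorem exists_affineMap_lipschitz (a : Plane →ᵃ[ℝ] ℝ) :
    ∃ K : ℝ, 0 ≤ K ∧ ∀ x y, |a x - a y| ≤ K * ‖x - y‖ := by
  refine ⟨‖a.linear.toContinuousLinearMap‖, norm_nonneg _, fun x y => ?_⟩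
  have h := a.linear.toContinuousLinearMap.le_opNorm (x - y)
  have h2 : a.linear (x - y) = a x - a y := a.linearMap_vsub x y
  rw [LinearMap.coe_toContinuousLinearMap', h2] at h
  exact h

/-- Write `c < 1` for the cosine of the angle, `A = ‖s • d₁‖` and `B = ‖t • d₂‖`. Then `2 (A² + B² -
2 c A B) - (1 - c) (A + B)² = (1 + c) (A - B)² ≥ 0`, whence the constant `√(2 / (1 - c))`. -/
theorem norm_smul_add_norm_smul_le {d₁ d₂ : Plane} (h : inner ℝ d₁ d₂ < ‖d₁‖ * ‖d₂‖) :
    ∃ C : ℝ, 0 ≤ C ∧ ∀ s t : ℝ, 0 ≤ s → 0 ≤ t →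
      ‖s • d₁‖ + ‖t • d₂‖ ≤ C * ‖s • d₁ - t • d₂‖ := by
  have hd : 0 < ‖d₁‖ * ‖d₂‖ := by
    have h1 := abs_real_inner_le_norm d₁ d₂
    by_contra! h2
    have := neg_abs_le (inner ℝ d₁ d₂)
    have h3 : ‖d₁‖ * ‖d₂‖ = 0 := le_antisymm h2 (by positivity)
    rw [h3] at h h1
    linarith
  set c := inner ℝ d₁ d₂ / (‖d₁‖ * ‖d₂‖) with hc
  have hc1 : c < 1 := (div_lt_one hd).2 h
  have hc2 : -1 ≤ c := (abs_le.1 (abs_real_inner_div_norm_mul_norm_le_one d₁ d₂)).1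
  have hin : inner ℝ d₁ d₂ = c * (‖d₁‖ * ‖d₂‖) := (div_mul_cancel₀ _ hd.ne').symm
  refine ⟨√(2 / (1 - c)), Real.sqrt_nonneg _, fun s t hs ht => ?_⟩
  rw [← Real.sqrt_sq (norm_nonneg (s • d₁ - t • d₂)), ← Real.sqrt_mul
    (div_nonneg zero_le_two (by linarith))]
  refine Real.le_sqrt_of_sq_le ?_
  rw [div_mul_eq_mul_div, le_div_iff₀ (by linarith), norm_sub_sq_real, real_inner_smul_left,
    real_inner_smul_right, hin, norm_smul, norm_smul, Real.norm_of_nonneg hs, Real.norm_of_nonneg ht]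
  nlinarith [mul_nonneg (by linarith : 0 ≤ 1 + c) (sq_nonneg (s * ‖d₁‖ - t * ‖d₂‖))]

/-- Segments leaving `p` in the same direction would overlap beyond `p`, so Cauchy–Schwarz is strict
for the two directions. Opposite directions, that is, flat angles, are harmless. -/
theorem exists_norm_add_norm_le_of_segments {p p₁ p₂ : Plane} (h₁ : p ≠ p₁) (h₂ : p ≠ p₂)
    (hint : segment ℝ p p₁ ∩ segment ℝ p p₂ ⊆ {p, p₁}) :
    ∃ C : ℝ, 0 ≤ C ∧ ∀ x ∈ segment ℝ p p₁, ∀ y ∈ segment ℝ p p₂,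
      ‖x - p‖ + ‖y - p‖ ≤ C * ‖x - y‖ := by
  have hd₁ : 0 < ‖p₁ - p‖ := norm_pos_iff.2 (sub_ne_zero.2 h₁.symm)
  have hd₂ : 0 < ‖p₂ - p‖ := norm_pos_iff.2 (sub_ne_zero.2 h₂.symm)
  have hlt : inner ℝ (p₁ - p) (p₂ - p) < ‖p₁ - p‖ * ‖p₂ - p‖ := by
    refine lt_of_le_of_ne (real_inner_le_norm _ _) fun heq => ?_
    rw [inner_eq_norm_mul_iff_real] at heq
    -- The normalization makes `p + (k * ‖p₂ - p‖) • (p₁ - p)` a point strictly inside both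
    -- segments, hence a forbidden common point.
    set k := (2 * (‖p₁ - p‖ + ‖p₂ - p‖))⁻¹ with hk
    have hk0 : 0 < k := by positivity
    have hk1 : k * ‖p₂ - p‖ < 1 := by
      rw [hk, inv_mul_lt_iff₀ (by positivity)]
      linarith
    have hk2 : k * ‖p₁ - p‖ < 1 := by
      rw [hk, inv_mul_lt_iff₀ (by positivity)]
      linarith
    have hmem : ∀ (r : Plane) (t : ℝ), 0 ≤ t → t ≤ 1 → p + t • (r - p) ∈ segment ℝ p r :=
      fun r t h0 h1 => by
        rw [segment_eq_image']
        exact ⟨t, ⟨h0, h1⟩, rfl⟩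
    have hz := hint ⟨hmem p₁ (k * ‖p₂ - p‖) (by positivity) hk1.le, by
      rw [mul_smul, heq, ← mul_smul]
      exact hmem p₂ _ (by positivity) hk2.le⟩
    obtain hz | hz := hz
    · rw [add_eq_left, smul_eq_zero, sub_eq_zero] at hz
      obtain hz | hz := hz
      · exact (by positivity : 0 < k * ‖p₂ - p‖).ne' hz
      · exact h₁ hz.symm
    · have hz : p + (k * ‖p₂ - p‖) • (p₁ - p) = p₁ := hz
      have : (k * ‖p₂ - p‖ - 1) • (p₁ - p) = 0 := by
        rw [sub_smul, one_smul, sub_eq_zero]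
        exact eq_sub_of_add_eq' hz
      obtain h | h := smul_eq_zero.1 this
      · linarith
      · exact h₁ (sub_eq_zero.1 h).symm
  obtain ⟨C, hC0, hC⟩ := norm_smul_add_norm_smul_le hlt
  refine ⟨C, hC0, fun x hx y hy => ?_⟩
  rw [segment_eq_image'] at hx hy
  obtain ⟨s, hs, rfl⟩ := hx
  obtain ⟨t, ht, rfl⟩ := hy
  simpa using hC s t hs.1 ht.1

variable {n : ℕ} {E : PolygonalElement n}

/-- Affine functions on two different edges, with the same values at common vertices, are
Lipschitz continuous across the edges. -/
theorem exists_edge_lipschitz (v : Fin n → ℝ) {a : Fin n → Plane →ᵃ[ℝ] ℝ}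
    (ha : ∀ i, a i (E.curve i) = v i ∧ a i (E.curve (finRotate n i)) = v (finRotate n i))
    (i j : Fin n) : ∃ K : ℝ, 0 ≤ K ∧ ∀ x ∈ E.curve.edgeSet ℝ i, ∀ y ∈ E.curve.edgeSet ℝ j,
      |a i x - a j y| ≤ K * ‖x - y‖ := by
  have hcomp : ∀ i, IsCompact (E.curve.edgeSet ℝ i) := fun i => by
    rw [Polygon.edgeSet_eq_image_edgePath]
    exact isCompact_Icc.image AffineMap.lineMap_continuous
  obtain ⟨K₁, hK₁, h₁⟩ := exists_affineMap_lipschitz (a i)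
  obtain ⟨K₂, hK₂, h₂⟩ := exists_affineMap_lipschitz (a j)
  by_cases hij : i = j
  · subst hij
    exact ⟨K₁, hK₁, fun x _ y _ => h₁ x y⟩
  by_cases hdis : Disjoint (E.curve.edgeSet ℝ i) (E.curve.edgeSet ℝ j)
  · obtain ⟨r, hr, hlt⟩ := Metric.exists_pos_forall_lt_edist (hcomp i) (hcomp j).isClosed hdis
    obtain ⟨B₁, hB₁⟩ := (hcomp i).exists_bound_of_continuousOn
      (a i).continuous_of_finiteDimensional.continuousOn
    obtain ⟨B₂, hB₂⟩ := (hcomp j).exists_bound_of_continuousOn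
      (a j).continuous_of_finiteDimensional.continuousOn
    refine ⟨(|B₁| + |B₂|) / r, by positivity, fun x hx y hy => ?_⟩
    have hxy : (r : ℝ) ≤ ‖x - y‖ := by
      have := (hlt x hx y hy).le
      rw [edist_dist, ENNReal.le_ofReal_iff_toReal_le ENNReal.coe_ne_top dist_nonneg] at this
      simpa [dist_eq_norm] using this
    have h3 : |a i x - a j y| ≤ |B₁| + |B₂| :=
      (abs_sub _ _).trans (add_le_add ((hB₁ x hx).trans (le_abs_self _))
        ((hB₂ y hy).trans (le_abs_self _)))
    refine h3.trans ?_
    rw [div_mul_eq_mul_div, le_div_iff₀ (by exact_mod_cast hr)]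
    gcongr
  · obtain ⟨p, hpi, hpj⟩ := Set.not_disjoint_iff.1 hdis
    have hinter := E.edge_inter i j hij
    have hp := hinter ⟨hpi, hpj⟩
    -- A common point of two edges is a vertex of each. This normalizes the four possible positions
    -- by naming `p` as the first end of both edges; both affine functions take the same vertex
    -- value there.
    have hends : ∀ k, p ∈ ({E.curve k, E.curve (finRotate n k)} : Set Plane) →
        ∃ m p', E.curve m = p ∧ a k p = v m ∧ p ≠ p' ∧ E.curve.edgeSet ℝ k = segment ℝ p p' ∧
          ({E.curve k, E.curve (finRotate n k)} : Set Plane) = {p, p'} := by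
      rintro k (rfl | hk)
      · exact ⟨k, _, rfl, (ha k).1, E.vertex_ne k, affineSegment_eq_segment .., rfl⟩
      · obtain rfl : p = E.curve (finRotate n k) := hk
        refine ⟨_, E.curve k, rfl, (ha k).2, (E.vertex_ne k).symm, ?_, Set.pair_comm _ _⟩
        rw [segment_symm]
        exact affineSegment_eq_segment ..
    obtain ⟨m₁, p₁, hm₁, hv₁, hpp₁, he₁, hs₁⟩ := hends i hp.1
    obtain ⟨m₂, p₂, hm₂, hv₂, hpp₂, he₂, -⟩ := hends j hp.2
    have hm : m₁ = m₂ := E.vertices_injective (hm₁.trans hm₂.symm)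
    rw [he₁, he₂, hs₁] at hinter
    obtain ⟨C, hC0, hC⟩ := exists_norm_add_norm_le_of_segments hpp₁ hpp₂
      fun z hz => (hinter hz).1
    refine ⟨(K₁ + K₂) * C, by positivity, fun x hx y hy => ?_⟩
    rw [he₁] at hx
    rw [he₂] at hy
    have h3 := hC x hx y hy
    have h4 : |a i x - a j y| ≤ |a i x - a i p| + |a j y - a j p| := by
      rw [hv₁, hv₂, hm, abs_sub_comm (a j y)]
      exact abs_sub_le _ _ _
    calc _ ≤ K₁ * ‖x - p‖ + K₂ * ‖y - p‖ := h4.trans (add_le_add (h₁ _ _) (h₂ _ _))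
      _ ≤ (K₁ + K₂) * (‖x - p‖ + ‖y - p‖) := by
        nlinarith [norm_nonneg (x - p), norm_nonneg (y - p)]
      _ ≤ (K₁ + K₂) * (C * ‖x - y‖) := by gcongr
      _ = _ := by ring

/-- The estimate across pairs of edges, taken at equal points, shows that the edgewise interpolant
is well defined. It also shows that the interpolant is Lipschitz on `∂E`, with the sum of all the
constants, and a real-valued Lipschitz function extends to the plane. -/
theorem exists_lipschitz_extension (E : PolygonalElement n) (v : Fin n → ℝ) :
    ∃ (K : NNReal) (g : Plane → ℝ), LipschitzWith K g ∧ (∀ i, g (E.curve i) = v i) ∧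
      ∀ i, ∃ a : Plane →ᵃ[ℝ] ℝ, ∀ x ∈ E.curve.edgeSet ℝ i, g x = a x := by
  choose a ha using fun i => exists_affineMap_eq (E.vertex_ne i) (v i) (v (finRotate n i))
  choose K hK0 hK using exists_edge_lipschitz v ha
  classical
  set f : Plane → ℝ := fun x => if h : ∃ i, x ∈ E.curve.edgeSet ℝ i then a h.choose x else 0 with hf
  have hfe : ∀ i, ∀ x ∈ E.curve.edgeSet ℝ i, f x = a i x := fun i x hx => by
    have h : ∃ i, x ∈ E.curve.edgeSet ℝ i := ⟨i, hx⟩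
    simp only [hf, dif_pos h]
    have := hK h.choose i x h.choose_spec x hx
    rw [sub_self, norm_zero, mul_zero] at this
    exact sub_eq_zero.1 (abs_nonpos_iff.1 this)
  set L : ℝ := ∑ i, ∑ j, K i j with hL
  have hL0 : 0 ≤ L := Finset.sum_nonneg fun i _ => Finset.sum_nonneg fun j _ => hK0 i j
  have hlip : LipschitzOnWith L.toNNReal f (⋃ i, E.curve.edgeSet ℝ i) := by
    refine LipschitzOnWith.of_dist_le_mul fun x hx y hy => ?_
    obtain ⟨i, hi⟩ := Set.mem_iUnion.1 hx
    obtain ⟨j, hj⟩ := Set.mem_iUnion.1 hy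
    rw [hfe i x hi, hfe j y hj, Real.dist_eq, dist_eq_norm, Real.coe_toNNReal _ hL0]
    refine (hK i j x hi y hj).trans (mul_le_mul_of_nonneg_right ?_ (norm_nonneg _))
    exact (Finset.single_le_sum (f := fun j => K i j) (fun j _ => hK0 i j) (Finset.mem_univ j)).trans
      (Finset.single_le_sum (f := fun i => ∑ j, K i j)
        (fun i _ => Finset.sum_nonneg fun j _ => hK0 i j) (Finset.mem_univ i))
  obtain ⟨g, hg, hgf⟩ := hlip.extend_real
  have hge : ∀ i, ∀ x ∈ E.curve.edgeSet ℝ i, g x = a i x := fun i x hx =>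
    (hgf (Set.mem_iUnion.2 ⟨i, hx⟩)).symm.trans (hfe i x hx)
  exact ⟨_, g, hg, fun i => (hge i _ (left_mem_affineSegment ℝ _ _)).trans (ha i).1,
    fun i => ⟨a i, hge i⟩⟩

open scoped Convolution in
/-- Lipschitz functions are uniform limits of smooth functions with the same Lipschitz constant. -/
theorem exists_contDiff_lipschitz {K : NNReal} {g : Plane → ℝ} (hg : LipschitzWith K g) {ε : ℝ}
    (hε : 0 < ε) : ∃ h : Plane → ℝ, ContDiff ℝ (⊤ : ℕ∞) h ∧ (∀ x, |h x - g x| ≤ ε) ∧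
      ∀ x, ‖gradient h x‖ ≤ K := by
  set δ := ε / (K + 1) with hδ
  have hδ0 : 0 < δ := by positivity
  set φ : ContDiffBump (0 : Plane) := ⟨δ / 2, δ, half_pos hδ0, half_lt_self hδ0⟩ with hφ
  set h : Plane → ℝ := φ.normed volume ⋆[ContinuousLinearMap.lsmul ℝ ℝ, volume] g with hh
  have hi : ∀ x, Integrable fun t => φ.normed volume t * g (x - t) := fun x =>
    (φ.continuous_normed.mul (hg.continuous.comp (by fun_prop))).integrable_of_hasCompactSupport
      φ.hasCompactSupport_normed.mul_right
  have hlip : LipschitzWith K h := by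
    refine LipschitzWith.of_dist_le_mul fun x y => ?_
    have e : ∀ x, h x = ∫ t, φ.normed volume t * g (x - t) := fun x => rfl
    rw [Real.dist_eq, e, e, ← integral_sub (hi x) (hi y), ← Real.norm_eq_abs]
    have hb : Integrable fun t => φ.normed volume t * (K * dist x y) :=
      φ.integrable_normed.mul_const _
    refine (norm_integral_le_of_norm_le hb (Eventually.of_forall fun t => ?_)).trans ?_
    · rw [← mul_sub, norm_mul, Real.norm_of_nonneg (φ.nonneg_normed t)]
      refine mul_le_mul_of_nonneg_left ?_ (φ.nonneg_normed t)
      have := hg.dist_le_mul (x - t) (y - t)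
      rwa [dist_sub_right, Real.dist_eq] at this
    · rw [integral_mul_const, φ.integral_normed, one_mul]
  refine ⟨h, φ.hasCompactSupport_normed.contDiff_convolution_left _ φ.contDiff_normed
    hg.continuous.locallyIntegrable, fun x => ?_, fun x => ?_⟩
  · refine φ.dist_normed_convolution_le hg.continuous.aestronglyMeasurable fun y hy => ?_
    refine (hg.dist_le_mul y x).trans ?_
    have h1 : dist y x ≤ δ := (Metric.mem_ball.1 hy).le
    calc (K : ℝ) * dist y x ≤ (K + 1) * δ := by
          gcongr
          linarith
      _ = ε := mul_div_cancel₀ _ (by positivity)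
  · rw [gradient, LinearIsometryEquiv.norm_map]
    exact norm_fderiv_le_of_lipschitz ℝ hlip

end

/-! ### The Dirichlet problem with Lipschitz data, and the space `W`. -/

noncomputable section

/-- A bounded sequence in a Hilbert space converges weakly along some ultrafilter. -/
theorem exists_weak_limit {H : Type*} [NormedAddCommGroup H] [InnerProductSpace ℝ H]
    [CompleteSpace H] {B : ℝ} {G : ℕ → H} (hG : ∀ k, ‖G k‖ ≤ B) :
    ∃ G₀ : H, ∀ Φ, Tendsto (fun k => inner ℝ (G k) Φ) (hyperfilter ℕ) (𝓝 (inner ℝ G₀ Φ)) := by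
  set s : ℕ → WeakDual ℝ H := fun k => StrongDual.toWeakDual (InnerProductSpace.toDual ℝ H (G k))
    with hs
  -- Banach–Alaoglu; with an ultrafilter no subsequence has to be extracted.
  have hK := WeakDual.isCompact_closedBall (𝕜 := ℝ) (E := H) 0 B
  have hsK : ∀ k, s k ∈ WeakDual.toStrongDual ⁻¹' Metric.closedBall (0 : StrongDual ℝ H) B :=
    fun k => by simpa [hs] using hG k
  obtain ⟨l, -, hl⟩ := hK.ultrafilter_le_nhds ((hyperfilter ℕ).map s)
    (le_principal_iff.2 (Eventually.of_forall (f := (hyperfilter ℕ : Filter ℕ)) hsK))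
  refine ⟨(InnerProductSpace.toDual ℝ H).symm (WeakDual.toStrongDual l), fun Φ => ?_⟩
  rw [InnerProductSpace.toDual_symm_apply]
  have h1 : Tendsto s (hyperfilter ℕ) (𝓝 l) := hl
  exact ((WeakDual.eval_continuous Φ).tendsto l).comp h1

variable {n : ℕ} {E : PolygonalElement n}

/-- The weak Laplacian is defined through a chosen weak gradient; by almost everywhere uniqueness
any other weak gradient serves equally well. -/
theorem hasWeakLaplacian_of_hasWeakGradient {ζ : C(E.carrier, ℝ)} {G : Plane → Plane}
    (h : E.HasWeakGradient ζ G) {f : Plane → ℝ} : E.HasWeakLaplacian ζ f ↔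
      ∀ φ, E.IsTest φ →
        ∫ x in E.carrier, inner ℝ (G x) (gradient φ x) = -∫ x in E.carrier, f x * φ x := by
  refine forall₂_congr fun φ hφ => ?_
  have h1 := (MemH1.hasWeakGradient ⟨G, h⟩).ae_eq h
  have h2 : ∫ x in E.carrier, inner ℝ (E.weakGradient ζ x) (gradient φ x) =
      ∫ x in E.carrier, inner ℝ (G x) (gradient φ x) := by
    refine integral_congr_ae ?_
    filter_upwards [h1] with x hx
    rw [hx]
  rw [h2]

theorem integral_mul_lap_eq_zero {ζ : C(E.carrier, ℝ)} (h : E.MemH1 ζ)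
    (hΔ : E.HasWeakLaplacian ζ (0 : Plane →ᵃ[ℝ] ℝ)) (ψ : Plane → ℝ) (hψ : E.IsTest ψ) :
    ∫ y in E.carrier, extend ζ y * lap ψ y = 0 := by
  have hg := h.hasWeakGradient
  rw [(hasWeakGradient_iff.1 hg).2.integral_mul_lap ((memLp_extend ζ).integrable (by norm_num))
    hg.memLp hψ, hΔ ψ hψ]
  simp

/-- The boundary values are zero pointwise, so the maximum principle for continuous distributional
solutions applies directly, without showing that `ζ` has zero Sobolev trace. -/
theorem eq_zero_of_hasWeakLaplacian_zero {ζ : C(E.carrier, ℝ)} (h : E.MemH1 ζ)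
    (hΔ : E.HasWeakLaplacian ζ (0 : Plane →ᵃ[ℝ] ℝ))
    (h0 : ∀ x ∈ frontier E.carrier, extend ζ x = 0) : ζ = 0 := by
  ext x
  rw [← extend_coe]
  exact eqOn_zero_of_lap_eq_zero (continuousOn_extend ζ) (integral_mul_lap_eq_zero h hΔ) h0 x x.2

theorem extend_sub (ζ η : C(E.carrier, ℝ)) (x : Plane) :
    extend (ζ - η) x = extend ζ x - extend η x := by
  by_cases h : x ∈ E.carrier <;> simp [extend, h]

theorem extend_eq_zero_of_vertices {ζ : C(E.carrier, ℝ)} (hζ : E.IsAffineOnEdges ζ)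
    (h0 : ∀ j, ζ (E.q j) = 0) : ∀ x ∈ frontier E.carrier, extend ζ x = 0 := by
  intro x hx
  have hxE : x ∈ E.carrier := E.isCompact.isClosed.frontier_subset hx
  rw [E.frontier_eq] at hx
  obtain ⟨i, hi⟩ := Set.mem_iUnion.1 hx
  obtain ⟨a, ha⟩ := hζ i
  have h1 : a (E.curve i) = 0 :=
    (ha (E.q i) (left_mem_affineSegment ℝ _ _)).symm.trans (h0 i)
  have h2 : a (E.curve (finRotate n i)) = 0 :=
    (ha (E.q (finRotate n i)) (right_mem_affineSegment ℝ _ _)).symm.trans (h0 _)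
  have h3 : extend ζ x = a x := (extend_coe ζ ⟨x, hxE⟩).trans (ha ⟨x, hxE⟩ hi)
  obtain ⟨t, -, rfl⟩ := hi
  rw [h3, AffineMap.apply_lineMap, h1, h2, AffineMap.lineMap_same_apply]

theorem tendsto_integral_extend {s : ℕ → C(E.carrier, ℝ)} {ζ : C(E.carrier, ℝ)}
    (h : Tendsto s atTop (𝓝 ζ)) {f : Plane → ℝ} (hf : IntegrableOn f E.carrier) :
    Tendsto (fun k => ∫ x in E.carrier, extend (s k) x * f x) atTop
      (𝓝 (∫ x in E.carrier, extend ζ x * f x)) := by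
  have hi : ∀ η : C(E.carrier, ℝ), IntegrableOn (fun x => extend η x * f x) E.carrier := fun η => by
    obtain ⟨C, hC⟩ := E.isCompact.exists_bound_of_continuousOn (continuousOn_extend η)
    refine hf.bdd_mul (c := C) (memLp_extend η).1 ?_
    filter_upwards [ae_restrict_mem E.measurableSet_carrier] with x hx using hC x hx
  rw [tendsto_iff_norm_sub_tendsto_zero] at h ⊢
  have h1 := h.mul_const (∫ x in E.carrier, ‖f x‖)
  rw [zero_mul] at h1
  refine squeeze_zero (fun _ => norm_nonneg _) (fun k => ?_) h1
  rw [← integral_sub (hi _) (hi _), ← integral_const_mul]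
  refine norm_integral_le_of_norm_le (hf.norm.const_mul _) ?_
  filter_upwards [ae_restrict_mem E.measurableSet_carrier] with x hx
  rw [← sub_mul, ← extend_sub, norm_mul]
  refine mul_le_mul_of_nonneg_right ?_ (norm_nonneg _)
  rw [show extend (s k - ζ) x = _ from extend_coe (s k - ζ) ⟨x, hx⟩]
  exact (s k - ζ).norm_coe_le_norm _

/-- The Dirichlet problem with Lipschitz boundary data. -/
theorem exists_dirichlet_of_lipschitz {K : NNReal} {g : Plane → ℝ} (hg : LipschitzWith K g) :
    ∃ ζ : C(E.carrier, ℝ), E.MemH1 ζ ∧ E.HasWeakLaplacian ζ (0 : Plane →ᵃ[ℝ] ℝ) ∧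
      ∀ x ∈ frontier E.carrier, extend ζ x = g x := by
  have hpos : ∀ k : ℕ, (0 : ℝ) < 1 / (k + 1) := fun k => by positivity
  choose h hc hd hgrad using fun k : ℕ => exists_contDiff_lipschitz hg (hpos k)
  choose s G htr hG hGn hbd using fun k => exists_dirichlet (E := E) (hc k)
  have hΔ : ∀ k, ∀ ψ, E.IsTest ψ → ∫ y in E.carrier, extend (s k) y * lap ψ y = 0 := by
    intro k ψ hψ
    rw [((htr k).isDistribGradient (hc k)).integral_mul_lap ((memLp_extend _).integrable
      (by norm_num)) (htr k).memLp_gradient hψ, hG k ψ hψ, neg_zero]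
  -- The maximum principle transfers uniform closeness of the smoothed data to the solutions.
  have hcmp : ∀ k l, ∀ x ∈ E.carrier, extend (s k) x - extend (s l) x ≤ 1 / (k + 1) + 1 / (l + 1) := by
    intro k l
    refine le_of_lap_eq_zero (u := fun x => extend (s k) x - extend (s l) x) ((continuousOn_extend _).sub (continuousOn_extend _)) ?_ ?_
    · intro ψ hψ
      have hi : ∀ k, IntegrableOn (fun y => extend (s k) y * lap ψ y) E.carrier := fun k =>
        ((continuousOn_extend (s k)).mul hψ.continuous_lap.continuousOn).integrableOn_compact
          E.isCompact
      simp only [sub_mul]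
      rw [integral_sub (hi k) (hi l), hΔ k ψ hψ, hΔ l ψ hψ, sub_zero]
    · intro x hx
      rw [hbd k x hx, hbd l x hx]
      have h1 := (abs_le.1 (hd k x)).2
      have h2 := (abs_le.1 (hd l x)).1
      linarith
  have hcauchy : CauchySeq s := by
    refine cauchySeq_of_le_tendsto_0 (fun N : ℕ => 1 / ((N : ℝ) + 1) + 1 / (N + 1)) ?_ ?_
    · intro k l N hk hl
      have hk' : 1 / ((k : ℝ) + 1) ≤ 1 / (N + 1) := by gcongr
      have hl' : 1 / ((l : ℝ) + 1) ≤ 1 / (N + 1) := by gcongr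
      rw [ContinuousMap.dist_le (by positivity)]
      intro x
      have h1 := hcmp k l x x.2
      have h2 := hcmp l k x x.2
      rw [extend_coe, extend_coe] at h1 h2
      rw [Real.dist_eq, abs_le]
      constructor <;> linarith
    · simpa using tendsto_one_div_add_atTop_nhds_zero_nat.add
        (tendsto_one_div_add_atTop_nhds_zero_nat (𝕜 := ℝ))
  obtain ⟨ζ, hζ⟩ := cauchySeq_tendsto_of_complete hcauchy
  -- By the Dirichlet principle the energy of each solution is at most that of its data, whose
  -- gradients are bounded by `K`.
  have hbound : ∃ B : ℝ, ∀ k, ‖(htr k).memLp_gradient.toLp (G k)‖ ≤ B := by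
    refine ⟨((volume.restrict E.carrier) Set.univ ^ (2 : ENNReal).toReal⁻¹ *
      ENNReal.ofReal K).toReal, fun k => ?_⟩
    rw [Lp.norm_toLp]
    refine (hGn k).trans (ENNReal.toReal_mono ?_
      (eLpNorm_le_of_ae_bound (Eventually.of_forall (hgrad k))))
    exact ENNReal.mul_ne_top (ENNReal.rpow_ne_top_of_nonneg (by positivity) (measure_ne_top _ _))
      ENNReal.ofReal_ne_top
  obtain ⟨B, hB⟩ := hbound
  obtain ⟨G₀, hG₀⟩ := exists_weak_limit hB
  have hweak : ∀ Φ : Plane → Plane, MemLp Φ 2 (volume.restrict E.carrier) →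
      Tendsto (fun k => ∫ x in E.carrier, inner ℝ (G k x) (Φ x)) (hyperfilter ℕ)
        (𝓝 (∫ x in E.carrier, inner ℝ (G₀ x) (Φ x))) := by
    intro Φ hΦ
    have h1 := hG₀ (hΦ.toLp Φ)
    simp only [inner_toLp] at h1
    rwa [← Lp.toLp_coeFn G₀ (Lp.memLp G₀), inner_toLp] at h1
  -- In the integration by parts formula for the approximations, one side converges by uniform
  -- convergence of the functions and the other by weak convergence of the gradients.
  have hwg : E.HasWeakGradient ζ G₀ := by
    refine hasWeakGradient_iff.2 ⟨Lp.memLp G₀, fun φ hφ v => ?_⟩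
    have hv : MemLp (fun x => φ x • v) 2 (volume.restrict E.carrier) :=
      memLp_of_continuousOn (hφ.1.continuous.smul continuous_const).continuousOn 2
    have h1 := (tendsto_integral_extend hζ ((((hφ.fderiv_apply v).memLp 2).integrable
      (by norm_num)))).mono_left (Nat.hyperfilter_le_atTop)
    have h2 := (hweak _ hv).neg
    simp only [inner_smul_right] at h2
    refine (tendsto_nhds_unique h1 (h2.congr fun k => ?_)).trans ?_
    · rw [((htr k).isDistribGradient (hc k)) φ hφ v]
      simp only [mul_comm]
    · simp only [mul_comm]
  refine ⟨ζ, ⟨_, hwg⟩, (hasWeakLaplacian_of_hasWeakGradient hwg).2 fun φ hφ => ?_, fun x hx => ?_⟩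
  · have h1 := hweak _ (hφ.memLp_gradient 2)
    simp only [hG _ φ hφ] at h1
    rw [← tendsto_nhds_unique tendsto_const_nhds h1]
    simp
  · have hxE : x ∈ E.carrier := E.isCompact.isClosed.frontier_subset hx
    have h1 : Tendsto (fun k => extend (s k) x) atTop (𝓝 (extend ζ x)) := by
      have h2 : ∀ η : C(E.carrier, ℝ), extend η x = η ⟨x, hxE⟩ := fun η => extend_coe η ⟨x, hxE⟩
      simp only [h2]
      exact ((continuous_eval_const (⟨x, hxE⟩ : E.carrier)).tendsto ζ).comp hζ
    refine tendsto_nhds_unique h1 ?_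
    rw [tendsto_iff_norm_sub_tendsto_zero]
    refine squeeze_zero (fun _ => norm_nonneg _) (fun k => ?_)
      tendsto_one_div_add_atTop_nhds_zero_nat
    rw [hbd k x hx]
    exact hd k x

theorem injective_dof_W (E : PolygonalElement n) : Function.Injective (E.dof.domRestrict E.W) := by
  rw [← LinearMap.ker_eq_bot, LinearMap.ker_eq_bot']
  rintro ⟨ζ, h1, h2, h3⟩ h0
  refine Subtype.ext (eq_zero_of_hasWeakLaplacian_zero h1 h3 (extend_eq_zero_of_vertices h2 ?_))
  exact fun j => congrFun h0 j

theorem surjective_dof_W (E : PolygonalElement n) :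
    Function.Surjective (E.dof.domRestrict E.W) := by
  intro v
  obtain ⟨K, g, hg, hgv, hga⟩ := E.exists_lipschitz_extension v
  obtain ⟨ζ, h1, h2, h3⟩ := exists_dirichlet_of_lipschitz (E := E) hg
  refine ⟨⟨ζ, h1, fun i => ?_, h2⟩, funext fun j => ?_⟩
  · obtain ⟨a, ha⟩ := hga i
    refine ⟨a, fun x hx => ?_⟩
    rw [← extend_coe, h3 x (E.edgeSet_subset_frontier i hx), ha x hx]
  · have h4 : E.curve j ∈ frontier E.carrier :=
      E.edgeSet_subset_frontier j (left_mem_affineSegment ℝ _ _)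
    have h5 : ζ (E.q j) = g (E.curve j) := by
      rw [← extend_coe]
      exact h3 _ h4
    exact h5.trans (hgv j)

end

/-! ### Bubbles, their moments, and the space `Z`. -/

noncomputable section

variable {n : ℕ} {E : PolygonalElement n}

/-- Every affine function is the Laplacian of a polynomial. -/
theorem exists_lap_eq (m : Plane →ᵃ[ℝ] ℝ) :
    ∃ p : Plane → ℝ, ContDiff ℝ (⊤ : ℕ∞) p ∧ ∀ x, lap p x = m x := by
  set c := m 0 with hc
  set β : Plane := (InnerProductSpace.toDual ℝ Plane).symm m.linear.toContinuousLinearMap with hβ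
  have hm : ∀ x, m x = c + inner ℝ β x := fun x => by
    have h1 := congrFun m.decomp x
    rw [hβ, InnerProductSpace.toDual_symm_apply]
    simp only [Pi.add_apply] at h1
    simpa [add_comm] using h1
  -- In the plane, `Δ ‖x‖² = 4` and `Δ (⟨β, x⟩ ‖x‖²) = 8 ⟨β, x⟩`.
  refine ⟨fun x => c / 4 * ‖x‖ ^ 2 + 1 / 8 * (inner ℝ β x * ‖x‖ ^ 2), ?_, fun x => ?_⟩
  · exact (contDiff_const.mul (contDiff_norm_sq ℝ)).add (contDiff_const.mul
      ((contDiff_const.inner ℝ contDiff_id).mul (contDiff_norm_sq ℝ)))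
  · have hn : ∀ y : Plane, HasFDerivAt (fun y => ‖y‖ ^ 2) (2 • innerSL ℝ y) y := fun y =>
      (hasFDerivAt_id y).norm_sq
    have hi : ∀ v y : Plane, HasFDerivAt (fun y => inner ℝ v y) (innerSL ℝ v) y := fun v y =>
      (innerSL ℝ v).hasFDerivAt
    have h1 : ∀ y v, fderiv ℝ (fun x => c / 4 * ‖x‖ ^ 2 + 1 / 8 * (inner ℝ β x * ‖x‖ ^ 2)) y v =
        c / 2 * inner ℝ v y + 1 / 8 * (inner ℝ β v * ‖y‖ ^ 2 + 2 * (inner ℝ β y * inner ℝ v y)) := by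
      intro y v
      have e : fderiv ℝ (fun x => c / 4 * ‖x‖ ^ 2 + 1 / 8 * (inner ℝ β x * ‖x‖ ^ 2)) y = _ :=
        (((hn y).const_mul (c / 4)).add (((hi β y).mul (hn y)).const_mul (1 / 8))).fderiv
      rw [e]
      simp only [_root_.smul_apply, _root_.add_apply, innerSL_apply_apply,
        smul_eq_mul, nsmul_eq_mul, real_inner_comm v]
      push_cast
      ring
    have h2 : ∀ v, fderiv ℝ (fun y => fderiv ℝ
        (fun x => c / 4 * ‖x‖ ^ 2 + 1 / 8 * (inner ℝ β x * ‖x‖ ^ 2)) y v) x v =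
        c / 2 * inner ℝ v v + 1 / 8 * (4 * (inner ℝ β v * inner ℝ v x) +
          2 * (inner ℝ β x * inner ℝ v v)) := by
      intro v
      simp only [h1]
      have e : fderiv ℝ (fun y => c / 2 * inner ℝ v y +
          1 / 8 * (inner ℝ β v * ‖y‖ ^ 2 + 2 * (inner ℝ β y * inner ℝ v y))) x = _ :=
        (((hi v x).const_mul (c / 2)).add ((((hn x).const_mul (inner ℝ β v)).add
          (((hi β x).mul (hi v x)).const_mul 2)).const_mul (1 / 8))).fderiv
      rw [e]
      simp only [_root_.smul_apply, _root_.add_apply, innerSL_apply_apply,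
        smul_eq_mul, nsmul_eq_mul, real_inner_comm v]
      push_cast
      ring
    rw [hm, inner_eq_sum]
    simp only [lap, h2, inner_eq_sum β x, Fin.sum_univ_two, real_inner_comm x,
      EuclideanSpace.inner_single_left]
    simp
    ring

theorem IsTest.integral_inner_gradient {p ψ : Plane → ℝ} (hψ : E.IsTest ψ)
    (hp : ContDiff ℝ (⊤ : ℕ∞) p) :
    ∫ x in E.carrier, inner ℝ (gradient p x) (gradient ψ x) = -∫ x in E.carrier, lap p x * ψ x := by
  have hd : ∀ v, ContDiff ℝ (⊤ : ℕ∞) fun x => fderiv ℝ p x v := fun v =>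
    (hp.fderiv_right (m := (⊤ : ℕ∞)) (by simp)).clm_apply contDiff_const
  have hI : ∀ {f g : Plane → ℝ}, Continuous f → Continuous g →
      IntegrableOn (fun x => f x * g x) E.carrier := fun hf hg =>
    (hf.mul hg).continuousOn.integrableOn_compact E.isCompact
  simp only [inner_eq_sum _ (gradient ψ _), inner_gradient_left, lap, Finset.sum_mul]
  rw [integral_finsetSum _ fun i _ => hI (hd _).continuous (hψ.fderiv_apply _).1.continuous,
    integral_finsetSum, ← Finset.sum_neg_distrib]
  · exact Finset.sum_congr rfl fun i _ => hψ.integral_mul_fderiv ((hd _).of_le (by simp)).contDiffOn _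
  · exact fun i _ => hI (((hd _).continuous_fderiv (by simp)).clm_apply continuous_const)
      hψ.1.continuous

theorem gradient_zero : gradient (0 : Plane → ℝ) = 0 := by
  ext1 x
  simp [gradient]

/-- The integral of a derivative of a test function is zero, and this passes to `L²` limits. It
makes the mean gradient of a bubble vanish. -/
theorem HasTrace.integral_inner_eq_zero {u : Plane → ℝ} {G : Plane → Plane}
    (h : E.HasTrace u G 0) (v : Plane) : ∫ x in E.carrier, inner ℝ (G x) v = 0 := by
  have hv : MemLp (fun _ : Plane => v) 2 (volume.restrict E.carrier) :=
    memLp_of_continuousOn continuousOn_const 2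
  refine eq_zero_of_forall_abs_le
    (C := (eLpNorm (fun _ : Plane => v) 2 (volume.restrict E.carrier)).toReal) fun δ hδ => ?_
  obtain ⟨φ, hφ, h1, -⟩ := h.approx δ hδ
  rw [gradient_zero, sub_zero] at h1
  have h2 : ∫ x in E.carrier, inner ℝ ((G - gradient φ) x) v = ∫ x in E.carrier, inner ℝ (G x) v := by
    have j1 : IntegrableOn (fun x => inner ℝ (G x) v) E.carrier :=
      integrable_inner_of_memLp h.memLp_gradient hv
    have j2 : IntegrableOn (fun x => fderiv ℝ φ x v) E.carrier :=
      ((hφ.fderiv_apply v).memLp 1).integrable le_rfl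
    simp only [Pi.sub_apply, inner_sub_left, inner_gradient_left]
    rw [integral_sub j1 j2, hφ.integral_fderiv, sub_zero]
  rw [← h2, mul_comm]
  refine (abs_integral_inner_le (h.memLp_gradient.sub (hφ.memLp_gradient 2)) hv).trans ?_
  gcongr

/-- This is the equation tested with `u` itself, which is not a test function but is approximated by
test functions together with its gradient. -/
theorem HasTrace.integral_inner_self {u f : Plane → ℝ} {G : Plane → Plane}
    (h : E.HasTrace u G 0) (hf : MemLp f 2 (volume.restrict E.carrier))
    (hG : ∀ ψ, E.IsTest ψ →
      ∫ x in E.carrier, inner ℝ (G x) (gradient ψ x) = -∫ x in E.carrier, f x * ψ x) :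
    ∫ x in E.carrier, inner ℝ (G x) (G x) = -∫ x in E.carrier, f x * u x := by
  rw [← sub_eq_zero, sub_neg_eq_add]
  refine eq_zero_of_forall_abs_le
    (C := (eLpNorm G 2 (volume.restrict E.carrier)).toReal +
      (eLpNorm f 2 (volume.restrict E.carrier)).toReal) fun δ hδ => ?_
  obtain ⟨φ, hφ, h1, h2⟩ := h.approx δ hδ
  rw [gradient_zero, sub_zero] at h1
  rw [sub_zero] at h2
  have m1 := h.memLp_gradient.sub (hφ.memLp_gradient 2)
  have m2 := h.memLp.sub (hφ.memLp 2)
  have e1 : ∫ x in E.carrier, inner ℝ (G x) ((G - gradient φ) x) =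
      (∫ x in E.carrier, inner ℝ (G x) (G x)) - ∫ x in E.carrier, inner ℝ (G x) (gradient φ x) := by
    rw [← integral_sub (integrable_inner_of_memLp h.memLp_gradient h.memLp_gradient)
      (integrable_inner_of_memLp h.memLp_gradient (hφ.memLp_gradient 2))]
    simp only [Pi.sub_apply, inner_sub_right]
  have e2 : ∫ x in E.carrier, f x * (u - φ) x =
      (∫ x in E.carrier, f x * u x) - ∫ x in E.carrier, f x * φ x := by
    have j1 : IntegrableOn (fun x => f x * u x) E.carrier := hf.integrable_mul h.memLp
    have j2 : IntegrableOn (fun x => f x * φ x) E.carrier := hf.integrable_mul (hφ.memLp 2)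
    rw [← integral_sub j1 j2]
    simp only [Pi.sub_apply, mul_sub]
  have e3 : (∫ x in E.carrier, inner ℝ (G x) (G x)) + ∫ x in E.carrier, f x * u x =
      (∫ x in E.carrier, inner ℝ (G x) ((G - gradient φ) x)) +
        ∫ x in E.carrier, f x * (u - φ) x := by
    rw [e1, e2, hG φ hφ]
    ring
  rw [e3, add_mul]
  refine (abs_add_le _ _).trans (add_le_add ((abs_integral_inner_le h.memLp_gradient m1).trans ?_)
    ((abs_integral_mul_le hf m2).trans ?_))
  · gcongr
  · gcongr

theorem memLp_affine (m : Plane →ᵃ[ℝ] ℝ) : MemLp m 2 (volume.restrict E.carrier) :=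
  memLp_of_continuousOn m.continuous_of_finiteDimensional.continuousOn 2

/-- The Poisson problem with an affine right-hand side and zero boundary data. -/
theorem exists_bubble (E : PolygonalElement n) (m : Plane →ᵃ[ℝ] ℝ) :
    ∃ ζ : C(E.carrier, ℝ), E.MemH1 ζ ∧ E.HasWeakLaplacian ζ m ∧
      (∀ x ∈ frontier E.carrier, extend ζ x = 0) ∧ E.averageGradient ζ = 0 ∧
      (∫ x, ζ x * m x ∂E.area = 0 → ζ = 0) := by
  obtain ⟨p, hp, hpm⟩ := exists_lap_eq m
  obtain ⟨η, G₀, htr, hG₀, -, hbd⟩ := exists_dirichlet (E := E) hp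
  -- A polynomial with the right Laplacian, minus the harmonic function with the same boundary
  -- values.
  set ζ : C(E.carrier, ℝ) := ⟨fun x => p x, hp.continuous.comp continuous_subtype_val⟩ - η with hζ
  have hext : ∀ x ∈ E.carrier, extend ζ x = p x - extend η x := fun x hx => by
    rw [hζ, extend_sub]
    congr 1
    exact extend_coe (⟨fun x => p x, hp.continuous.comp continuous_subtype_val⟩ :
      C(E.carrier, ℝ)) ⟨x, hx⟩
  have hT : E.HasTrace (extend ζ) (gradient p - G₀) 0 := by
    refine ⟨memLp_extend ζ, (memLp_gradient_of_contDiff hp).sub htr.memLp_gradient, fun δ hδ => ?_⟩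
    obtain ⟨φ, hφ, h1, h2⟩ := htr.approx δ hδ
    have hgn : gradient (-φ) = -gradient φ := by
      ext1 x
      simp [gradient, fderiv_neg]
    refine ⟨-φ, hφ.neg, ?_, ?_⟩
    · rw [gradient_zero, hgn, ← eLpNorm_neg]
      convert h1 using 3
      abel
    · rw [← eLpNorm_neg]
      refine le_trans (le_of_eq ?_) h2
      congr 1
      refine eLpNorm_congr_ae ?_
      filter_upwards [ae_restrict_mem E.measurableSet_carrier] with x hx
      simp only [Pi.neg_apply, Pi.sub_apply, Pi.zero_apply, hext x hx]
      ring
  have hwg : E.HasWeakGradient ζ (gradient p - G₀) :=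
    hasWeakGradient_iff.2 ⟨hT.memLp_gradient, hT.isDistribGradient contDiff_const⟩
  have hlap : ∀ ψ, E.IsTest ψ → ∫ x in E.carrier, inner ℝ ((gradient p - G₀) x) (gradient ψ x) =
      -∫ x in E.carrier, m x * ψ x := by
    intro ψ hψ
    simp only [Pi.sub_apply, inner_sub_left]
    rw [integral_sub (integrable_inner_of_memLp (memLp_gradient_of_contDiff hp)
      (hψ.memLp_gradient 2)) (integrable_inner_of_memLp htr.memLp_gradient (hψ.memLp_gradient 2)),
      hG₀ ψ hψ, hψ.integral_inner_gradient hp, sub_zero]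
    simp only [hpm]
  have hζb : ∀ x ∈ frontier E.carrier, extend ζ x = 0 := fun x hx => by
    rw [hext x (E.isCompact.isClosed.frontier_subset hx), hbd x hx, sub_self]
  refine ⟨ζ, ⟨_, hwg⟩, (hasWeakLaplacian_of_hasWeakGradient hwg).2 hlap, hζb, ?_, fun h0 => ?_⟩
  · have hae := (MemH1.hasWeakGradient ⟨_, hwg⟩).ae_eq hwg
    rw [averageGradient, setAverage_eq, integral_congr_ae hae, smul_eq_zero]
    right
    refine ext_inner_left ℝ fun v => ?_
    rw [← integral_inner (hwg.memLp.integrable (by norm_num)), inner_zero_right]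
    simpa only [real_inner_comm v] using hT.integral_inner_eq_zero v
  · rw [integral_area_mul] at h0
    -- By the energy identity, a zero moment against `m` forces the gradient to vanish; then the
    -- bubble is harmonic with zero boundary values.
    have h1 := hT.integral_inner_self (memLp_affine m) hlap
    simp only [mul_comm (m _)] at h1
    rw [h0, neg_zero, PolygonalElement.integral_inner_self hwg.memLp, sq_eq_zero_iff,
      ENNReal.toReal_eq_zero_iff, or_iff_left hwg.memLp.2.ne,
      eLpNorm_eq_zero_iff hwg.memLp.1 (by simp)] at h1
    refine eq_zero_of_hasWeakLaplacian_zero ⟨_, hwg⟩ ?_ hζb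
    refine (hasWeakLaplacian_of_hasWeakGradient hwg).2 fun ψ hψ => ?_
    have h2 : ∫ x in E.carrier, inner ℝ ((gradient p - G₀) x) (gradient ψ x) = 0 := by
      refine integral_eq_zero_of_ae ?_
      filter_upwards [h1] with x hx
      rw [hx]
      simp
    rw [h2]
    simp

theorem eq_of_hasWeakLaplacian {ζ η : C(E.carrier, ℝ)} {m : Plane →ᵃ[ℝ] ℝ} (hζ : E.MemH1 ζ)
    (hη : E.MemH1 η) (hζm : E.HasWeakLaplacian ζ m) (hηm : E.HasWeakLaplacian η m)
    (hb : ∀ x ∈ frontier E.carrier, extend ζ x = extend η x) : ζ = η := by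
  have hη' : E.MemH1 ((-1 : ℝ) • η) := ⟨_, hη.hasWeakGradient.smul (-1)⟩
  have h1 := hζm.add hζ hη' (hηm.smul (-1) hη)
  have h2 : m + (-1 : ℝ) • m = 0 := by simp
  have h3 : ζ + (-1 : ℝ) • η = ζ - η := by simp [sub_eq_add_neg]
  rw [h2, h3] at h1
  have h4 : E.MemH1 (ζ - η) := by
    rw [← h3]
    exact ⟨_, hζ.hasWeakGradient.add hη'.hasWeakGradient⟩
  exact sub_eq_zero.1 (eq_zero_of_hasWeakLaplacian_zero h4 h1 fun x hx => by
    rw [extend_sub, hb x hx, sub_self])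

theorem extend_add (ζ η : C(E.carrier, ℝ)) (x : Plane) :
    extend (ζ + η) x = extend ζ x + extend η x := by
  by_cases h : x ∈ E.carrier <;> simp [extend, h]

theorem extend_smul (c : ℝ) (ζ : C(E.carrier, ℝ)) (x : Plane) :
    extend (c • ζ) x = c * extend ζ x := by
  by_cases h : x ∈ E.carrier <;> simp [extend, h]

/-- The solution of the Poisson problem with zero boundary data, as a linear function of the
right-hand side. -/
def bubble (E : PolygonalElement n) : (Plane →ᵃ[ℝ] ℝ) →ₗ[ℝ] C(E.carrier, ℝ) where
  toFun m := (E.exists_bubble m).choose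
  map_add' m k := by
    obtain ⟨h1, h2, h3, -⟩ := (E.exists_bubble m).choose_spec
    obtain ⟨k1, k2, k3, -⟩ := (E.exists_bubble k).choose_spec
    obtain ⟨l1, l2, l3, -⟩ := (E.exists_bubble (m + k)).choose_spec
    exact eq_of_hasWeakLaplacian l1 ⟨_, h1.hasWeakGradient.add k1.hasWeakGradient⟩ l2
      (h2.add h1 k1 k2) fun x hx => by rw [l3 x hx, extend_add, h3 x hx, k3 x hx, add_zero]
  map_smul' c m := by
    obtain ⟨h1, h2, h3, -⟩ := (E.exists_bubble m).choose_spec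
    obtain ⟨l1, l2, l3, -⟩ := (E.exists_bubble (c • m)).choose_spec
    exact eq_of_hasWeakLaplacian l1 ⟨_, h1.hasWeakGradient.smul c⟩ l2
      (h2.smul c h1) fun x hx => by
        rw [l3 x hx, RingHom.id_apply, extend_smul, h3 x hx, mul_zero]

theorem memH1_bubble (m : Plane →ᵃ[ℝ] ℝ) : E.MemH1 (E.bubble m) := (E.exists_bubble m).choose_spec.1

theorem hasWeakLaplacian_bubble (m : Plane →ᵃ[ℝ] ℝ) : E.HasWeakLaplacian (E.bubble m) m :=
  (E.exists_bubble m).choose_spec.2.1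

theorem extend_bubble (m : Plane →ᵃ[ℝ] ℝ) : ∀ x ∈ frontier E.carrier, extend (E.bubble m) x = 0 :=
  (E.exists_bubble m).choose_spec.2.2.1

theorem averageGradient_bubble (m : Plane →ᵃ[ℝ] ℝ) : E.averageGradient (E.bubble m) = 0 :=
  (E.exists_bubble m).choose_spec.2.2.2.1

theorem bubble_eq_zero {m : Plane →ᵃ[ℝ] ℝ} (h : ∫ x, E.bubble m x * m x ∂E.area = 0) :
    E.bubble m = 0 :=
  (E.exists_bubble m).choose_spec.2.2.2.2 h

theorem bubble_edge (m : Plane →ᵃ[ℝ] ℝ) {i : Fin n} {x : E.carrier}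
    (hx : (x : Plane) ∈ E.curve.edgeSet ℝ i) : E.bubble m x = 0 := by
  rw [← extend_coe]
  exact extend_bubble m x (E.edgeSet_subset_frontier i hx)

theorem bubble_q (m : Plane →ᵃ[ℝ] ℝ) (j : Fin n) : E.bubble m (E.q j) = 0 :=
  bubble_edge (i := j) m (left_mem_affineSegment ℝ _ _)

theorem bubble_mem_Wtilde (m : Plane →ᵃ[ℝ] ℝ) : E.bubble m ∈ E.Wtilde :=
  ⟨memH1_bubble m, fun _ => ⟨0, fun _ hx => bubble_edge m hx⟩, m, hasWeakLaplacian_bubble m⟩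

/-- Both ingredients of the projection, the vertex average and the mean gradient, vanish. Adding
bubbles therefore changes moments without changing projections. -/
theorem piP_bubble (m : Plane →ᵃ[ℝ] ℝ) (x : Plane) : E.piP (E.bubble m) x = 0 := by
  change E.vertexAverage _ + inner ℝ (E.averageGradient _) _ = 0
  simp [vertexAverage, bubble_q, averageGradient_bubble]

/-- If the zero function has Laplacian `m`, then `m` vanishes on the interior of `E`, a nonempty
open set, which affinely spans the plane. -/
theorem eq_zero_of_bubble_eq_zero {m : Plane →ᵃ[ℝ] ℝ} (h : E.bubble m = 0) : m = 0 := by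
  have h1 := hasWeakLaplacian_bubble (E := E) m
  rw [h] at h1
  have h2 := (hasWeakLaplacian_of_hasWeakGradient (hasWeakGradient_zero (E := E))).1 h1
  have hmc : ContinuousOn m (interior E.carrier) := m.continuous_of_finiteDimensional.continuousOn
  have h3 := isOpen_interior.ae_eq_zero_of_integral_contDiff_smul_eq_zero
    (hmc.locallyIntegrableOn (μ := volume) isOpen_interior.measurableSet) (by
      intro φ hc hs ht
      have hφ : E.IsTest φ := ⟨hc, hs, ht⟩
      have h4 := h2 φ hφ
      simp only [Pi.zero_apply, inner_zero_left, integral_zero] at h4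
      have h5 := neg_eq_zero.1 h4.symm
      rw [hφ.setIntegral_eq fun x hx => subset_closure fun h => hx (by simp [h])] at h5
      simpa only [smul_eq_mul, mul_comm] using h5)
  have h4 : m =ᵐ[volume.restrict E.carrier] fun _ => (0 : ℝ) := by
    rw [restrict_carrier_eq, Filter.EventuallyEq, ae_restrict_iff' isOpen_interior.measurableSet]
    exact h3
  have h5 : Set.EqOn m (0 : Plane →ᵃ[ℝ] ℝ) (interior E.carrier) :=
    eqOn_interior h4 hmc continuousOn_const
  exact AffineMap.ext_on
    (isOpen_interior.affineSpan_eq_top E.isConnected_interior.nonempty) h5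

/-- The moments of continuous functions against affine functions. -/
def moment (E : PolygonalElement n) :
    C(E.carrier, ℝ) →ₗ[ℝ] (Plane →ᵃ[ℝ] ℝ) →ₗ[ℝ] ℝ :=
  have hi : ∀ (ζ : C(E.carrier, ℝ)) (m : Plane →ᵃ[ℝ] ℝ),
      Integrable (fun x : E.carrier => ζ x * m x) E.area := fun ζ m =>
    integrable_mul_continuous ζ m.continuous_of_finiteDimensional
  LinearMap.mk₂ ℝ (fun ζ m => ∫ x, ζ x * m x ∂E.area)
    (fun ζ η m => by
      simp only [ContinuousMap.add_apply, add_mul]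
      exact integral_add (hi ζ m) (hi η m))
    (fun c ζ m => by
      simp only [ContinuousMap.smul_apply, smul_eq_mul, mul_assoc]
      exact integral_const_mul _ _)
    (fun ζ m k => by
      simp only [AffineMap.coe_add, Pi.add_apply, mul_add]
      exact integral_add (hi ζ m) (hi ζ k))
    (fun c ζ m => by
      simp only [AffineMap.coe_smul, Pi.smul_apply, smul_eq_mul, mul_left_comm _ c]
      exact integral_const_mul _ _)

theorem moment_apply (ζ : C(E.carrier, ℝ)) (m : Plane →ᵃ[ℝ] ℝ) :
    E.moment ζ m = ∫ x, ζ x * m x ∂E.area := rfl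

/-- If all moments of `bubble m` vanish, so does the one against `m`, which forces `m = 0`. An
injective map from a finite-dimensional space to its dual is onto. -/
theorem surjective_moment_bubble (E : PolygonalElement n) :
    Function.Surjective (E.moment ∘ₗ E.bubble) := by
  have hfin : FiniteDimensional ℝ (Plane →ᵃ[ℝ] ℝ) :=
    Module.Finite.equiv (AffineMap.toConstProdLinearMap (k := ℝ) (V1 := Plane) (V2 := ℝ) ℝ).symm
  have hinj : Function.Injective (E.moment ∘ₗ E.bubble) := by
    rw [← LinearMap.ker_eq_bot, LinearMap.ker_eq_bot']
    intro m hm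
    exact eq_zero_of_bubble_eq_zero (bubble_eq_zero (LinearMap.congr_fun hm m))
  refine (LinearMap.injective_iff_surjective_of_finrank_eq_finrank ?_).1 hinj
  exact Subspace.dual_finrank_eq.symm

/-- With zero vertex values the function is a bubble, whose projection is zero. The moment condition
then kills its moment against its own Laplacian, and the energy identity concludes. -/
theorem injective_dof_Z (E : PolygonalElement n) : Function.Injective (E.dof.domRestrict E.Z) := by
  rw [← LinearMap.ker_eq_bot, LinearMap.ker_eq_bot']
  rintro ⟨ζ, ⟨h1, h2, m, h3⟩, h4⟩ h0
  have hv : ∀ j, ζ (E.q j) = 0 := fun j => congrFun h0 j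
  have hb := extend_eq_zero_of_vertices h2 hv
  obtain rfl : ζ = E.bubble m := eq_of_hasWeakLaplacian h1 (memH1_bubble m) h3
    (hasWeakLaplacian_bubble m) fun x hx => by rw [hb x hx, extend_bubble m x hx]
  refine Subtype.ext (bubble_eq_zero ?_)
  rw [h4 m]
  simp [piP_bubble]

theorem W_le_Wtilde (E : PolygonalElement n) : E.W ≤ E.Wtilde := fun _ h => ⟨h.1, h.2.1, 0, h.2.2⟩

theorem surjective_dof_Z (E : PolygonalElement n) :
    Function.Surjective (E.dof.domRestrict E.Z) := by
  intro v
  obtain ⟨⟨w, hw⟩, hwv⟩ := E.surjective_dof_W v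
  set π : C(E.carrier, ℝ) := ⟨fun x => E.piP w x,
    (E.piP w).continuous_of_finiteDimensional.comp continuous_subtype_val⟩ with hπ
  -- The bubble compensates for the defect of `w` in the moment condition. The target moments stay
  -- those of `π`, since the bubble does not alter the projection.
  obtain ⟨m, hm⟩ := E.surjective_moment_bubble (E.moment (π - w))
  refine ⟨⟨w + E.bubble m, E.Wtilde.add_mem (E.W_le_Wtilde hw) (bubble_mem_Wtilde m), fun k => ?_⟩, ?_⟩
  · have h1 : E.moment (E.bubble m) k = E.moment (π - w) k := LinearMap.congr_fun hm k
    have h2 : E.moment (w + E.bubble m) k = E.moment π k := by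
      rw [map_add, LinearMap.add_apply, h1, ← LinearMap.add_apply, ← map_add, add_sub_cancel]
    rw [← moment_apply, h2, moment_apply]
    simp only [hw.1.piP_add (memH1_bubble m), piP_bubble, add_zero]
    exact integral_area fun x => E.piP w x * k x
  · rw [← hwv]
    funext j
    change w (E.q j) + E.bubble m (E.q j) = w (E.q j)
    rw [bubble_q, add_zero]

end

end PolygonalElement

theorem lemmaD2 (n : ℕ) (E : PolygonalElement n) :
    (∀ i : Fin n, ∃! ζ : E.Z, ∀ j : Fin n, (ζ : C(E.carrier, ℝ)) (E.q j) = if j = i then 1 else 0) ∧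
    Function.Bijective (E.dof.domRestrict E.Z) ∧
    Function.Bijective (E.dof.domRestrict E.W) := by
  have hZ : Function.Bijective (E.dof.domRestrict E.Z) := ⟨E.injective_dof_Z, E.surjective_dof_Z⟩
  refine ⟨fun i => ?_, hZ, E.injective_dof_W, E.surjective_dof_W⟩
  obtain ⟨ζ, h, huniq⟩ := hZ.existsUnique fun j => if j = i then 1 else 0
  exact ⟨ζ, fun j => congrFun h j, fun η hη => huniq η (funext hη)⟩
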